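/- All graphs are finite, nonnull and loopless, and multiple edges are allowed. For a graph $G$ let $\omega(G)$ denote its number of components. For a real number $t>0$, $G$ is called $t$-tough if $\omega(G\setminus S)\le \max\{1,\tfrac1t|S|\}$ for every $S\subseteq V(G)$. For a positive integer $m$, a graph is called $m$-tree-connected if it has $m$ pairwise edge-disjoint spanning trees. The degree of a vertex is the number of edges incident to it. Let $m\ge 1$ and $r\ge 2m$ be integers and let $t$ be a real number with $$t\ \ge\ \max\Big\{\frac{2m\,r}{r+1-2m},\ r\Big\}.$$ Then every $t$-tough graph $G$ of order $|V(G)|\ge r+1$ has an $m$-tree-connected spanning subgraph $H$ such that $d_H(v)\in\{r,r+1\}$ for every vertex $v$. -/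

import Mathlib

open scoped Graph

namespace Graph

variable {α β : Type*}

/-- The degree of a vertex: the number of edges incident with it, a loop being counted twice.
In a loopless graph this is the number of incident edges. -/
noncomputable def vertexDegree (G : Graph α β) (v : α) : ℕ :=
  (G.incidenceSet v).ncard + (G.loopSet v).ncard

/-- Two vertices are joined by a (possibly trivial) walk. -/
def Joined (G : Graph α β) (x y : α) : Prop :=
  x ∈ V(G) ∧ Relation.ReflTransGen G.Adj x y

/-- The vertex sets of the components of `G`. -/
def componentSets (G : Graph α β) : Set (Set α) :=
  {C | ∃ x ∈ V(G), C = {y | G.Joined x y}}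

/-- The number of components of a graph; the null graph has none. -/
noncomputable def numComponents (G : Graph α β) : ℕ :=
  G.componentSets.ncard

/-- A graph is connected if it is nonnull and any two of its vertices are joined by a walk. -/
def IsConnectedGraph (G : Graph α β) : Prop :=
  V(G).Nonempty ∧ ∀ x ∈ V(G), ∀ y ∈ V(G), G.Joined x y

/-- `G` contains a cycle of length `k + 1`: distinct vertices `v 0, …, v k` and distinct edges
`e 0, …, e k`, where `e i` joins `v i` and `v (i + 1)`, indices being taken modulo `k + 1`.
Loops are cycles of length one and pairs of parallel edges are cycles of length two. -/
def HasCycleOfLength (G : Graph α β) (k : ℕ) : Prop :=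
  ∃ (v : Fin (k + 1) → α) (e : Fin (k + 1) → β),
    Function.Injective v ∧ Function.Injective e ∧ ∀ i, G.IsLink (e i) (v i) (v (i + 1))

/-- A tree is a connected graph without cycles. -/
def IsTreeGraph (G : Graph α β) : Prop :=
  G.IsConnectedGraph ∧ ∀ k : ℕ, ¬ G.HasCycleOfLength k

/-- A graph is `m`-tree-connected if it has `m` pairwise edge-disjoint spanning trees. -/
def IsTreeConnected (m : ℕ) (G : Graph α β) : Prop :=
  ∃ T : Fin m → Graph α β,
    (∀ i, T i ≤s G ∧ (T i).IsTreeGraph) ∧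
      Pairwise fun i j => Disjoint E(T i) E(T j)

/-- A graph is `t`-tough if `ω(G ∖ S) ≤ max {1, |S| / t}` for every set `S` of vertices. -/
def IsTough (t : ℝ) (G : Graph α β) : Prop :=
  ∀ S ⊆ V(G), ((G.deleteVerts S).numComponents : ℝ) ≤ max 1 (1 / t * (S.ncard : ℝ))

end Graph

/-! The required subgraph is H = F ∪ M. All degrees of F are r, except that one vertex may have
degree r + 1; M is a matching of edges outside F that avoids this vertex. So all degrees of H are r
or r + 1. By Nash-Williams and Tutte (`exists_tree_packing`), H has m disjoint spanning trees as
soon as every partition of the vertices into k classes is crossed by at least m(k − 1) edges, which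
is `Tight m H univ`. Partitions are encoded by colourings throughout.

The factor F needs only t ≥ r. It comes from Tutte's f-factor theorem (`exists_factor`), whose
condition is checked in `palette_add_sum_sub_le` by cutting the graph around a greedily chosen
independent set.

The matching M minimises the largest value of m·(classes) − (crossing edges). If H is still not
tight, an augmentation argument (`exists_tight_or_barrier`) yields a barrier: a set S of saturated
vertices and a partition into parts such that edges outside F between different parts meet S, while
any k parts span at most m(k − 1) crossing edges of H. This rests on two facts: tight sets behave
like contracted vertices (`exists_merge`), and in a minimal tight set containing x and y any edge
can be traded for xy (`tight_exchange`).

Toughness forbids barriers (`barrier_contradiction`). A part with at most r vertices sends out at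
least r ≥ 2m edges, so it cannot account for the shortage of edges. Hence at least two parts have
more than r vertices and few outgoing edges. Deleting S and the ends, in those parts, of the edges
of F leaving them separates these parts from each other, at a cost bounded by their boundaries; the
bound t ≥ 2mr/(r + 1 − 2m) makes this cost too small. -/

namespace TreeFactor

open Finset

/-! ### Partition-connected vertex sets. -/

section PartitionConnectivity

variable {V : Type*} {κ κ' : Type*}

/-- The set of colours that the colouring `c` uses on `X`. -/
noncomputable def palette (X : Finset V) (c : V → κ) : Finset κ := by
  classical exact X.image c

@[simp] lemma mem_palette {X : Finset V} {c : V → κ} {a : κ} :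
    a ∈ palette X c ↔ ∃ x ∈ X, c x = a := by
  simp [palette]

lemma mem_palette_of_mem {X : Finset V} (c : V → κ) {x : V} (hx : x ∈ X) : c x ∈ palette X c :=
  mem_palette.2 ⟨x, hx, rfl⟩

lemma palette_mono {X Y : Finset V} (h : X ⊆ Y) (c : V → κ) : palette X c ⊆ palette Y c := by
  intro a ha
  obtain ⟨x, hx, rfl⟩ := mem_palette.1 ha
  exact mem_palette_of_mem c (h hx)

/-- The edges of `E` inside `X` whose ends have different colours. -/
noncomputable def crossSet (E : Finset (Sym2 V)) (X : Finset V) (c : V → κ) : Finset (Sym2 V) := by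
  classical exact {e ∈ E | e ∈ X.sym2 ∧ ¬ (e.map c).IsDiag}

@[simp] lemma mem_crossSet {E : Finset (Sym2 V)} {X : Finset V} {c : V → κ} {e : Sym2 V} :
    e ∈ crossSet E X c ↔ e ∈ E ∧ e ∈ X.sym2 ∧ ¬ (e.map c).IsDiag := by
  simp [crossSet]

/-- The number of edges of `E` inside `X` whose ends have different colours. -/
noncomputable def cross (E : Finset (Sym2 V)) (X : Finset V) (c : V → κ) : ℕ :=
  #(crossSet E X c)

lemma card_palette_le_of_imp {X : Finset V} {c : V → κ} {d : V → κ'}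
    (h : ∀ x ∈ X, ∀ y ∈ X, d x = d y → c x = c y) : #(palette X c) ≤ #(palette X d) := by
  refine Finset.card_le_card_of_forall_subsingleton (fun a k => ∃ x ∈ X, c x = a ∧ d x = k) ?_ ?_
  · intro a ha
    obtain ⟨x, hx, rfl⟩ := mem_palette.1 ha
    exact ⟨d x, mem_palette_of_mem d hx, x, hx, rfl, rfl⟩
  · rintro k - a ⟨-, x, hx, rfl, hk⟩ b ⟨-, y, hy, rfl, hk'⟩
    exact h x hx y hy (hk.trans hk'.symm)

lemma crossSet_mono_of_imp {E : Finset (Sym2 V)} {X : Finset V} {c : V → κ} {d : V → κ'}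
    (h : ∀ x ∈ X, ∀ y ∈ X, d x = d y → c x = c y) : crossSet E X c ⊆ crossSet E X d := by
  intro e
  induction e with | _ x y
  simp only [mem_crossSet, Sym2.map_mk, Sym2.mk_isDiag_iff, Finset.mk_mem_sym2_iff]
  rintro ⟨he, ⟨hx, hy⟩, hc⟩
  exact ⟨he, ⟨hx, hy⟩, fun hd => hc (h x hx y hy hd)⟩

lemma card_palette_congr {X : Finset V} {c : V → κ} {d : V → κ'}
    (h : ∀ x ∈ X, ∀ y ∈ X, d x = d y ↔ c x = c y) : #(palette X c) = #(palette X d) :=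
  (card_palette_le_of_imp fun x hx y hy => (h x hx y hy).1).antisymm
    (card_palette_le_of_imp fun x hx y hy => (h x hx y hy).2)

lemma cross_congr {E : Finset (Sym2 V)} {X : Finset V} {c : V → κ} {d : V → κ'}
    (h : ∀ x ∈ X, ∀ y ∈ X, d x = d y ↔ c x = c y) : cross E X c = cross E X d :=
  congrArg card ((crossSet_mono_of_imp fun x hx y hy => (h x hx y hy).1).antisymm
    (crossSet_mono_of_imp fun x hx y hy => (h x hx y hy).2))

lemma cross_mono_left {E E' : Finset (Sym2 V)} (h : E ⊆ E') (X : Finset V) (c : V → κ) :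
    cross E X c ≤ cross E' X c := by
  refine card_le_card fun e he => ?_
  rw [mem_crossSet] at he ⊢
  exact ⟨h he.1, he.2⟩

/-- Naming each class after one of its vertices moves any colouring into V. Thus `Tight`, which
quantifies only over colourings with values in V, applies to pairs, sets or vectors as colours. -/
lemma exists_vertex_coloring (c : V → κ) : ∃ d : V → V, ∀ x y, d x = d y ↔ c x = c y := by
  refine ⟨fun x => (⟨x, rfl⟩ : ∃ v, c v = c x).choose, fun x y => ?_⟩
  have hx := (⟨x, rfl⟩ : ∃ v, c v = c x).choose_spec
  have hy := (⟨y, rfl⟩ : ∃ v, c v = c y).choose_spec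
  constructor
  · intro h
    have h' : (⟨x, rfl⟩ : ∃ v, c v = c x).choose = (⟨y, rfl⟩ : ∃ v, c v = c y).choose := h
    rw [← hx, ← hy, h']
  · intro h
    simp only [h]

/-- `B` is `m`-partition-connected in the graph with edge set `E`. -/
def Tight (m : ℕ) (E : Finset (Sym2 V)) (B : Finset V) : Prop :=
  ∀ c : V → V, m * #(palette B c) ≤ cross E B c + m

variable {m : ℕ} {E E₁ E₂ : Finset (Sym2 V)} {B B₁ B₂ X : Finset V}

lemma Tight.le (h : Tight m E B) (c : V → κ) : m * #(palette B c) ≤ cross E B c + m := by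
  obtain ⟨d, hd⟩ := exists_vertex_coloring c
  rw [card_palette_congr (d := d) fun x _ y _ => hd x y, cross_congr (d := d) fun x _ y _ => hd x y]
  exact h d

lemma Tight.mono (h : Tight m E₁ B) (hE : E₁ ⊆ E₂) : Tight m E₂ B := fun c =>
  (h c).trans (Nat.add_le_add_right (cross_mono_left hE B c) m)

lemma card_palette_le_one_of_const {c : V → κ} (h : ∀ x ∈ X, ∀ y ∈ X, c x = c y) :
    #(palette X c) ≤ 1 := by
  rw [card_le_one]
  intro a ha b hb
  obtain ⟨x, hx, rfl⟩ := mem_palette.1 ha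
  obtain ⟨y, hy, rfl⟩ := mem_palette.1 hb
  exact h x hx y hy

lemma tight_singleton (m : ℕ) (E : Finset (Sym2 V)) (v : V) : Tight m E {v} := by
  intro c
  have h : #(palette {v} c) ≤ 1 := card_palette_le_one_of_const (by simp)
  calc m * #(palette {v} c) ≤ m * 1 := Nat.mul_le_mul_left m h
    _ ≤ _ := by omega

/-- Identify all the colours that `c` uses on `B`. -/
lemma exists_merge (hB : Tight m E B) (hBX : B ⊆ X) (c : V → κ) :
    ∃ c' : V → κ, (∀ x y, c x = c y → c' x = c' y) ∧ (∀ x ∈ B, ∀ y ∈ B, c' x = c' y) ∧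
      m * #(palette X c) + cross E X c' ≤ m * #(palette X c') + cross E X c ∧
      (#(palette X c') < #(palette X c) ∨ ∀ x ∈ B, ∀ y ∈ B, c x = c y) := by
  classical
  rcases B.eq_empty_or_nonempty with rfl | ⟨b, hb⟩
  · exact ⟨c, fun _ _ h => h, by simp, le_rfl, Or.inr (by simp)⟩
  set c' : V → κ := fun v => if c v ∈ palette B c then c b else c v with hc'
  have hpal : palette X c' = insert (c b) (palette X c \ palette B c) := by
    ext a
    simp only [mem_palette, mem_insert, mem_sdiff, hc']
    constructor
    · rintro ⟨x, hx, rfl⟩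
      split_ifs with h
      · exact Or.inl rfl
      · exact Or.inr ⟨⟨x, hx, rfl⟩, h⟩
    · rintro (rfl | ⟨⟨x, hx, rfl⟩, h⟩)
      · exact ⟨b, hBX hb, by rw [if_pos ⟨b, hb, rfl⟩]⟩
      · exact ⟨x, hx, by rw [if_neg h]⟩
  have hcard : #(palette X c') + #(palette B c) = #(palette X c) + 1 := by
    rw [hpal, card_insert_of_notMem (by simpa using fun _ _ _ => ⟨b, hb, rfl⟩)]
    have := card_sdiff_add_card_eq_card (palette_mono hBX c)
    omega
  -- The edges inside B that cross for c are lost on merging. Tightness makes them at least m times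
  -- the number of colours lost, so m·colours − crossing edges does not drop.
  have hcross : cross E X c' + cross E B c ≤ cross E X c := by
    unfold cross
    rw [← card_union_of_disjoint]
    · refine card_le_card ?_
      intro e
      induction e with | _ x y
      simp only [mem_union, mem_crossSet, Sym2.map_mk, Sym2.mk_isDiag_iff, Finset.mk_mem_sym2_iff]
      rintro (⟨he, hxy, hne⟩ | ⟨he, hxy, hne⟩)
      · exact ⟨he, hxy, fun h => hne (by simp only [hc', h])⟩
      · exact ⟨he, ⟨hBX hxy.1, hBX hxy.2⟩, hne⟩
    · rw [disjoint_left]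
      intro e
      induction e with | _ x y
      simp only [mem_crossSet, Sym2.map_mk, Sym2.mk_isDiag_iff, Finset.mk_mem_sym2_iff]
      rintro ⟨-, -, hne⟩ ⟨-, hxy, -⟩
      refine hne ?_
      simp only [hc', if_pos (mem_palette_of_mem c hxy.1), if_pos (mem_palette_of_mem c hxy.2)]
  refine ⟨c', fun x y h => by simp only [hc', h], fun x hx y hy => ?_, ?_, ?_⟩
  · simp only [hc', if_pos (mem_palette_of_mem c hx), if_pos (mem_palette_of_mem c hy)]
  · have h1 := hB.le c
    have h2 : m * #(palette X c') + m * #(palette B c) = m * #(palette X c) + m := by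
      rw [← Nat.mul_add, hcard, Nat.mul_add, Nat.mul_one]
    omega
  · by_cases h : #(palette B c) ≤ 1
    · right
      intro x hx y hy
      exact card_le_one.1 h _ (mem_palette_of_mem c hx) _ (mem_palette_of_mem c hy)
    · left
      omega

/-- A colouring constant on B cannot see the edges inside B. -/
lemma cross_le_of_agree {c : V → κ} (hc : ∀ x ∈ B, ∀ y ∈ B, c x = c y)
    (hE : ∀ e, e ∉ B.sym2 → e ∈ E₁ → e ∈ E₂) : cross E₁ X c ≤ cross E₂ X c := by
  refine card_le_card ?_
  intro e
  induction e with | _ x y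
  simp only [mem_crossSet, Sym2.map_mk, Sym2.mk_isDiag_iff, Finset.mk_mem_sym2_iff]
  rintro ⟨he, hxy, hne⟩
  exact ⟨hE _ (fun h => hne (hc x (Finset.mk_mem_sym2_iff.1 h).1 y (Finset.mk_mem_sym2_iff.1 h).2))
    he, hxy, hne⟩

/-- Partition-connectivity of `X` does not depend on the edges inside a tight subset. -/
lemma Tight.replace (hX : Tight m E₁ X) (hBX : B ⊆ X) (hB : Tight m E₂ B)
    (hE : ∀ e, e ∉ B.sym2 → e ∈ E₁ → e ∈ E₂) : Tight m E₂ X := by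
  intro c
  obtain ⟨c', -, hconst, hle, -⟩ := exists_merge hB hBX c
  have h1 := hX.le c'
  have h2 : cross E₁ X c' ≤ cross E₂ X c' := cross_le_of_agree hconst hE
  omega

/-- Merge the colours of B₁, then those of B₂: the common vertex makes the result constant on the
union, and neither merge decreased m·colours − crossing edges. -/
lemma Tight.union [DecidableEq V] (h₁ : Tight m E B₁) (h₂ : Tight m E B₂)
    (h : (B₁ ∩ B₂).Nonempty) : Tight m E (B₁ ∪ B₂) := by
  intro c
  obtain ⟨c₁, -, hc₁, hle₁, -⟩ := exists_merge h₁ (subset_union_left (s₂ := B₂)) c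
  obtain ⟨c₂, himp, hc₂, hle₂, -⟩ := exists_merge h₂ (subset_union_right (s₁ := B₁)) c₁
  obtain ⟨b, hb⟩ := h
  rw [mem_inter] at hb
  have hb' : ∀ x ∈ B₁ ∪ B₂, c₂ x = c₂ b := by
    intro x hx
    rcases mem_union.1 hx with hx | hx
    · exact himp _ _ (hc₁ x hx b hb.1)
    · exact hc₂ x hx b hb.2
  have h1 : m * #(palette (B₁ ∪ B₂) c₂) ≤ m * 1 := Nat.mul_le_mul_left m <|
    card_palette_le_one_of_const fun x hx y hy => (hb' x hx).trans (hb' y hy).symm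
  omega

/-- The colour classes of an optimal colouring are tight. -/
lemma tight_class_of_optimal (c : V → κ)
    (hopt : ∀ d : V → V, m * #(palette X d) + cross E X c ≤ m * #(palette X c) + cross E X d)
    {b : V} (hb : b ∈ X) (hB : ∀ x, x ∈ B ↔ x ∈ X ∧ c x = c b) : Tight m E B := by
  classical
  intro d
  -- This refines c by d on the class of b only; `none` keeps every other class whole.
  set f : V → κ × Option V := fun v => (c v, if c v = c b then some (d v) else none) with hf
  obtain ⟨g, hg⟩ := exists_vertex_coloring f
  have h1 := hopt g
  rw [← card_palette_congr (c := f) fun x _ y _ => hg x y,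
    ← cross_congr (c := f) fun x _ y _ => hg x y] at h1
  have h2 : #(palette X c) + #(palette B d) ≤ #(palette X f) + 1 := by
    have hsub : ((palette X c).erase (c b)).image (fun a => (a, none)) ∪
        (palette B d).image (fun v => (c b, some v)) ⊆ palette X f := by
      intro p hp
      rw [mem_union, mem_image, mem_image] at hp
      rcases hp with ⟨a, ha, rfl⟩ | ⟨v, hv, rfl⟩
      · obtain ⟨hne, ha⟩ := mem_erase.1 ha
        obtain ⟨x, hx, rfl⟩ := mem_palette.1 ha
        exact mem_palette.2 ⟨x, hx, by simp only [hf, if_neg hne]⟩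
      · obtain ⟨x, hx, rfl⟩ := mem_palette.1 hv
        obtain ⟨hx, hcx⟩ := (hB x).1 hx
        exact mem_palette.2 ⟨x, hx, by simp only [hf, hcx, if_true]⟩
    have hle := card_le_card hsub
    rw [card_union_of_disjoint, card_image_of_injective, card_image_of_injective,
      card_erase_of_mem (mem_palette_of_mem c hb)] at hle
    · omega
    · intro a a' h
      simpa using h
    · intro a a' h
      simpa using h
    · rw [disjoint_left]
      intro p hp hp'
      rw [mem_image] at hp hp'
      obtain ⟨a, -, rfl⟩ := hp
      obtain ⟨v, -, hv⟩ := hp'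
      simp at hv
  have h3 : cross E X f ≤ cross E X c + cross E B d := by
    unfold cross
    refine (card_le_card ?_).trans (card_union_le _ _)
    intro e
    induction e with | _ x y
    simp only [mem_union, mem_crossSet, Sym2.map_mk, Sym2.mk_isDiag_iff, Finset.mk_mem_sym2_iff, hB]
    rintro ⟨he, hxy, hne⟩
    by_cases hcxy : c x = c y
    · by_cases hcx : c x = c b
      · exact Or.inr ⟨he, ⟨⟨hxy.1, hcx⟩, hxy.2, hcxy ▸ hcx⟩,
          fun h => hne (by simp only [hf, hcxy, h])⟩
      · exact absurd (by simp only [hf, ← hcxy, if_neg hcx]) hne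
    · exact Or.inl ⟨he, hxy, hcxy⟩
  have h4 := Nat.mul_le_mul_left m h2
  rw [Nat.mul_add, Nat.mul_add] at h4
  omega

section Deficit

variable [Fintype V] [DecidableEq V]

/-- The deficit of `E` with respect to `m`-partition-connectivity, shifted by `m`. -/
noncomputable def deficit (m : ℕ) (E : Finset (Sym2 V)) : ℤ :=
  (univ : Finset (V → V)).sup' ⟨id, mem_univ _⟩
    fun c => (m : ℤ) * #(palette univ c) - cross E univ c

lemma le_deficit (c : V → V) : (m : ℤ) * #(palette univ c) - cross E univ c ≤ deficit m E := by
  exact Finset.le_sup' (fun c : V → V => (m : ℤ) * #(palette univ c) - cross E univ c) (mem_univ c)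

lemma exists_eq_deficit (m : ℕ) (E : Finset (Sym2 V)) :
    ∃ c : V → V, (m : ℤ) * #(palette univ c) - cross E univ c = deficit m E := by
  obtain ⟨c, -, hc⟩ := Finset.exists_mem_eq_sup' (s := (univ : Finset (V → V))) ⟨id, mem_univ _⟩
    fun c => (m : ℤ) * #(palette univ c) - cross E univ c
  exact ⟨c, hc.symm⟩

/-- Merging on B turns an optimal colouring for E₁ into one that is equally good and ignores all
edges inside B. -/
lemma deficit_le_of_agree (hB : Tight m E₁ B) (hE : ∀ e, e ∉ B.sym2 → e ∈ E₂ → e ∈ E₁) :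
    deficit m E₁ ≤ deficit m E₂ := by
  obtain ⟨c, hc⟩ := exists_eq_deficit m E₁
  obtain ⟨c', -, hconst, hle, -⟩ := exists_merge hB (subset_univ B) c
  have h1 : cross E₂ univ c' ≤ cross E₁ univ c' := cross_le_of_agree hconst hE
  have h2 := le_deficit (m := m) (E := E₂) c'
  zify at hle h1
  linarith

/-- An edge that does not lower the deficit joins two vertices of a tight set. -/
lemma exists_tight_of_deficit_le {x y : V} (he : s(x, y) ∉ E)
    (h : deficit m E ≤ deficit m (insert s(x, y) E)) : ∃ B, x ∈ B ∧ y ∈ B ∧ Tight m E B := by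
  classical
  obtain ⟨c, hc⟩ := exists_eq_deficit m (insert s(x, y) E)
  have hmono := cross_mono_left (subset_insert s(x, y) E) univ c
  have hle := le_deficit (m := m) (E := E) c
  -- The colouring c, optimal after the edge is added, is at most as good as the optimum before; so
  -- the new edge cannot cross it.
  have hxy : c x = c y := by
    by_contra hne
    have hlt : cross E univ c < cross (insert s(x, y) E) univ c := by
      refine card_lt_card ⟨fun e he => ?_, fun hsub => he ?_⟩
      · rw [mem_crossSet] at he ⊢
        exact ⟨mem_insert_of_mem he.1, he.2⟩
      · exact (mem_crossSet.1 (hsub (mem_crossSet.2 ⟨mem_insert_self _ _, by simp, by simpa⟩))).1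
    zify at hlt
    linarith
  refine ⟨({v | c v = c x} : Finset V), by simp, by simp [hxy], ?_⟩
  refine tight_class_of_optimal (X := univ) c ?_ (mem_univ x) (by simp)
  intro d
  have := le_deficit (m := m) (E := E) d
  zify at hmono ⊢
  linarith

end Deficit

/-- In a minimal tight set containing `x` and `y`, every edge can be exchanged for `s(x, y)`. -/
lemma tight_exchange [DecidableEq V] {D : Finset V} {x y : V} (hD : Tight m E D)
    (hx : x ∈ D) (hy : y ∈ D) (he : s(x, y) ∉ E)
    (hmin : ∀ D' ⊂ D, x ∈ D' → y ∈ D' → ¬ Tight m E D') {f : Sym2 V} (hf : f ∈ D.sym2) :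
    Tight m (insert s(x, y) (E.erase f)) D := by
  classical
  by_contra hnot
  unfold Tight at hnot
  push Not at hnot
  obtain ⟨c, hc⟩ := hnot
  have h1 := hD.le c
  have hsub : crossSet (E.erase f) D c ⊆ crossSet (insert s(x, y) (E.erase f)) D c := by
    intro e he
    rw [mem_crossSet] at he ⊢
    exact ⟨mem_insert_of_mem he.1, he.2⟩
  have herase : crossSet (E.erase f) D c = (crossSet E D c).erase f := by
    ext e
    simp only [mem_crossSet, mem_erase]
    tauto
  have h2 := card_le_card hsub
  rw [herase] at h2 hsub
  have h3 := Finset.pred_card_le_card_erase (s := crossSet E D c) (a := f)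
  have hlt : cross (insert s(x, y) (E.erase f)) D c < cross E D c := by omega
  have hle : cross E D c ≤ cross (insert s(x, y) (E.erase f)) D c + 1 := by
    unfold cross; omega
  -- Since c violates the bound only after the exchange, f crosses and s(x, y) does not. Before the
  -- exchange c meets the bound with equality, hence is optimal on D, and its class containing x and
  -- y is a smaller tight set.
  have hfc : f ∈ crossSet E D c := by
    by_contra hfc
    rw [Finset.erase_eq_of_notMem hfc] at h2
    unfold cross at hlt
    omega
  have hxy : c x = c y := by
    by_contra hne
    have : insert s(x, y) ((crossSet E D c).erase f) ⊆
        crossSet (insert s(x, y) (E.erase f)) D c := by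
      refine insert_subset ?_ hsub
      rw [mem_crossSet]
      exact ⟨mem_insert_self _ _, by simp [hx, hy], by simpa⟩
    have := card_le_card this
    rw [card_insert_of_notMem (by simp [he]), card_erase_of_mem hfc] at this
    unfold cross at hlt
    omega
  refine hmin ({v ∈ D | c v = c x} : Finset V) ?_ (by simp [hx]) (by simp [hy, hxy]) ?_
  · refine ⟨filter_subset _ _, fun hsub => ?_⟩
    have hconst : ∀ v ∈ D, c v = c x := fun v hv => (mem_filter.1 (hsub hv)).2
    revert hfc
    induction f with | _ a b
    rw [Finset.mk_mem_sym2_iff] at hf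
    simp [hconst a hf.1, hconst b hf.2]
  · refine tight_class_of_optimal (X := D) c ?_ hx (by simp)
    intro d
    have := hD d
    omega

/-- If `X` is not tight, then this is witnessed by a colouring which is constant on every tight
subset of `X`. -/
lemma exists_coarse_witness (hX : ¬ Tight m E X) :
    ∃ c : V → V, cross E X c + m < m * #(palette X c) ∧
      ∀ B ⊆ X, Tight m E B → ∀ x ∈ B, ∀ y ∈ B, c x = c y := by
  classical
  unfold Tight at hX
  push Not at hX
  -- Take a violating colouring with the fewest colours. Merging a tight subset preserves the
  -- violation, so it cannot reduce the number of colours.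
  have hne : ∃ k, ∃ c : V → V, #(palette X c) = k ∧ cross E X c + m < m * #(palette X c) :=
    hX.elim fun c hc => ⟨_, c, rfl, hc⟩
  obtain ⟨c, hck, hc⟩ := Nat.find_spec hne
  refine ⟨c, hc, fun B hBX hB => ?_⟩
  obtain ⟨c', -, -, hle, h | h⟩ := exists_merge hB hBX c
  · exact absurd ⟨c', rfl, by omega⟩ (Nat.find_min hne (hck ▸ h))
  · exact h

end PartitionConnectivity

end TreeFactor

namespace TreeFactor

open Finset

/-! ### Augmenting a degree-constrained edge set; barriers. -/

section LocalSearch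

variable {V : Type*} {κ κ' : Type*} {m : ℕ} {E E₁ E₂ : Finset (Sym2 V)} {B D X : Finset V}

lemma Tight.congr_inside (h : Tight m E₁ B) (hE : ∀ e ∈ B.sym2, e ∈ E₁ → e ∈ E₂) :
    Tight m E₂ B := fun c => by
  refine (h c).trans (Nat.add_le_add_right (card_le_card fun e he => ?_) m)
  rw [mem_crossSet] at he ⊢
  exact ⟨hE e he.2.1 he.1, he.2⟩

/-- Refining the colouring `c` by the colouring `p`, one class of `c` at a time. -/
lemma cross_add_le_of_refine {p : V → κ} {c : V → κ'} (hX : ∀ x ∈ X, ∀ y ∈ X, p x = p y → c x = c y)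
    (h : ∀ b ∈ X, ∀ Y : Finset V, (∀ y, y ∈ Y ↔ y ∈ X ∧ c y = c b) →
      cross E Y p + m ≤ m * #(palette Y p)) :
    cross E X p + m * #(palette X c) ≤ cross E X c + m * #(palette X p) := by
  classical
  set Y : κ' → Finset V := fun a => {x ∈ X | c x = a} with hY
  have h1 : cross E X p ≤ cross E X c + ∑ a ∈ palette X c, cross E (Y a) p := by
    have hsub : crossSet E X p ⊆
        crossSet E X c ∪ (palette X c).biUnion fun a => crossSet E (Y a) p := by
      intro e
      induction e with | _ x y
      simp only [mem_union, mem_biUnion, mem_crossSet, Sym2.map_mk, Sym2.mk_isDiag_iff,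
        Finset.mk_mem_sym2_iff]
      rintro ⟨he, hxy, hne⟩
      by_cases hc : c x = c y
      · exact Or.inr ⟨c x, mem_palette_of_mem c hxy.1, he, by simp [hY, hxy, hc], hne⟩
      · exact Or.inl ⟨he, hxy, hc⟩
    exact (card_le_card hsub).trans ((card_union_le _ _).trans
      (Nat.add_le_add_left card_biUnion_le _))
  have h2 : ∑ a ∈ palette X c, #(palette (Y a) p) ≤ #(palette X p) := by
    rw [← card_biUnion]
    · refine card_le_card fun k hk => ?_
      obtain ⟨a, -, hk⟩ := mem_biUnion.1 hk
      exact palette_mono (filter_subset _ _) p hk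
    · intro a _ b _ hab
      rw [Function.onFun, disjoint_left]
      intro k hk hk'
      obtain ⟨x, hx, rfl⟩ := mem_palette.1 hk
      obtain ⟨y, hy, hxy⟩ := mem_palette.1 hk'
      rw [hY, mem_filter] at hx hy
      exact hab (by rw [← hx.2, ← hy.2, hX y hy.1 x hx.1 hxy])
  have h3 : ∑ a ∈ palette X c, (cross E (Y a) p + m) ≤ ∑ a ∈ palette X c, m * #(palette (Y a) p) := by
    refine sum_le_sum fun a ha => ?_
    obtain ⟨b, hb, rfl⟩ := mem_palette.1 ha
    exact h b hb _ (by simp [hY])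
  rw [sum_add_distrib, sum_const, smul_eq_mul, ← mul_sum] at h3
  have h4 := Nat.mul_le_mul_left m h2
  rw [Nat.mul_comm _ m] at h3
  omega

/-- The number of edges of `M` at the vertex `v`. -/
noncomputable def edgeDegree (M : Finset (Sym2 V)) (v : V) : ℕ := by
  classical exact #{e ∈ M | v ∈ e}

lemma edgeDegree_eq [DecidableEq V] (M : Finset (Sym2 V)) (v : V) :
    edgeDegree M v = #{e ∈ M | v ∈ e} := by
  unfold edgeDegree
  congr

lemma edgeDegree_congr {M M' : Finset (Sym2 V)} {v : V} (h : ∀ e, v ∈ e → (e ∈ M ↔ e ∈ M')) :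
    edgeDegree M v = edgeDegree M' v := by
  classical
  rw [edgeDegree_eq, edgeDegree_eq]
  congr 1
  ext e
  simp only [mem_filter]
  exact ⟨fun ⟨h1, h2⟩ => ⟨(h e h2).1 h1, h2⟩, fun ⟨h1, h2⟩ => ⟨(h e h2).2 h1, h2⟩⟩

lemma edgeDegree_mono {M M' : Finset (Sym2 V)} (h : M ⊆ M') (v : V) :
    edgeDegree M v ≤ edgeDegree M' v := by
  classical
  rw [edgeDegree_eq, edgeDegree_eq]
  exact card_le_card (filter_subset_filter _ h)

variable [DecidableEq V]

lemma edgeDegree_erase {M : Finset (Sym2 V)} {f : Sym2 V} (hf : f ∈ M) {v : V} (hv : v ∈ f) :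
    edgeDegree (M.erase f) v + 1 = edgeDegree M v := by
  rw [edgeDegree_eq, edgeDegree_eq, filter_erase]
  exact card_erase_add_one (mem_filter.2 ⟨hf, hv⟩)

lemma edgeDegree_insert {M : Finset (Sym2 V)} {f : Sym2 V} (hf : f ∉ M) (v : V) :
    edgeDegree (insert f M) v = edgeDegree M v + if v ∈ f then 1 else 0 := by
  rw [edgeDegree_eq, edgeDegree_eq, filter_insert]
  split_ifs with h
  · rw [card_insert_of_notMem (by simp [hf])]
  · rfl

lemma edgeDegree_pos {M : Finset (Sym2 V)} {f : Sym2 V} (hf : f ∈ M) {v : V} (hv : v ∈ f) :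
    0 < edgeDegree M v := by
  rw [edgeDegree_eq, card_pos]
  exact ⟨f, mem_filter.2 ⟨hf, hv⟩⟩

/-- `M` is a set of edges from `A` with at most `cap v` edges at each vertex `v`. -/
def Admissible (A : Finset (Sym2 V)) (cap : V → ℕ) (M : Finset (Sym2 V)) : Prop :=
  M ⊆ A ∧ ∀ v, edgeDegree M v ≤ cap v

variable {A F M : Finset (Sym2 V)} {cap : V → ℕ}

/-- By changing `M` inside `D` only, and keeping `D` tight, the vertex `x` can be made
unsaturated. -/
def Freed (m : ℕ) (A F M : Finset (Sym2 V)) (cap : V → ℕ) (D : Finset V) (x : V) : Prop :=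
  ∃ M', Admissible A cap M' ∧ (∀ e, e ∉ D.sym2 → (e ∈ M' ↔ e ∈ M)) ∧ Tight m (F ∪ M') D ∧
    edgeDegree M' x < cap x

/-- A tight set in which the ends of all edges of `M` can be freed. -/
def Good (m : ℕ) (A F M : Finset (Sym2 V)) (cap : V → ℕ) (D : Finset V) : Prop :=
  D.Nonempty ∧ Tight m (F ∪ M) D ∧ ∀ f ∈ M, f ∈ D.sym2 → ∀ x ∈ f, Freed m A F M cap D x

/-- The change happens inside B, which stays tight, and by `Tight.replace` the larger set D does not
notice it. -/
lemma Freed.mono {x : V} (h : Freed m A F M cap B x) (hBD : B ⊆ D) (hD : Tight m (F ∪ M) D) :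
    Freed m A F M cap D x := by
  obtain ⟨M', hM', hag, ht, hx⟩ := h
  refine ⟨M', hM', fun e he => hag e fun h => he (Finset.sym2_mono hBD h), ?_, hx⟩
  refine hD.replace hBD ht fun e he hmem => ?_
  rw [mem_union] at hmem ⊢
  rwa [hag e he]

lemma good_singleton (hA : ∀ e ∈ A, ¬ e.IsDiag) (hM : Admissible A cap M) (v : V) :
    Good m A F M cap {v} := by
  refine ⟨singleton_nonempty v, tight_singleton _ _ _, fun f hf hfv => ?_⟩
  refine absurd ?_ (hA f (hM.1 hf))
  revert hfv
  induction f with | _ a b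
  rw [Finset.mk_mem_sym2_iff, mem_singleton, mem_singleton, Sym2.mk_isDiag_iff]
  exact fun h => h.1.trans h.2.symm

/-- An edge of M inside one of the two sets is freed there. An edge inside the union but in neither
set can simply be deleted: both sets stay tight, hence so does their union. -/
lemma Good.union {B₁ B₂ : Finset V} (hM : Admissible A cap M) (h₁ : Good m A F M cap B₁)
    (h₂ : Good m A F M cap B₂) (h : (B₁ ∩ B₂).Nonempty) : Good m A F M cap (B₁ ∪ B₂) := by
  have ht := h₁.2.1.union h₂.2.1 h
  refine ⟨h₁.1.mono subset_union_left, ht, fun f hf hfB x hx => ?_⟩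
  by_cases hf₁ : f ∈ B₁.sym2
  · exact (h₁.2.2 f hf hf₁ x hx).mono subset_union_left ht
  by_cases hf₂ : f ∈ B₂.sym2
  · exact (h₂.2.2 f hf hf₂ x hx).mono subset_union_right ht
  refine ⟨M.erase f, ⟨(erase_subset _ _).trans hM.1, fun v =>
    (edgeDegree_mono (erase_subset _ _) v).trans (hM.2 v)⟩, ?_, ?_, ?_⟩
  · intro e he
    rw [mem_erase, and_iff_right]
    rintro rfl
    exact he hfB
  · refine Tight.union (h₁.2.1.congr_inside ?_) (h₂.2.1.congr_inside ?_) h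
    all_goals
      intro e he hmem
      rw [mem_union] at hmem ⊢
      refine hmem.imp_right fun h => mem_erase.2 ⟨?_, h⟩
      rintro rfl
      contradiction
  · have := edgeDegree_erase hf hx
    have := hM.2 x
    omega

variable [Fintype V]

/-- The largest good set containing `x`. -/
noncomputable def part (m : ℕ) (A F M : Finset (Sym2 V)) (cap : V → ℕ) (x : V) : Finset V := by
  classical exact {y | ∃ D, Good m A F M cap D ∧ x ∈ D ∧ y ∈ D}

lemma mem_part {x y : V} :
    y ∈ part m A F M cap x ↔ ∃ D, Good m A F M cap D ∧ x ∈ D ∧ y ∈ D := by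
  simp [part]

lemma Good.subset_part {x : V} (h : Good m A F M cap D) (hx : x ∈ D) :
    D ⊆ part m A F M cap x := fun _ hy => mem_part.2 ⟨D, h, hx, hy⟩

lemma self_mem_part (hA : ∀ e ∈ A, ¬ e.IsDiag) (hM : Admissible A cap M) (x : V) :
    x ∈ part m A F M cap x :=
  mem_part.2 ⟨{x}, good_singleton hA hM x, mem_singleton_self x, mem_singleton_self x⟩

/-- Good sets sharing a vertex have a good union, so a largest good set through x absorbs all
others. Singletons are good, so the parts partition the vertices. -/
lemma good_part (hA : ∀ e ∈ A, ¬ e.IsDiag) (hM : Admissible A cap M) (x : V) :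
    Good m A F M cap (part m A F M cap x) := by
  classical
  obtain ⟨D, hD, hmax⟩ := Finset.exists_max_image
    ({D | Good m A F M cap D ∧ x ∈ D} : Finset (Finset V)) card
    ⟨{x}, by simpa using good_singleton hA hM x⟩
  rw [mem_filter_univ] at hD
  have : part m A F M cap x = D := by
    refine Subset.antisymm (fun y hy => ?_) (hD.1.subset_part hD.2)
    obtain ⟨D', hD', hx, hy⟩ := mem_part.1 hy
    have hU := hD.1.union hM hD' ⟨x, mem_inter.2 ⟨hD.2, hx⟩⟩
    have hle := hmax (D ∪ D') (by rw [mem_filter_univ]; exact ⟨hU, mem_union_left _ hD.2⟩)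
    rw [Finset.eq_of_subset_of_card_le subset_union_left hle]
    exact mem_union_right _ hy
  rw [this]
  exact hD.1

lemma part_eq_of_mem (hA : ∀ e ∈ A, ¬ e.IsDiag) (hM : Admissible A cap M) {x y : V}
    (h : y ∈ part m A F M cap x) : part m A F M cap y = part m A F M cap x := by
  have h1 := (good_part (m := m) (F := F) hA hM x).subset_part h
  refine Subset.antisymm ?_ h1
  exact (good_part (m := m) (F := F) hA hM y).subset_part (h1 (self_mem_part hA hM x))

/-- `x` can be freed inside its part. -/
def Reachable (m : ℕ) (A F M : Finset (Sym2 V)) (cap : V → ℕ) (x : V) : Prop :=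
  Freed m A F M cap (part m A F M cap x) x

/-- If `M` is optimal, then an unused edge of `A` whose ends can be freed lies inside a part. -/
lemma mem_part_of_reachable (hA : ∀ e ∈ A, ¬ e.IsDiag) (hAF : Disjoint A F)
    (hM : Admissible A cap M)
    (hopt : ∀ M', Admissible A cap M' → deficit m (F ∪ M) ≤ deficit m (F ∪ M')) {x y : V}
    (hx : Reachable m A F M cap x) (hy : Reachable m A F M cap y) (hxyA : s(x, y) ∈ A)
    (hxyM : s(x, y) ∉ M) : y ∈ part m A F M cap x := by
  classical
  by_contra hxy
  have hBg := good_part (m := m) (F := F) hA hM x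
  have hBg' := good_part (m := m) (F := F) hA hM y
  have hxB := self_mem_part (m := m) (F := F) hA hM x
  have hyB := self_mem_part (m := m) (F := F) hA hM y
  have hmaxB : ∀ D, Good m A F M cap D → x ∈ D → D ⊆ part m A F M cap x := fun D hD hx =>
    hD.subset_part hx
  have hdisj : ∀ z, z ∈ part m A F M cap x → z ∉ part m A F M cap y := by
    intro z hz hz'
    apply hxy
    rw [← part_eq_of_mem hA hM hz, part_eq_of_mem hA hM hz']
    exact hyB
  obtain ⟨M₁, hM₁, hag₁, ht₁, hx₁⟩ := hx
  obtain ⟨M₂, hM₂, hag₂, ht₂, hy₂⟩ := hy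
  generalize part m A F M cap x = B at *
  generalize part m A F M cap y = B' at *
  have hdisj2 : ∀ e ∈ B.sym2, e ∉ B'.sym2 := by
    intro e
    induction e with | _ a b
    simp only [Finset.mk_mem_sym2_iff]
    exact fun h h' => hdisj a h.1 h'.1
  -- The two parts are disjoint, so both changes can be made at once: N leaves x and y unsaturated
  -- and keeps both parts tight.
  set N : Finset (Sym2 V) := {e ∈ A | (e ∈ B.sym2 ∧ e ∈ M₁) ∨ (e ∈ B'.sym2 ∧ e ∈ M₂) ∨
    (e ∉ B.sym2 ∧ e ∉ B'.sym2 ∧ e ∈ M)} with hN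
  have hNB : ∀ e, e ∉ B'.sym2 → (e ∈ N ↔ e ∈ M₁) := by
    intro e he
    rw [hN, mem_filter]
    by_cases heB : e ∈ B.sym2
    · simp only [heB, he]
      simpa using fun h => hM₁.1 h
    · simp only [heB, he, hag₁ e heB]
      simpa using fun h => hM.1 h
  have hNB' : ∀ e, e ∉ B.sym2 → (e ∈ N ↔ e ∈ M₂) := by
    intro e he
    rw [hN, mem_filter]
    by_cases heB : e ∈ B'.sym2
    · simp only [heB, he]
      simpa using fun h => hM₂.1 h
    · simp only [heB, he, hag₂ e heB]
      simpa using fun h => hM.1 h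
  have hNdeg : ∀ v, v ∉ B' → edgeDegree N v = edgeDegree M₁ v := fun v hv =>
    edgeDegree_congr fun e he => hNB e fun h => hv (Finset.mem_sym2_iff.1 h v he)
  have hNdeg' : ∀ v, v ∉ B → edgeDegree N v = edgeDegree M₂ v := fun v hv =>
    edgeDegree_congr fun e he => hNB' e fun h => hv (Finset.mem_sym2_iff.1 h v he)
  have hNt : Tight m (F ∪ N) B := ht₁.congr_inside fun e he hmem => by
    rw [mem_union] at hmem ⊢
    rwa [hNB e (hdisj2 e he)]
  have hNt' : Tight m (F ∪ N) B' := ht₂.congr_inside fun e he hmem => by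
    rw [mem_union] at hmem ⊢
    rwa [hNB' e fun h => hdisj2 e h he]
  have heB : s(x, y) ∉ B.sym2 := fun h => hxy (Finset.mk_mem_sym2_iff.1 h).2
  have heB' : s(x, y) ∉ B'.sym2 := fun h => hdisj x hxB (Finset.mk_mem_sym2_iff.1 h).1
  have heN : s(x, y) ∉ N := by
    rw [hNB _ heB', hag₁ _ heB]
    exact hxyM
  have heFN : s(x, y) ∉ F ∪ N := by
    rw [mem_union, not_or]
    exact ⟨fun h => (disjoint_left.1 hAF) hxyA h, heN⟩
  have hne : x ≠ y := fun h => hA _ hxyA (by simp [h])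
  have hadd : Admissible A cap (insert s(x, y) N) := by
    refine ⟨insert_subset hxyA (filter_subset _ _), fun v => ?_⟩
    rw [edgeDegree_insert heN]
    by_cases hvB : v ∈ B
    · rw [hNdeg v (hdisj v hvB)]
      split_ifs with hv
      · rcases Sym2.mem_iff.1 hv with rfl | rfl
        · exact hx₁
        · exact absurd hvB hxy
      · exact hM₁.2 v
    · rw [hNdeg' v hvB]
      split_ifs with hv
      · rcases Sym2.mem_iff.1 hv with rfl | rfl
        · exact absurd hxB hvB
        · exact hy₂
      · exact hM₂.2 v
  -- N is no worse than M because it differs from M only inside sets that are tight for it.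
  -- Optimality of M then says that adding s(x, y) to N gains nothing, so x and y lie in a common
  -- tight set.
  have hdef : deficit m (F ∪ N) ≤ deficit m (insert s(x, y) (F ∪ N)) := by
    have h1 : deficit m (F ∪ M₁) ≤ deficit m (F ∪ M) :=
      deficit_le_of_agree ht₁ fun e he hmem => by
        rw [mem_union] at hmem ⊢
        rwa [hag₁ e he]
    have h2 : deficit m (F ∪ N) ≤ deficit m (F ∪ M₁) :=
      deficit_le_of_agree hNt' fun e he hmem => by
        rw [mem_union] at hmem ⊢
        rwa [hNB e he]
    have h3 := hopt _ hadd
    rw [union_insert] at h3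
    exact h2.trans (h1.trans h3)
  obtain ⟨D₀, hD₀⟩ := exists_tight_of_deficit_le heFN hdef
  obtain ⟨D, hD, hDmin⟩ := Finset.exists_min_image
    ({D | x ∈ D ∧ y ∈ D ∧ Tight m (F ∪ N) D} : Finset (Finset V)) card
    ⟨D₀, by rw [mem_filter_univ]; exact hD₀⟩
  rw [mem_filter_univ] at hD
  obtain ⟨hxD, hyD, hDt⟩ := hD
  have hmin : ∀ D' ⊂ D, x ∈ D' → y ∈ D' → ¬ Tight m (F ∪ N) D' := by
    intro D' hD' h1 h2 h3
    have := hDmin D' (by rw [mem_filter_univ]; exact ⟨h1, h2, h3⟩)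
    exact absurd (card_lt_card hD') (by omega)
  have hunion : ∀ E, Tight m E D → Tight m E B → Tight m E B' → Tight m E (D ∪ B ∪ B') :=
    fun E h1 h2 h3 => (h1.union h2 ⟨x, mem_inter.2 ⟨hxD, hxB⟩⟩).union h3
      ⟨y, mem_inter.2 ⟨mem_union_left _ hyD, hyB⟩⟩
  have hUN := hunion _ hDt hNt hNt'
  have hBU : B ⊆ D ∪ B ∪ B' := subset_union_right.trans subset_union_left
  have hU : Tight m (F ∪ M) (D ∪ B ∪ B') := by
    have h1 : Tight m (F ∪ M₁) B' := hBg'.2.1.congr_inside fun e he hmem => by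
      rw [mem_union] at hmem ⊢
      rwa [hag₁ e fun h => hdisj2 e h he]
    have h2 : Tight m (F ∪ M₁) (D ∪ B ∪ B') :=
      hUN.replace subset_union_right h1 fun e he hmem => by
        rw [mem_union] at hmem ⊢
        rwa [← hNB e he]
    refine h2.replace hBU hBg.2.1 fun e he hmem => ?_
    rw [mem_union] at hmem ⊢
    rwa [← hag₁ e he]
  have heU : s(x, y) ∈ (D ∪ B ∪ B').sym2 := by simp [hxD, hyD]
  have hgood : Good m A F M cap (D ∪ B ∪ B') := by
    refine ⟨⟨x, by simp [hxD]⟩, hU, fun f hf hfU v hv => ?_⟩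
    by_cases hfB : f ∈ B.sym2
    · exact (hBg.2.2 f hf hfB v hv).mono hBU hU
    by_cases hfB' : f ∈ B'.sym2
    · exact (hBg'.2.2 f hf hfB' v hv).mono subset_union_right hU
    -- Here f lies in neither part and is traded for s(x, y). Minimality of D keeps D tight, and an
    -- end of f has one edge fewer than in `insert s(x, y) N`, which is admissible; so this end is
    -- freed. Hence the union is good, contradicting the maximality of the part of x.
    have hfN : f ∈ N := by rwa [hNB f hfB', hag₁ f hfB]
    have heN' : s(x, y) ∉ N.erase f := fun h => heN (mem_of_mem_erase h)
    have hin : ∀ C : Finset V, f ∉ C.sym2 → ∀ e ∈ C.sym2, e ∈ F ∪ N →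
        e ∈ F ∪ insert s(x, y) (N.erase f) := by
      intro C hfC e he hmem
      rw [mem_union] at hmem ⊢
      refine hmem.imp_right fun h => mem_insert_of_mem (mem_erase.2 ⟨?_, h⟩)
      rintro rfl
      exact hfC he
    have hsub : insert s(x, y) (N.erase f) ⊆ insert s(x, y) N :=
      insert_subset_insert _ (erase_subset _ _)
    refine ⟨insert s(x, y) (N.erase f), ⟨hsub.trans hadd.1, fun w =>
      (edgeDegree_mono hsub w).trans (hadd.2 w)⟩, fun e he => ?_, ?_, ?_⟩
    · have h1 : e ≠ s(x, y) := by rintro rfl; exact he heU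
      have h2 : e ≠ f := by rintro rfl; exact he hfU
      rw [mem_insert, mem_erase, or_iff_right h1, and_iff_right h2,
        hNB e fun h => he (Finset.sym2_mono subset_union_right h),
        hag₁ e fun h => he (Finset.sym2_mono hBU h)]
    · refine hunion _ ?_ (hNt.congr_inside (hin B hfB)) (hNt'.congr_inside (hin B' hfB'))
      by_cases hfD : f ∈ D.sym2
      · refine (tight_exchange hDt hxD hyD heFN hmin hfD).mono ?_
        intro e he
        rw [mem_insert, mem_erase, mem_union] at he
        rw [mem_union, mem_insert, mem_erase]
        tauto
      · exact hDt.congr_inside (hin D hfD)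
    · have h1 := edgeDegree_insert heN' v
      have h2 := edgeDegree_insert heN v
      have h3 := edgeDegree_erase hfN hv
      have h4 := hadd.2 v
      omega
  exact hxy (hmaxB _ hgood (by simp [hxD]) (by simp [hyD]))

/-- The edges of `F ∪ M` between parts are sparse. -/
lemma cross_part_le (hA : ∀ e ∈ A, ¬ e.IsDiag) (hM : Admissible A cap M) (X : Finset V)
    (hX : X.Nonempty) (hpart : ∀ x ∈ X, part m A F M cap x ⊆ X) :
    cross (F ∪ M) X (part m A F M cap) + m ≤ m * #(palette X (part m A F M cap)) := by
  induction hn : #X using Nat.strong_induction_on generalizing X with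
  | _ n ih =>
  subst hn
  set p := part m A F M cap with hp
  have hself : ∀ x, x ∈ p x := self_mem_part hA hM
  by_cases hconst : ∀ x ∈ X, ∀ y ∈ X, p x = p y
  · have h0 : cross (F ∪ M) X p = 0 := by
      rw [cross, card_eq_zero, eq_empty_iff_forall_notMem]
      intro e
      induction e with | _ x y
      simp only [mem_crossSet, Sym2.map_mk, Sym2.mk_isDiag_iff, Finset.mk_mem_sym2_iff]
      exact fun h => h.2.2 (hconst x h.2.1.1 y h.2.1.2)
    have h1 : 1 ≤ #(palette X p) := card_pos.2 (hX.elim fun x hx => ⟨_, mem_palette_of_mem p hx⟩)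
    have := Nat.mul_le_mul_left m h1
    omega
  obtain ⟨c, hc, hlt, hcp⟩ : ∃ c : V → V, cross (F ∪ M) X c + m ≤ m * #(palette X c) ∧
      m < m * #(palette X c) ∧ ∀ x ∈ X, ∀ y ∈ p x, c y = c x := by
    by_cases ht : Tight m (F ∪ M) X
    · have hng : ¬ Good m A F M cap X := fun hg => hconst fun x hx y hy =>
        (part_eq_of_mem hA hM (hg.subset_part hx hy)).symm
      -- X is tight but not good. Deleting f would free x, so it must destroy tightness; restoring f
      -- adds at most one crossing edge to the violating colouring, which turns the strict
      -- inequality into a weak one.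
      obtain ⟨f, hf, hfX, x, hxf, hx⟩ : ∃ f ∈ M, f ∈ X.sym2 ∧ ∃ x ∈ f, ¬ Freed m A F M cap X x := by
        by_contra! h
        exact hng ⟨hX, ht, h⟩
      have hnt : ¬ Tight m (F ∪ M.erase f) X := fun ht' => hx ⟨M.erase f,
        ⟨(erase_subset _ _).trans hM.1, fun v =>
          (edgeDegree_mono (erase_subset _ _) v).trans (hM.2 v)⟩,
        fun e he => by
          rw [mem_erase, and_iff_right]
          rintro rfl
          exact he hfX, ht', by
          have := edgeDegree_erase hf hxf
          have := hM.2 x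
          omega⟩
      obtain ⟨c, hc, hcB⟩ := exists_coarse_witness hnt
      refine ⟨c, ?_, by omega, fun y hy z hz => ?_⟩
      · have hle : cross (F ∪ M) X c ≤ cross (F ∪ M.erase f) X c + 1 := by
          refine (card_le_card (t := insert f (crossSet (F ∪ M.erase f) X c)) fun e he => ?_).trans
            (card_insert_le _ _)
          rw [mem_insert, mem_crossSet, mem_union, mem_erase]
          rw [mem_crossSet, mem_union] at he
          tauto
        omega
      -- No part contains f, since x would be freed inside it; hence each part stays tight without f
      -- and is monochromatic.
      · have hg := good_part (m := m) (F := F) hA hM y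
        refine hcB (p y) (hpart y hy) (hg.2.1.congr_inside fun e he hmem => ?_) z hz y (hself y)
        rw [mem_union] at hmem ⊢
        refine hmem.imp_right fun h => mem_erase.2 ⟨?_, h⟩
        rintro rfl
        exact hx ((hg.2.2 e hf he x hxf).mono (hpart y hy) ht)
    · obtain ⟨c, hc, hcB⟩ := exists_coarse_witness ht
      exact ⟨c, hc.le, by omega, fun y hy z hz =>
        hcB (p y) (hpart y hy) (good_part (m := m) (F := F) hA hM y).2.1 z hz y (hself y)⟩
  have hc2 : ∃ a ∈ X, ∃ b ∈ X, c a ≠ c b := by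
    by_contra! h
    have := Nat.mul_le_mul_left m (card_palette_le_one_of_const h)
    omega
  have href := cross_add_le_of_refine (E := F ∪ M) (m := m) (X := X) (p := p) (c := c)
    (fun x hx y hy hxy => hcp y hy x (hxy ▸ hself x)) (fun b hb Y hY => by
      refine ih #Y (card_lt_card ⟨fun y hy => ((hY y).1 hy).1, fun hsub => ?_⟩) Y
        ⟨b, (hY b).2 ⟨hb, rfl⟩⟩ (fun x hx y hy => ?_) rfl
      · obtain ⟨a, ha, a', ha', hne⟩ := hc2
        exact hne (((hY a).1 (hsub ha)).2.trans ((hY a').1 (hsub ha')).2.symm)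
      · obtain ⟨hxX, hxb⟩ := (hY x).1 hx
        exact (hY y).2 ⟨hpart x hxX hy, (hcp x hxX y hy).trans hxb⟩)
  omega

/-- Either the graph `F` can be made `m`-partition-connected by adding a degree-constrained set of
edges from `A`, or there is a barrier: a set `S` of saturated vertices and a partition, given by
the colouring `p`, such that edges of `A` between different parts meet `S`. -/
theorem exists_tight_or_barrier (hA : ∀ e ∈ A, ¬ e.IsDiag) (hAF : Disjoint A F)
    (hcap : ∀ v, cap v ≤ 1) : ∃ M, Admissible A cap M ∧ (Tight m (F ∪ M) univ ∨
      ∃ (S : Finset V) (p : V → Finset V),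
        (∀ x, x ∈ p x) ∧ (∀ x, ∀ y ∈ p x, p y = p x) ∧
        (∀ x ∈ S, edgeDegree M x = cap x) ∧
        (∀ x ∈ S, ∀ y, s(x, y) ∈ M → p x ≠ p y) ∧
        (∀ x y, x ∉ S → y ∉ S → s(x, y) ∈ A → p x = p y) ∧
        (∀ X : Finset V, X.Nonempty → (∀ x ∈ X, p x ⊆ X) →
          cross (F ∪ M) X p + m ≤ m * #(palette X p)) ∧
        cross (F ∪ M) univ p + m < m * #(palette univ p)) := by
  classical
  obtain ⟨M, hM, hopt⟩ := Finset.exists_min_image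
    ({M | Admissible A cap M} : Finset (Finset (Sym2 V))) (fun M => deficit m (F ∪ M))
    ⟨∅, by rw [mem_filter_univ]; exact ⟨empty_subset _, by simp [edgeDegree]⟩⟩
  rw [mem_filter_univ] at hM
  replace hopt : ∀ M', Admissible A cap M' → deficit m (F ∪ M) ≤ deficit m (F ∪ M') :=
    fun M' hM' => hopt M' (by rwa [mem_filter_univ])
  refine ⟨M, hM, or_iff_not_imp_left.2 fun hnt => ?_⟩
  set p := part m A F M cap with hp
  have hself : ∀ x, x ∈ p x := self_mem_part hA hM
  have heq : ∀ x, ∀ y ∈ p x, p y = p x := fun x y hy => part_eq_of_mem hA hM hy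
  have hgood : ∀ x, Good m A F M cap (p x) := good_part hA hM
  -- S consists of the vertices that cannot be freed within their part.
  refine ⟨({x | ¬ Reachable m A F M cap x} : Finset V), p, hself, heq, fun x hx => ?_,
    fun x hx y hxy hpxy => ?_, fun x y hx hy hxy => ?_, fun X hX hX' => cross_part_le hA hM X hX hX',
    ?_⟩
  · rw [mem_filter_univ] at hx
    refine (hM.2 x).antisymm (not_lt.1 fun hlt => hx ?_)
    exact ⟨M, hM, fun _ _ => Iff.rfl, (hgood x).2.1, hlt⟩
  · rw [mem_filter_univ] at hx
    refine hx ((hgood x).2.2 _ hxy ?_ x (Sym2.mem_mk_left x y))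
    rw [Finset.mk_mem_sym2_iff]
    exact ⟨hself x, hpxy ▸ hself y⟩
  · rw [mem_filter_univ, not_not] at hx hy
    suffices h : y ∈ p x from (heq x y h).symm
    by_cases hxyM : s(x, y) ∈ M
    · by_contra hy'
      obtain ⟨M', -, hag, -, hlt⟩ := hx
      -- An edge of M leaving the part of x survives the change that frees x. It already uses up the
      -- capacity of x, which is at most one.
      have hmem : s(x, y) ∈ M' := by
        rw [hag]
        · exact hxyM
        · rw [Finset.mk_mem_sym2_iff]
          exact fun h => hy' h.2
      have := edgeDegree_pos hmem (Sym2.mem_mk_left x y)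
      have := hcap x
      omega
    · exact mem_part_of_reachable hA hAF hM hopt hx hy hxy hxyM
  -- A violating colouring constant on parts is refined to the partition into parts; sparsity inside
  -- each of its classes preserves the violation.
  · obtain ⟨c, hc, hcB⟩ := exists_coarse_witness hnt
    have href := cross_add_le_of_refine (E := F ∪ M) (m := m) (X := univ) (p := p) (c := c)
      (fun x _ y _ hxy => hcB (p x) (subset_univ _) (hgood x).2.1 x (hself x) y (hxy ▸ hself y))
      (fun b _ Y hY => cross_part_le hA hM Y ⟨b, (hY b).2 ⟨mem_univ _, rfl⟩⟩ fun x hx y hy =>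
        (hY y).2 ⟨mem_univ _, (hcB (p x) (subset_univ _) (hgood x).2.1 y hy x (hself x)).trans
          ((hY x).1 hx).2⟩)
    omega

end LocalSearch

end TreeFactor

namespace TreeFactor

open Finset

/-! ### Tough graphs have no barriers. -/

section Counting

variable {V : Type*} [DecidableEq V]

lemma sum_edgeDegree (K : Finset (Sym2 V)) (X : Finset V) :
    ∑ x ∈ X, edgeDegree K x = ∑ e ∈ K, #{x ∈ X | x ∈ e} := by
  simp_rw [edgeDegree_eq, card_filter]
  exact sum_comm

lemma edgeDegree_union {F M : Finset (Sym2 V)} (h : Disjoint F M) (v : V) :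
    edgeDegree (F ∪ M) v = edgeDegree F v + edgeDegree M v := by
  rw [edgeDegree_eq, edgeDegree_eq, edgeDegree_eq, filter_union, card_union_of_disjoint]
  exact disjoint_filter_filter h

variable [Fintype V]

/-- Deleting `S` from `Γ` leaves at most `|S| / t` components, unless it leaves at most one;
components are counted by colourings that are constant on the edges that remain. -/
def ToughColoring (Γ : SimpleGraph V) (t : ℝ) : Prop :=
  ∀ (S : Finset V) (c : V → V), (∀ x y, x ∉ S → y ∉ S → Γ.Adj x y → c x = c y) →
    2 ≤ #(palette Sᶜ c) → t * #(palette Sᶜ c) ≤ #S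

lemma ToughColoring.le {Γ : SimpleGraph V} {t : ℝ} (h : ToughColoring Γ t) (ht : 0 ≤ t)
    {κ : Type*} (S : Finset V) (c : V → κ)
    (hc : ∀ x y, x ∉ S → y ∉ S → Γ.Adj x y → c x = c y) {k : ℕ} (hk : 2 ≤ k)
    (hkc : k ≤ #(palette Sᶜ c)) : t * k ≤ #S := by
  obtain ⟨d, hd⟩ := exists_vertex_coloring c
  rw [card_palette_congr (d := d) fun x _ y _ => hd x y] at hkc
  refine le_trans ?_ (h S d (fun x y hx hy hxy => (hd x y).2 (hc x y hx hy hxy)) (hk.trans hkc))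
  gcongr

lemma card_filter_mem_sym2 {e : Sym2 V} (he : ¬ e.IsDiag) : #{x | x ∈ e} = 2 := by
  rw [← Sym2.card_toFinset_of_not_isDiag e he]
  congr 1
  ext x
  simp

lemma sum_edgeDegree_univ {K : Finset (Sym2 V)} (hK : ∀ e ∈ K, ¬ e.IsDiag) :
    ∑ x, edgeDegree K x = 2 * #K := by
  rw [sum_edgeDegree, sum_congr rfl fun e he => card_filter_mem_sym2 (hK e he), sum_const,
    smul_eq_mul, Nat.mul_comm]

/-- An edge inside X counts twice on the left; any other edge counts at most once there and at least
once in the sum over the complement. -/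
lemma sum_edgeDegree_le {K : Finset (Sym2 V)} (hK : ∀ e ∈ K, ¬ e.IsDiag) (X : Finset V) :
    ∑ x ∈ X, edgeDegree K x ≤ 2 * #{e ∈ K | e ∈ X.sym2} + ∑ x ∈ Xᶜ, edgeDegree K x := by
  rw [sum_edgeDegree, sum_edgeDegree, card_filter, mul_sum, ← sum_add_distrib]
  refine sum_le_sum fun e he => ?_
  have h2 := card_filter_mem_sym2 (hK e he)
  have hle : #{x ∈ X | x ∈ e} + #{x ∈ Xᶜ | x ∈ e} = 2 := by
    rw [← h2, ← card_union_of_disjoint]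
    · congr 1
      ext x
      simp only [mem_union, mem_filter, mem_compl, mem_univ, true_and]
      tauto
    · rw [disjoint_left]
      simp only [mem_filter, mem_compl]
      tauto
  split_ifs with h
  · omega
  · have : 0 < #{x ∈ Xᶜ | x ∈ e} := by
      rw [card_pos]
      rw [Finset.mem_sym2_iff] at h
      push Not at h
      obtain ⟨x, hx, hxX⟩ := h
      exact ⟨x, by simp [hx, hxX]⟩
    omega

/-- The edges from x into its own part lead to distinct vertices of that part other than x; here it
matters that the graph is simple. -/
lemma edgeDegree_le_of_part {H : Finset (Sym2 V)} (hH : ∀ e ∈ H, ¬ e.IsDiag)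
    {p : V → Finset V} (hself : ∀ x, x ∈ p x) (x : V) :
    edgeDegree H x + 1 ≤ edgeDegree (crossSet H univ p) x + #(p x) := by
  rw [edgeDegree_eq, edgeDegree_eq]
  have hsub : ({e ∈ H | x ∈ e} : Finset (Sym2 V)) ⊆
      ({e ∈ crossSet H univ p | x ∈ e} : Finset (Sym2 V)) ∪
        ((p x).erase x).image fun y => s(x, y) := by
    intro e he
    obtain ⟨he, hxe⟩ := mem_filter.1 he
    obtain ⟨y, rfl⟩ := Sym2.mem_iff_exists.1 hxe
    rw [mem_union, mem_filter, mem_crossSet, mem_image]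
    by_cases h : p x = p y
    · refine Or.inr ⟨y, mem_erase.2 ⟨?_, h ▸ hself y⟩, rfl⟩
      rintro rfl
      exact hH _ he (by simp)
    · exact Or.inl ⟨⟨he, by simp, by simpa⟩, hxe⟩
  have h1 := (card_le_card hsub).trans ((card_union_le _ _).trans
    (Nat.add_le_add_left card_image_le _))
  have h2 := card_erase_add_one (hself x)
  omega

lemma sum_parts {p : V → Finset V} (hp : ∀ x y, y ∈ p x ↔ p y = p x) (f : V → ℕ)
    {Q : Finset (Finset V)} (hQ : Q ⊆ palette univ p) :
    ∑ B ∈ Q, ∑ x ∈ B, f x = ∑ x with p x ∈ Q, f x := by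
  rw [← sum_fiberwise_of_maps_to (s := ({x | p x ∈ Q} : Finset V)) (t := Q) (g := p)
    (fun x hx => (mem_filter.1 hx).2) f]
  refine sum_congr rfl fun B hB => ?_
  obtain ⟨b, -, rfl⟩ := mem_palette.1 (hQ hB)
  refine sum_congr ?_ fun _ _ => rfl
  ext x
  rw [mem_filter, mem_filter_univ, hp]
  exact ⟨fun h => ⟨by rwa [h], h⟩, fun h => h.2⟩

/-- The arithmetic that fixes the bound on t. K counts parts with large boundary, k large parts with
small boundary, N the total boundary of both kinds, and q = r + 1 − 2m. -/
lemma count_contradiction {m q r K k N : ℤ} (hm : 1 ≤ m) (hq : 1 ≤ q) (hr : r + 1 = 2 * m + q)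
    (hK : 0 ≤ K) (h₁ : N + 2 * m + 2 ≤ 2 * m * K + 2 * m * k)
    (h₂ : K = 0 ∨ 2 * (r + 1) * K - 2 - 2 * m * K + 2 * m ≤ N) (hN : 0 ≤ N)
    (h₃ : 2 * m * r * k ≤ (N + 1) * q) : False := by
  obtain rfl : r = 2 * m + q - 1 := by linarith
  have hr0 : 0 ≤ 2 * m + q - 1 := by linarith
  have h4 := mul_le_mul_of_nonneg_left h₁ hr0
  -- Multiply `h₁` by r and bound 2mrk by `h₃`; the coefficient of N is r − q = 2m − 1.
  have h5 : (2 * m - 1) * N + (2 * m + q - 1) * (2 * m + 2) - q ≤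
      2 * m * (2 * m + q - 1) * K := by nlinarith
  have h6 : 0 ≤ (2 * m + q - 1) * (2 * m + 2) - q - 1 := by nlinarith
  rcases h₂ with rfl | h₂
  · have : 0 ≤ (2 * m - 1) * N := mul_nonneg (by linarith) hN
    linarith
  · have h7 := mul_le_mul_of_nonneg_left h₂ (show 0 ≤ 2 * m - 1 by linarith)
    -- Once `h₂` is multiplied by 2m − 1, the coefficients of K differ by exactly 2q(m − 1).
    have h8 : 0 ≤ q * (m - 1) * K := mul_nonneg (mul_nonneg (by linarith) (by linarith)) hK
    have h9 : 0 ≤ (2 * m - 1) * (m - 1) := mul_nonneg (by linarith) (by linarith)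
    nlinarith

lemma count_contradiction_nat {m q r K k a c : ℕ} (hm : 1 ≤ m) (hr : r + 1 = 2 * m + 1 + q)
    (h₁ : a + c + 2 * m + 2 ≤ 2 * m * K + 2 * m * k) (h₂ : K = 0 ∨ a + 2 * m ≤ 2 * m * K + c)
    (h₃ : (r + 1) * K ≤ a + 1) (h₄ : 2 * m * r * k ≤ (a + c + 1) * (q + 1)) : False := by
  zify at *
  refine count_contradiction (m := m) (q := q + 1) (r := r) (K := K) (k := k) (N := a + c) hm
    (by omega) (by omega) (by omega) h₁ ?_ (by omega) h₄
  rcases h₂ with h | h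
  · exact Or.inl h
  · exact Or.inr (by linarith)

/-- There is no barrier in a tough graph. -/
lemma barrier_contradiction {Γ : SimpleGraph V} {m r : ℕ} {t : ℝ} (hm : 1 ≤ m) (hr : 2 * m ≤ r)
    (ht : 2 * (m : ℝ) * r ≤ t * (r + 1 - 2 * m)) (htough : ToughColoring Γ t)
    {F H K : Finset (Sym2 V)} (hFH : F ⊆ H) (hHd : ∀ e ∈ H, ¬ e.IsDiag)
    (hHr : ∀ v, edgeDegree H v = r ∨ edgeDegree H v = r + 1)
    {S : Finset V} {p : V → Finset V} (hself : ∀ x, x ∈ p x) (heq : ∀ x, ∀ y ∈ p x, p y = p x)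
    (hK : K = crossSet H univ p) {u : V → ℕ} (hu1 : ∑ x, u x ≤ 1)
    (hSone : ∀ x ∈ S, 1 ≤ edgeDegree K x + u x) (hSdeg : ∀ x ∈ S, edgeDegree H x = r + 1)
    (hAp : ∀ x y, x ∉ S → y ∉ S → Γ.Adj x y → s(x, y) ∉ F → p x = p y)
    (hsparse : ∀ X : Finset V, X.Nonempty → (∀ x ∈ X, p x ⊆ X) →
      cross H X p + m ≤ m * #(palette X p))
    (hlt : cross H univ p + m < m * #(palette univ p)) : False := by
  classical
  have hp : ∀ x y, y ∈ p x ↔ p y = p x := fun x y => ⟨heq x y, fun h => h ▸ hself y⟩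
  have hKd : ∀ e ∈ K, ¬ e.IsDiag := fun e he => hHd e (mem_crossSet.1 (hK ▸ he)).1
  obtain ⟨P, hP⟩ : ∃ P, P = palette univ p := ⟨_, rfl⟩
  obtain ⟨d, hd⟩ : ∃ d : Finset V → ℕ, ∀ B, d B = ∑ x ∈ B, edgeDegree K x := ⟨_, fun _ => rfl⟩
  obtain ⟨w, hw⟩ : ∃ w : Finset V → ℕ, ∀ B, w B = ∑ x ∈ B, u x := ⟨_, fun _ => rfl⟩
  rw [← hP] at hlt
  have hKmem : ∀ x y, s(x, y) ∈ H → p x ≠ p y → 0 < edgeDegree K x := fun x y hxy hne =>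
    edgeDegree_pos (hK ▸ mem_crossSet.2 ⟨hxy, by simp, by simpa⟩) (Sym2.mem_mk_left x y)
  -- the boundary of a small part
  have hsmall : ∀ B ∈ P, #B ≤ r → r + #{x ∈ B | x ∈ S} ≤ d B := by
    intro B hB hBr
    obtain ⟨b, -, rfl⟩ := mem_palette.1 (hP ▸ hB)
    have hpos : 1 ≤ #(p b) := card_pos.2 ⟨b, hself b⟩
    have h1 : ∑ x ∈ p b, (r + 1 + if x ∈ S then 1 else 0) ≤
        ∑ x ∈ p b, (edgeDegree K x + #(p b)) := by
      refine sum_le_sum fun x hx => ?_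
      have h2 := edgeDegree_le_of_part hHd hself x
      rw [heq b x hx, ← hK] at h2
      split_ifs with hxS
      · have := hSdeg x hxS
        omega
      · rcases hHr x with h | h <;> omega
    simp only [sum_add_distrib, sum_const, smul_eq_mul, ← card_filter] at h1
    obtain ⟨k, hk⟩ := Nat.exists_eq_add_of_le hBr
    obtain ⟨l, hl⟩ := Nat.exists_eq_add_of_le hpos
    rw [hd]
    rw [hl] at h1 hk
    -- For a part of size b this is b(r + 1 − b) − r = (b − 1)(r − b), which is nonnegative for 1 ≤
    -- b ≤ r.
    have h3 : (1 + l) * r + (1 + l) * 1 = (1 + l) * (1 + l) + r + l * k := by rw [hk]; ring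
    have h4 : 0 ≤ l * k := Nat.zero_le _
    omega
  -- Three kinds of parts: `PA` has large boundary, `PB` consists of small parts and `PC` of large
  -- parts with small boundary. The weight w corrects for the possible vertex of degree r + 1 in F,
  -- which need not have an edge of K.
  obtain ⟨PA, hPA⟩ : ∃ Q : Finset (Finset V), Q = {B ∈ P | r + 1 ≤ d B + w B} := ⟨_, rfl⟩
  obtain ⟨PB, hPB⟩ : ∃ Q : Finset (Finset V), Q = {B ∈ P | d B + w B ≤ r ∧ #B ≤ r} := ⟨_, rfl⟩
  obtain ⟨PC, hPC⟩ : ∃ Q : Finset (Finset V), Q = {B ∈ P | d B + w B ≤ r ∧ r + 1 ≤ #B} := ⟨_, rfl⟩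
  have hPcard : #P = #PA + #PB + #PC := by
    rw [hPA, hPB, hPC, card_filter, card_filter, card_filter, ← sum_add_distrib, ← sum_add_distrib,
      card_eq_sum_ones]
    refine sum_congr rfl fun B _ => ?_
    split_ifs <;> omega
  have hPsum : ∀ f : Finset V → ℕ, ∑ B ∈ P, f B = ∑ B ∈ PA, f B + ∑ B ∈ PB, f B + ∑ B ∈ PC, f B := by
    intro f
    rw [hPA, hPB, hPC, sum_filter, sum_filter, sum_filter, ← sum_add_distrib, ← sum_add_distrib]
    refine sum_congr rfl fun B _ => ?_
    split_ifs <;> omega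
  have hPuniv : ∀ f : V → ℕ, ∑ B ∈ P, ∑ x ∈ B, f x = ∑ x, f x := by
    intro f
    rw [sum_parts hp f (hP ▸ Subset.refl P)]
    refine sum_congr ?_ fun _ _ => rfl
    ext x
    simp only [mem_filter_univ, mem_univ, iff_true, hP]
    exact mem_palette_of_mem p (mem_univ x)
  have hdB : ∀ B ∈ PB, d B = r ∧ ∀ x ∈ B, x ∉ S := by
    intro B hB
    obtain ⟨hBP, h1, h2⟩ := mem_filter.1 (hPB ▸ hB)
    have h3 := hsmall B hBP h2
    have h4 : #{x ∈ B | x ∈ S} = 0 := by omega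
    refine ⟨by omega, fun x hx hxS => ?_⟩
    rw [card_eq_zero, filter_eq_empty_iff] at h4
    exact h4 hx hxS
  obtain ⟨DA, hDA⟩ : ∃ n, n = ∑ B ∈ PA, d B := ⟨_, rfl⟩
  obtain ⟨DC, hDC⟩ : ∃ n, n = ∑ B ∈ PC, d B := ⟨_, rfl⟩
  have hDA' : DA = ∑ B ∈ PA, ∑ x ∈ B, edgeDegree K x := by simp only [hDA, hd]
  have hDC' : DC = ∑ B ∈ PC, ∑ x ∈ B, edgeDegree K x := by simp only [hDC, hd]
  have hDB' : ∑ B ∈ PB, d B = ∑ B ∈ PB, ∑ x ∈ B, edgeDegree K x := by simp only [hd]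
  have hPAP : PA ⊆ P := hPA ▸ filter_subset _ _
  have hPBP : PB ⊆ P := hPB ▸ filter_subset _ _
  have hPCP : PC ⊆ P := hPC ▸ filter_subset _ _
  have hmA : ∀ B ∈ PA, r + 1 ≤ d B + w B := fun B hB => by
    rw [hPA] at hB; exact (mem_filter.1 hB).2
  have hmB : ∀ B ∈ PB, d B + w B ≤ r := fun B hB => by
    rw [hPB] at hB; exact (mem_filter.1 hB).2.1
  have hmC : ∀ B ∈ PC, d B + w B ≤ r ∧ r + 1 ≤ #B := fun B hB => by
    rw [hPC] at hB; exact (mem_filter.1 hB).2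
  have hABC : ∀ x, p x ∈ PA ∨ p x ∈ PB ∨ p x ∈ PC := by
    intro x
    have hxP := hP ▸ mem_palette_of_mem p (mem_univ x)
    simp only [hPA, hPB, hPC, mem_filter, hxP, true_and]
    omega
  have hDB : ∑ B ∈ PB, d B = r * #PB := by
    rw [sum_congr rfl fun B hB => (hdB B hB).1, sum_const, smul_eq_mul, Nat.mul_comm]
  have htotal : 2 * cross H univ p = DA + r * #PB + DC := by
    rw [cross, ← hK, ← sum_edgeDegree_univ hKd, ← hPuniv, hPsum, ← hDA', ← hDC', ← hDB', hDB]
  have hwsum : ∑ B ∈ PA, w B + ∑ B ∈ PC, w B ≤ 1 := by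
    have h1 : ∑ B ∈ P, w B = ∑ x, u x := by rw [← hPuniv]; simp only [hw]
    have := hPsum w
    omega
  have hDAge : (r + 1) * #PA ≤ DA + 1 := by
    have h1 : ∑ B ∈ PA, (r + 1) ≤ ∑ B ∈ PA, (d B + w B) :=
      sum_le_sum hmA
    rw [sum_const, smul_eq_mul, sum_add_distrib, Nat.mul_comm] at h1
    omega
  have h2m : 2 * m * #PB ≤ r * #PB := Nat.mul_le_mul_right _ hr
  -- Double the violated inequality; each part in `PB` contributes r ≥ 2m on the left and 2m on the
  -- right, so it drops out.
  have hmain : DA + DC + 2 * m + 2 ≤ 2 * m * #PA + 2 * m * #PC := by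
    rw [hPcard] at hlt
    have : m * (#PA + #PB + #PC) = m * #PA + m * #PB + m * #PC := by ring
    have : 2 * m * #PA = 2 * (m * #PA) := by ring
    have : 2 * m * #PB = 2 * (m * #PB) := by ring
    have : 2 * m * #PC = 2 * (m * #PC) := by ring
    omega
  -- the parts with large boundary are sparsely connected to each other
  have hlow : #PA = 0 ∨ DA + 2 * m ≤ 2 * m * #PA + DC := by
    rcases Nat.eq_zero_or_pos #PA with h0 | hpos
    · exact Or.inl h0
    right
    obtain ⟨Q, hQ⟩ : ∃ Q, Q = PA ∪ PB := ⟨_, rfl⟩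
    have hQP : Q ⊆ palette univ p := hP ▸ hQ ▸ union_subset hPAP hPBP
    obtain ⟨X, hX⟩ : ∃ X : Finset V, X = ({x | p x ∈ Q} : Finset V) := ⟨_, rfl⟩
    have hXne : X.Nonempty := by
      obtain ⟨B, hB⟩ := card_pos.1 hpos
      obtain ⟨b, -, rfl⟩ := mem_palette.1 (hQP (hQ ▸ mem_union_left _ hB))
      exact ⟨b, by rw [hX, mem_filter_univ, hQ]; exact mem_union_left _ hB⟩
    have h1 := hsparse X hXne (fun x hx y hy => by
      rw [hX, mem_filter_univ] at hx ⊢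
      rwa [heq x y hy])
    have hpal : palette X p = Q := by
      ext B
      rw [mem_palette]
      constructor
      · rintro ⟨x, hx, rfl⟩
        rwa [hX, mem_filter_univ] at hx
      · intro hB
        obtain ⟨b, -, rfl⟩ := mem_palette.1 (hQP hB)
        exact ⟨b, by rwa [hX, mem_filter_univ], rfl⟩
    have hdisj : Disjoint PA PB := by
      rw [disjoint_left]
      intro B hB hB'
      have h1 := hmA B hB
      have h2 := hmB B hB'
      omega
    rw [hpal, hQ, card_union_of_disjoint hdisj] at h1
    have h2 := sum_edgeDegree_le hKd X
    have h2' : ∑ x ∈ X, edgeDegree K x = DA + r * #PB := by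
      rw [hX, ← sum_parts hp (edgeDegree K) hQP, hQ, sum_union hdisj, ← hDA', ← hDB', hDB]
    have hcompl : Xᶜ = ({x | p x ∈ PC} : Finset V) := by
      ext x
      have h1 := hABC x
      simp only [hX, hQ, mem_compl, mem_filter_univ, mem_union]
      constructor
      · tauto
      · rintro h (h' | h')
        · have := hmA _ h'
          have := (hmC _ h).1
          omega
        · have := mem_filter.1 (hPB ▸ h')
          have := (hmC _ h).2
          omega
    rw [h2', hcompl, ← sum_parts hp (edgeDegree K) (hP ▸ hPCP), ← hDC'] at h2
    have h3 : #{e ∈ K | e ∈ X.sym2} ≤ cross H X p := by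
      refine card_le_card fun e he => ?_
      rw [mem_filter, hK, mem_crossSet] at he
      exact mem_crossSet.2 ⟨he.1.1, he.2, he.1.2.2⟩
    have : m * (#PA + #PB) = m * #PA + m * #PB := by ring
    have : 2 * m * #PA = 2 * (m * #PA) := by ring
    have : 2 * m * #PB = 2 * (m * #PB) := by ring
    omega
  obtain ⟨q, hq⟩ := Nat.exists_eq_add_of_le (show 2 * m + 1 ≤ r + 1 by omega)
  have hDA2 : (2 * m + 1) * #PA ≤ (r + 1) * #PA := Nat.mul_le_mul_right _ (by omega)
  -- With at most one part in `PC`, `hmain` would give DA + 2 ≤ 2m·#PA, against DA + 1 ≥ (2m +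
  -- 1)·#PA.
  rcases Nat.lt_or_ge #PC 2 with hkC | hkC
  · have : 2 * m * #PC ≤ 2 * m * 1 := Nat.mul_le_mul_left _ (by omega)
    have : (2 * m + 1) * #PA = 2 * m * #PA + #PA := by ring
    omega
  -- delete all saturated vertices and the ends of the edges of `F` leaving large parts
  obtain ⟨Y, hYmem⟩ : ∃ Y : Finset V, ∀ x, x ∈ Y ↔
      x ∈ S ∨ (p x ∈ PC ∧ ∃ y, s(x, y) ∈ F ∧ p x ≠ p y) :=
    ⟨({x | x ∈ S ∨ (p x ∈ PC ∧ ∃ y, s(x, y) ∈ F ∧ p x ≠ p y)} : Finset V), by simp⟩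
  have hYone : ∀ x ∈ Y, 1 ≤ edgeDegree K x + u x := by
    intro x hx
    rw [hYmem] at hx
    rcases hx with hx | ⟨-, y, hxy, hne⟩
    · exact hSone x hx
    · have := hKmem x y (hFH hxy) hne
      omega
  -- Parts in `PB` contain no vertex of S, so Y lies in the other parts. Every vertex of Y is
  -- charged to a boundary edge at it, or to the single unit of excess.
  have hYcard : #Y ≤ DA + DC + 1 := by
    have h1 : ∑ x ∈ Y, 1 ≤ ∑ x ∈ Y, (edgeDegree K x + u x) := sum_le_sum hYone
    have hYsub : Y ⊆ ({x | p x ∈ PA ∪ PC} : Finset V) := by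
      intro x hx
      rw [mem_filter_univ, mem_union]
      rw [hYmem] at hx
      by_contra hcon
      push Not at hcon
      have hxB : p x ∈ PB := by
        have := hABC x
        tauto
      rcases hx with hx | hx
      · exact (hdB _ hxB).2 x (hself x) hx
      · exact hcon.2 hx.1
    have h2 : ∑ x ∈ Y, (edgeDegree K x + u x) ≤ ∑ x with p x ∈ PA ∪ PC, (edgeDegree K x + u x) :=
      sum_le_sum_of_subset hYsub
    have hdisj : Disjoint PA PC := by
      rw [disjoint_left]
      intro B hB hB'
      have h1 := hmA B hB
      have h2 := (hmC B hB').1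
      omega
    rw [← sum_parts hp _ (hP ▸ union_subset hPAP hPCP),
      sum_union hdisj] at h2
    simp only [sum_add_distrib] at h2
    rw [sum_const, smul_eq_mul, Nat.mul_one, sum_add_distrib] at h1
    have hwA : ∑ B ∈ PA, w B = ∑ B ∈ PA, ∑ x ∈ B, u x := by simp only [hw]
    have hwC : ∑ B ∈ PC, w B = ∑ B ∈ PC, ∑ x ∈ B, u x := by simp only [hw]
    omega
  have hsurv : ∀ B ∈ PC, ∃ x ∈ B, x ∉ Y := by
    intro B hB
    by_contra! h
    have h1 : ∑ x ∈ B, 1 ≤ ∑ x ∈ B, (edgeDegree K x + u x) :=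
      sum_le_sum fun x hx => hYone x (h x hx)
    rw [sum_const, smul_eq_mul, Nat.mul_one, sum_add_distrib] at h1
    have h2 := hmC B hB
    rw [hd, hw] at h2
    omega
  have htpos : 0 ≤ t := by
    by_contra hneg
    have h1 : (0 : ℝ) ≤ 2 * m * r := by positivity
    have h2 : (0 : ℝ) < r + 1 - 2 * m := by
      have : (2 * m : ℝ) ≤ r := by exact_mod_cast hr
      linarith
    nlinarith
  -- Every part in `PC` keeps its own colour and all other vertices share `none`. An edge outside F
  -- between parts meets S, and an edge of F leaving a part in `PC` has lost its end there.
  have htY := htough.le htpos Y (fun x => if p x ∈ PC then some (p x) else none) (by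
    intro x y hx hy hxy
    by_cases hpxy : p x = p y
    · simp only [hpxy]
    simp only [hYmem, not_or, not_and, not_exists] at hx hy
    by_cases hF' : s(x, y) ∈ F
    · have h1 : p x ∉ PC := fun h => hx.2 h y hF' hpxy
      have h2 : p y ∉ PC := fun h => hy.2 h x (by rwa [Sym2.eq_swap]) (Ne.symm hpxy)
      simp only [h1, h2, if_false]
    · exact absurd (hAp x y hx.1 hy.1 hxy hF') hpxy) hkC (by
    rw [← card_image_of_injective PC (Option.some_injective _)]
    refine card_le_card fun o ho => ?_
    obtain ⟨B, hB, rfl⟩ := mem_image.1 ho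
    obtain ⟨x, hx, hxY⟩ := hsurv B hB
    obtain ⟨b, -, rfl⟩ := mem_palette.1 (hP ▸ hPCP hB)
    refine mem_palette.2 ⟨x, by simpa using hxY, ?_⟩
    rw [heq b x hx, if_pos hB])
  have hfin : 2 * m * r * #PC ≤ (DA + DC + 1) * (q + 1) := by
    have hq' : (r : ℝ) + 1 - 2 * m = q + 1 := by
      have : (r : ℝ) + 1 = 2 * m + 1 + q := by exact_mod_cast hq
      linarith
    rw [hq'] at ht
    have h1 : (2 * m * r * #PC : ℝ) ≤ (DA + DC + 1) * (q + 1) := by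
      have hY' : (#Y : ℝ) ≤ DA + DC + 1 := by exact_mod_cast hYcard
      calc (2 * m * r * #PC : ℝ) ≤ t * (q + 1) * #PC :=
          mul_le_mul_of_nonneg_right ht (Nat.cast_nonneg _)
        _ = t * #PC * (q + 1) := by ring
        _ ≤ (DA + DC + 1) * (q + 1) :=
          mul_le_mul_of_nonneg_right (htY.trans hY') (by exact_mod_cast Nat.zero_le (q + 1))
    exact_mod_cast h1
  exact count_contradiction_nat hm hq hmain hlow hDAge hfin

/-- Each vertex of degree r in F may receive one more edge, and a vertex of degree r + 1 none. So
every admissible M preserves the degree condition, and only the barrier has to be excluded. -/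
theorem exists_tight_of_tough {Γ : SimpleGraph V} {m r : ℕ} {t : ℝ} (hm : 1 ≤ m) (hr : 2 * m ≤ r)
    (ht : 2 * (m : ℝ) * r ≤ t * (r + 1 - 2 * m)) (htough : ToughColoring Γ t)
    {F : Finset (Sym2 V)} (hF : ∀ e ∈ F, e ∈ Γ.edgeSet)
    (hdeg : ∀ v, edgeDegree F v = r ∨ edgeDegree F v = r + 1)
    (huniq : ∀ v w, edgeDegree F v = r + 1 → edgeDegree F w = r + 1 → v = w) :
    ∃ H : Finset (Sym2 V), (∀ e ∈ H, e ∈ Γ.edgeSet) ∧ Tight m H univ ∧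
      ∀ v, edgeDegree H v = r ∨ edgeDegree H v = r + 1 := by
  classical
  set A : Finset (Sym2 V) := {e | e ∈ Γ.edgeSet ∧ e ∉ F} with hAdef
  set cap : V → ℕ := fun v => r + 1 - edgeDegree F v with hcapdef
  have hA : ∀ e ∈ A, ¬ e.IsDiag := fun e he => Γ.not_isDiag_of_mem_edgeSet (by
    rw [hAdef, mem_filter_univ] at he; exact he.1)
  have hAF : Disjoint A F := by
    rw [disjoint_left]
    intro e he
    rw [hAdef, mem_filter_univ] at he
    exact he.2
  obtain ⟨M, hM, hor⟩ := exists_tight_or_barrier (m := m) (F := F) hA hAF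
    (cap := cap) (fun v => by rcases hdeg v with h | h <;> simp only [hcapdef] <;> omega)
  have hFM : Disjoint F M := (hAF.mono_left hM.1).symm
  have hHdeg : ∀ v, edgeDegree (F ∪ M) v = edgeDegree F v + edgeDegree M v :=
    edgeDegree_union hFM
  have hHΓ : ∀ e ∈ F ∪ M, e ∈ Γ.edgeSet := by
    intro e he
    rcases mem_union.1 he with he | he
    · exact hF e he
    · have := hM.1 he
      rw [hAdef, mem_filter_univ] at this
      exact this.1
  have hHr : ∀ v, edgeDegree (F ∪ M) v = r ∨ edgeDegree (F ∪ M) v = r + 1 := by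
    intro v
    have h1 := hHdeg v
    have h2 := hM.2 v
    simp only [hcapdef] at h2
    rcases hdeg v with h | h <;> omega
  refine ⟨F ∪ M, hHΓ, hor.resolve_right ?_, hHr⟩
  rintro ⟨S, p, hself, heq, hsat, hScross, hAp, hsparse, hlt⟩
  -- The excess of F over r. A saturated vertex with excess has no edge of M, and is accounted for
  -- by this unit instead of a crossing edge.
  have hu1 : ∑ x, (edgeDegree F x - r) ≤ 1 := by
    by_cases hex : ∃ v, edgeDegree F v = r + 1
    · obtain ⟨v, hv⟩ := hex
      rw [sum_eq_single v]
      · omega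
      · intro b _ hb
        rcases hdeg b with h | h
        · omega
        · exact absurd (huniq b v h hv) hb
      · simp
    · refine (sum_eq_zero fun x _ => ?_).le.trans (Nat.zero_le _)
      rcases hdeg x with h | h
      · omega
      · exact absurd ⟨x, h⟩ hex
  have hHd : ∀ e ∈ F ∪ M, ¬ e.IsDiag := fun e he => Γ.not_isDiag_of_mem_edgeSet (hHΓ e he)
  refine barrier_contradiction hm hr ht htough subset_union_left hHd hHr hself heq rfl hu1
    (fun x hx => ?_) (fun x hx => ?_) (fun x y hx hy hxy hF' => hAp x y hx hy ?_) hsparse hlt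
  · have h1 := hsat x hx
    simp only [hcapdef] at h1
    rcases hdeg x with h | h
    · have h2 : 0 < edgeDegree M x := by omega
      rw [edgeDegree_eq, card_pos] at h2
      obtain ⟨e, he⟩ := h2
      obtain ⟨he, hxe⟩ := mem_filter.1 he
      obtain ⟨y, rfl⟩ := Sym2.mem_iff_exists.1 hxe
      have := edgeDegree_pos (M := crossSet (F ∪ M) univ p) (mem_crossSet.2
        ⟨mem_union_right _ he, by simp, by simpa using hScross x hx y he⟩) (Sym2.mem_mk_left x y)
      omega
    · omega
  · have h1 := hsat x hx
    simp only [hcapdef] at h1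
    have h2 := hHdeg x
    rcases hdeg x with h | h <;> omega
  · rw [hAdef, mem_filter_univ]
    exact ⟨hxy, hF'⟩

end Counting

end TreeFactor

namespace TreeFactor
open Finset

/-! ### Matroid union for a representable matroid. -/

section Packing

variable {k ι W : Type*} [Field k] [AddCommGroup W] [Module k W] [DecidableEq ι]

/-- Pairwise disjoint subsets of `H`, each of which is mapped to a linearly independent family. -/
structure IsPacking (k : Type*) {ι W : Type*} [Field k] [AddCommGroup W] [Module k W]
    (χ : ι → W) (H : Finset ι) {m : ℕ} (I : Fin m → Finset ι) : Prop where
  subset : ∀ i, I i ⊆ H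
  disjoint : Pairwise fun i j => Disjoint (I i) (I j)
  indep : ∀ i, LinearIndepOn k χ (I i : Set ι)

/-- `J` arises from `I` by replacing an element of one member by an element of `H` that no member
contains, the new member being independent. -/
def Exchange (k : Type*) {ι W : Type*} [Field k] [AddCommGroup W] [Module k W] [DecidableEq ι]
    (χ : ι → W) (H : Finset ι) {m : ℕ} (I J : Fin m → Finset ι) : Prop :=
  ∃ i x y, x ∈ H ∧ (∀ j, x ∉ I j) ∧ y ∈ I i ∧
    LinearIndepOn k χ (insert x ((I i).erase y) : Finset ι) ∧
    J = Function.update I i (insert x ((I i).erase y))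

theorem IsPacking.update {χ : ι → W} {H : Finset ι} {m : ℕ} {I : Fin m → Finset ι}
    (hI : IsPacking k χ H I) {i : Fin m} {A : Finset ι} {x : ι} (hx : x ∈ H)
    (hxI : ∀ j, x ∉ I j) (hA : A ⊆ insert x (I i)) (hind : LinearIndepOn k χ (A : Set ι)) :
    IsPacking k χ H (Function.update I i A) := by
  have key : ∀ j, j ≠ i → Disjoint A (I j) := fun j hj =>
    Disjoint.mono_left hA (Finset.disjoint_insert_left.2 ⟨hxI j, hI.disjoint hj.symm⟩)
  refine ⟨fun j => ?_, fun j l hjl => ?_, fun j => ?_⟩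
  · by_cases h : j = i
    · subst h
      rw [Function.update_self]
      exact hA.trans (Finset.insert_subset hx (hI.subset j))
    · rw [Function.update_of_ne h]
      exact hI.subset j
  · by_cases h : j = i
    · subst h
      rw [Function.update_self, Function.update_of_ne hjl.symm]
      exact key l hjl.symm
    · by_cases h' : l = i
      · subst h'
        rw [Function.update_self, Function.update_of_ne h]
        exact (key j h).symm
      · simp only [Function.update_of_ne h, Function.update_of_ne h']
        exact hI.disjoint hjl
  · by_cases h : j = i
    · subst h
      rwa [Function.update_self]
    · rw [Function.update_of_ne h]
      exact hI.indep j

theorem Exchange.isPacking {χ : ι → W} {H : Finset ι} {m : ℕ} {I J : Fin m → Finset ι}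
    (h : Exchange k χ H I J) (hI : IsPacking k χ H I) : IsPacking k χ H J := by
  obtain ⟨i, x, y, hx, hxI, -, hind, rfl⟩ := h
  exact hI.update hx hxI (Finset.insert_subset_insert _ (Finset.erase_subset _ _)) hind

theorem Exchange.sum_card {χ : ι → W} {H : Finset ι} {m : ℕ} {I J : Fin m → Finset ι}
    (h : Exchange k χ H I J) : ∑ i, #(J i) = ∑ i, #(I i) := by
  obtain ⟨i, x, y, hx, hxI, hy, hind, rfl⟩ := h
  refine Finset.sum_congr rfl fun j _ => ?_
  by_cases hj : j = i
  · subst hj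
    rw [Function.update_self, Finset.card_insert_of_notMem
      (fun hx' => hxI j (Finset.mem_of_mem_erase hx')), Finset.card_erase_add_one hy]
  · rw [Function.update_of_ne hj]

/-- An element of the span of an independent family may replace any member of the family that
occurs in its expansion. -/
theorem exists_expansion {χ : ι → W} {A : Finset ι} (hA : LinearIndepOn k χ (A : Set ι)) {x : ι}
    (hxA : x ∉ A) (hx : χ x ∈ Submodule.span k (χ '' (A : Set ι))) :
    ∃ B ⊆ A, χ x ∈ Submodule.span k (χ '' (B : Set ι)) ∧
      ∀ y ∈ B, LinearIndepOn k χ (insert x (A.erase y) : Finset ι) := by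
  classical
  obtain ⟨a, ha⟩ := (Submodule.mem_span_image_finset_iff_exists_fun' k).1 hx
  refine ⟨{y ∈ A | a y ≠ 0}, Finset.filter_subset _ _, ?_, fun y hy => ?_⟩
  · rw [← ha, ← Finset.sum_filter_of_ne (p := fun y => a y ≠ 0)]
    · exact Submodule.sum_mem _ fun y hy => Submodule.smul_mem _ _
        (Submodule.subset_span ⟨y, hy, rfl⟩)
    · intro y _ h h0
      exact h (by rw [h0, zero_smul])
  · rw [Finset.mem_filter] at hy
    have hxe : x ∉ ((A.erase y : Finset ι) : Set ι) := fun h => hxA (Finset.mem_of_mem_erase h)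
    rw [Finset.coe_insert, linearIndepOn_insert hxe]
    refine ⟨hA.mono (by simp), fun hspan => ?_⟩
    refine (linearIndepOn_iff_notMem_span.1 hA) y hy.1 ?_
    rw [Finset.coe_erase] at hspan
    rw [← Finset.add_sum_erase _ _ hy.1] at ha
    have h1 : a y • χ y ∈ Submodule.span k (χ '' ((A : Set ι) \ {y})) := by
      rw [eq_sub_of_add_eq ha]
      refine Submodule.sub_mem _ hspan (Submodule.sum_mem _ fun z hz => Submodule.smul_mem _ _
        (Submodule.subset_span ⟨z, ?_, rfl⟩))
      rw [Finset.mem_erase] at hz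
      exact ⟨hz.2, hz.1⟩
    exact (Submodule.smul_mem_iff _ hy.2).1 h1

/-- The matroid union theorem for `m` copies of a representable matroid: some packing of
maximal size leaves uncovered only elements of a set that each of its members spans. -/
theorem exists_packing_spanning_core (χ : ι → W) (H : Finset ι) (m : ℕ) :
    ∃ I : Fin m → Finset ι, IsPacking k χ H I ∧ ∃ X ⊆ H,
      (∀ e ∈ H, (∀ i, e ∉ I i) → e ∈ X) ∧
      ∀ i, ∀ x ∈ X, χ x ∈ Submodule.span k (χ '' (I i ∩ X : Finset ι)) := by
  classical
  have hex : ∃ n, ∃ I : Fin m → Finset ι, IsPacking k χ H I ∧ ∑ i, #(I i) = n :=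
    ⟨_, fun _ => ∅, ⟨by simp, by simp [Pairwise], by simp⟩, rfl⟩
  have hbd : ∀ I : Fin m → Finset ι, IsPacking k χ H I → ∑ i, #(I i) ≤ m * #H := fun I hI => by
    simpa using Finset.sum_le_card_nsmul univ (fun i => #(I i)) #H
      fun i _ => Finset.card_le_card (hI.subset i)
  obtain ⟨I₀, hI₀, hmax⟩ : ∃ I₀ : Fin m → Finset ι, IsPacking k χ H I₀ ∧
      ∀ I : Fin m → Finset ι, IsPacking k χ H I → ∑ i, #(I i) ≤ ∑ i, #(I₀ i) := by
    let P : ℕ → Prop := fun n => ∃ I : Fin m → Finset ι, IsPacking k χ H I ∧ ∑ i, #(I i) = n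
    have hP : P (Nat.findGreatest P (m * #H)) := by
      obtain ⟨n, I, hI, hn⟩ := hex
      exact Nat.findGreatest_spec (m := n) (by rw [← hn]; exact hbd I hI) ⟨I, hI, hn⟩
    obtain ⟨I₀, hI₀, hn⟩ := hP
    exact ⟨I₀, hI₀, fun I hI => by rw [hn]; exact Nat.le_findGreatest (hbd I hI) ⟨I, hI, rfl⟩⟩
  let R : (Fin m → Finset ι) → Prop := Relation.ReflTransGen (Exchange k χ H) I₀
  have hR : ∀ J, R J → IsPacking k χ H J ∧ ∑ i, #(J i) = ∑ i, #(I₀ i) := by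
    intro J hJ
    induction hJ with
    | refl => exact ⟨hI₀, rfl⟩
    | tail _ h ih => exact ⟨h.isPacking ih.1, h.sum_card.trans ih.2⟩
  -- X collects the elements left uncovered by some packing reachable from the maximal one by
  -- exchanges.
  set X : Finset ι := {x ∈ H | ∃ J, R J ∧ ∀ j, x ∉ J j} with hX
  have hspan : ∀ J, R J → ∀ x ∈ H, (∀ j, x ∉ J j) → ∀ i,
      χ x ∈ Submodule.span k (χ '' (J i ∩ X : Finset ι)) := by
    intro J hJ x hx hxJ i
    obtain ⟨hJp, hJc⟩ := hR J hJ
    -- Otherwise x could be added to J i, contradicting the maximal total size.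
    have h1 : χ x ∈ Submodule.span k (χ '' (J i : Set ι)) := by
      by_contra hno
      have hind : LinearIndepOn k χ (insert x (J i) : Finset ι) := by
        rw [Finset.coe_insert, linearIndepOn_insert (by exact_mod_cast hxJ i)]
        exact ⟨hJp.indep i, hno⟩
      have h2 := hmax _ (hJp.update (i := i) hx hxJ subset_rfl hind)
      rw [← hJc] at h2
      refine absurd h2 (not_le.2 (Finset.sum_lt_sum (fun j _ => ?_) ⟨i, mem_univ _, ?_⟩))
      · by_cases hj : j = i
        · subst hj
          rw [Function.update_self]
          exact Finset.card_le_card (Finset.subset_insert _ _)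
        · rw [Function.update_of_ne hj]
      · rw [Function.update_self, Finset.card_insert_of_notMem (hxJ i)]
        exact Nat.lt_succ_self _
    obtain ⟨B, hBJ, hxB, hB⟩ := exists_expansion (hJp.indep i) (hxJ i) h1
    refine Submodule.span_mono (Set.image_mono ?_) hxB
    intro y hy
    have hy' : y ∈ B := hy
    have hyJ := hBJ hy'
    rw [Finset.mem_coe, Finset.mem_inter, hX, Finset.mem_filter]
    -- Exchanging y for x uncovers y, so all elements in the expansion of x belong to X.
    refine ⟨hyJ, hJp.subset i hyJ, _, hJ.tail ⟨i, x, y, hx, hxJ, hyJ, hB y hy', rfl⟩, fun j => ?_⟩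
    by_cases hj : j = i
    · subst hj
      rw [Function.update_self, Finset.mem_insert]
      rintro (rfl | h)
      · exact hxJ j hyJ
      · exact Finset.notMem_erase _ _ h
    · rw [Function.update_of_ne hj]
      exact Finset.disjoint_left.1 (hJp.disjoint (Ne.symm hj)) hyJ
  -- Both exchanged elements lie in X, and the incoming one already lies in the span; Steinitz
  -- exchange shows that the span is unchanged.
  have hinv : ∀ J, R J → ∀ i, Submodule.span k (χ '' (J i ∩ X : Finset ι)) =
      Submodule.span k (χ '' (I₀ i ∩ X : Finset ι)) := by
    intro J hJ
    induction hJ with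
    | refl => exact fun i => rfl
    | @tail J L hJ hL ih =>
      intro j
      rw [← ih j]
      obtain ⟨i, x, y, hx, hxJ, hyJ, hind, rfl⟩ := hL
      by_cases hj : j = i
      swap
      · rw [Function.update_of_ne hj]
      subst hj
      have hxX : x ∈ X := Finset.mem_filter.2 ⟨hx, J, hJ, hxJ⟩
      have hxs := hspan J hJ x hx hxJ j
      have hyX : y ∈ X := by
        refine Finset.mem_filter.2 ⟨(hR J hJ).1.subset j hyJ, _,
          hJ.tail ⟨j, x, y, hx, hxJ, hyJ, hind, rfl⟩, fun l => ?_⟩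
        by_cases hl : l = j
        · subst hl
          rw [Function.update_self, Finset.mem_insert]
          rintro (rfl | h)
          · exact hxJ l hyJ
          · exact Finset.notMem_erase _ _ h
        · rw [Function.update_of_ne hl]
          exact Finset.disjoint_left.1 ((hR J hJ).1.disjoint (Ne.symm hl)) hyJ
      rw [Function.update_self]
      have e1 : insert x ((J j).erase y) ∩ X = insert x ((J j ∩ X).erase y) := by
        rw [Finset.insert_inter_of_mem hxX, Finset.erase_inter]
      have e2 : J j ∩ X = insert y ((J j ∩ X).erase y) :=
        (Finset.insert_erase (Finset.mem_inter.2 ⟨hyJ, hyX⟩)).symm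
      rw [e1, Finset.coe_insert, Set.image_insert_eq]
      have hxe : x ∉ (((J j).erase y : Finset ι) : Set ι) :=
        fun h => hxJ j (Finset.mem_of_mem_erase h)
      rw [Finset.coe_insert, linearIndepOn_insert hxe] at hind
      have hsub : (((J j ∩ X).erase y : Finset ι) : Set ι) ⊆ ((J j).erase y : Finset ι) := by
        rw [Finset.coe_subset]
        exact Finset.erase_subset_erase _ Finset.inter_subset_left
      have hxn : χ x ∉ Submodule.span k (χ '' (((J j ∩ X).erase y : Finset ι) : Set ι)) :=
        fun h => hind.2 (Submodule.span_mono (Set.image_mono hsub) h)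
      apply le_antisymm
      · rw [Submodule.span_le, Set.insert_subset_iff]
        exact ⟨hxs, (Set.image_mono (by
          rw [Finset.coe_subset]; exact Finset.erase_subset _ _)).trans Submodule.subset_span⟩
      · rw [e2, Finset.coe_insert, Set.image_insert_eq] at hxs ⊢
        rw [Finset.erase_insert (Finset.notMem_erase _ _)]
        rw [Submodule.span_le, Set.insert_subset_iff]
        exact ⟨_root_.mem_span_insert_exchange hxs hxn,
          (Set.subset_insert _ _).trans Submodule.subset_span⟩
  refine ⟨I₀, hI₀, X, Finset.filter_subset _ _, fun e he heI =>
    Finset.mem_filter.2 ⟨he, I₀, .refl, heI⟩, fun i x hx => ?_⟩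
  obtain ⟨hxH, J, hJ, hxJ⟩ := Finset.mem_filter.1 hx
  rw [← hinv J hJ i]
  exact hspan J hJ x hxH hxJ i

end Packing

/-! ### Disjoint spanning trees from partition-connectivity. -/

section Trees

variable {V : Type*} [DecidableEq V]

/-- The incidence vector of an edge over the field with two elements; that of a loop is zero. -/
def incidenceVector : Sym2 V → V → ZMod 2 :=
  Sym2.lift ⟨fun x y => Pi.single x 1 + Pi.single y 1, fun _ _ => add_comm _ _⟩

theorem incidenceVector_mk (x y : V) :
    incidenceVector s(x, y) = Pi.single x 1 + Pi.single y 1 := rfl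

/-- The sum of the coordinates in `C`. -/
def coordSum (C : Finset V) : (V → ZMod 2) →ₗ[ZMod 2] ZMod 2 :=
  ∑ v ∈ C, LinearMap.proj v

theorem coordSum_single (C : Finset V) (x : V) :
    coordSum C (Pi.single x 1) = if x ∈ C then 1 else 0 := by
  simp [coordSum, LinearMap.sum_apply, Pi.single_apply]

theorem coordSum_incidenceVector (C : Finset V) (x y : V) (h : x ∈ C ↔ y ∈ C) :
    coordSum C (incidenceVector s(x, y)) = 0 := by
  rw [incidenceVector_mk, map_add, coordSum_single, coordSum_single]
  by_cases hx : x ∈ C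
  · rw [if_pos hx, if_pos (h.1 hx)]; decide
  · rw [if_neg hx, if_neg (fun hy => hx (h.2 hy)), add_zero]

theorem finrank_span_of_indep {I : Finset (Sym2 V)}
    (hI : LinearIndepOn (ZMod 2) incidenceVector (I : Set (Sym2 V))) :
    Module.finrank (ZMod 2) (Submodule.span (ZMod 2) (incidenceVector '' (I : Set (Sym2 V))))
      = #I := by
  have h := finrank_span_eq_card (R := ZMod 2)
    (b := fun x : (I : Set (Sym2 V)) => incidenceVector x.1) hI
  rw [← Set.image_eq_range] at h
  simpa using h

/-- An independent edge set contains no cycle. -/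
theorem no_cycle_of_indep {I : Finset (Sym2 V)}
    (hI : LinearIndepOn (ZMod 2) incidenceVector (I : Set (Sym2 V))) {k : ℕ}
    (v : Fin (k + 1) → V) (hinj : Function.Injective fun i => s(v i, v (i + 1)))
    (hv : ∀ i, s(v i, v (i + 1)) ∈ I) : False := by
  have h := LinearIndependent.comp (R := ZMod 2)
    (v := fun x : (I : Set (Sym2 V)) => incidenceVector x.1) hI
    (fun i : Fin (k + 1) => ⟨s(v i, v (i + 1)), hv i⟩)
    (fun i j hij => hinj (congrArg Subtype.val hij))
  refine one_ne_zero (Fintype.linearIndependent_iff.1 h (fun _ => (1 : ZMod 2)) ?_ 0)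
  simp only [Function.comp_apply, one_smul, incidenceVector_mk, Finset.sum_add_distrib]
  -- Around a closed walk every position is once a start and once an end, so the incidence vectors
  -- sum to zero modulo 2.
  have hs := Equiv.sum_comp (Equiv.addRight (1 : Fin (k + 1)))
    (fun i => (Pi.single (v i) 1 : V → ZMod 2))
  simp only [Equiv.coe_addRight] at hs
  rw [hs]
  exact ZModModule.add_self _

variable [Fintype V]

theorem span_incidenceVector_le (I : Set (Sym2 V)) :
    Submodule.span (ZMod 2) (incidenceVector '' I) ≤ LinearMap.ker (coordSum (univ : Finset V)) := by
  rw [Submodule.span_le]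
  rintro _ ⟨e, -, rfl⟩
  induction e using Sym2.ind with
  | _ x y => exact coordSum_incidenceVector _ _ _ (by simp)

theorem finrank_ker_coordSum_lt [Nonempty V] :
    Module.finrank (ZMod 2) (LinearMap.ker (coordSum (univ : Finset V))) < Fintype.card V := by
  rw [← Module.finrank_fintype_fun_eq_card (R := ZMod 2) (η := V)]
  refine Submodule.finrank_lt fun h => ?_
  have x : V := Classical.arbitrary V
  have hx : (Pi.single x 1 : V → ZMod 2) ∈ LinearMap.ker (coordSum (univ : Finset V)) := by
    rw [h]; trivial
  rw [LinearMap.mem_ker, coordSum_single, if_pos (mem_univ _)] at hx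
  exact one_ne_zero hx

theorem card_lt_of_indep [Nonempty V] {I : Finset (Sym2 V)}
    (hI : LinearIndepOn (ZMod 2) incidenceVector (I : Set (Sym2 V))) : #I < Fintype.card V := by
  rw [← finrank_span_of_indep hI]
  exact (Submodule.finrank_mono (span_incidenceVector_le _)).trans_lt finrank_ker_coordSum_lt

/-- Nash-Williams and Tutte: a partition-connected edge set contains disjoint spanning trees. -/
theorem exists_tree_packing [Nonempty V] {m : ℕ} {H : Finset (Sym2 V)} (hH : Tight m H univ) :
    ∃ I : Fin m → Finset (Sym2 V), (∀ i, I i ⊆ H) ∧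
      (Pairwise fun i j => Disjoint (I i) (I j)) ∧
      ∀ i, LinearIndepOn (ZMod 2) incidenceVector (I i : Set (Sym2 V)) ∧
        #(I i) + 1 = Fintype.card V := by
  classical
  obtain ⟨I, hI, X, hXH, hXc, hXs⟩ :=
    exists_packing_spanning_core (k := ZMod 2) (incidenceVector (V := V)) H m
  refine ⟨I, hI.subset, hI.disjoint, fun i₀ => ⟨hI.indep i₀, ?_⟩⟩
  set S := Submodule.span (ZMod 2) (incidenceVector '' (X : Set (Sym2 V))) with hS
  have hw : ∀ i, #(I i ∩ X) = Module.finrank (ZMod 2) S := by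
    intro i
    rw [← finrank_span_of_indep ((hI.indep i).mono (by
      rw [Finset.coe_subset]; exact Finset.inter_subset_left))]
    rw [hS]
    refine congrArg (fun L : Submodule (ZMod 2) (V → ZMod 2) => Module.finrank (ZMod 2) L) ?_
    refine le_antisymm (Submodule.span_mono (Set.image_mono (by
      rw [Finset.coe_subset]; exact Finset.inter_subset_right))) ?_
    rw [Submodule.span_le]
    rintro _ ⟨x, hx, rfl⟩
    exact hXs i x hx
  -- Vertices are coloured by their unit vectors modulo the span S of X. Edges of X do not cross,
  -- and the colours span the quotient, so there are at least |V| − dim S of them.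
  let c : V → (V → ZMod 2) ⧸ S := fun v => S.mkQ (Pi.single v 1)
  obtain ⟨d, hd⟩ := exists_vertex_coloring c
  have hdc : #(palette (univ : Finset V) d) = #(palette univ c) :=
    card_palette_congr fun x _ y _ => (hd x y).symm
  have hq : Fintype.card V ≤ Module.finrank (ZMod 2) S + #(palette univ d) := by
    have h1 := Submodule.finrank_quotient_add_finrank S
    rw [Module.finrank_fintype_fun_eq_card] at h1
    have htop : Submodule.span (ZMod 2) ((palette univ c : Finset _) : Set ((V → ZMod 2) ⧸ S)) = ⊤ := by
      rw [eq_top_iff]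
      rintro z -
      obtain ⟨f, rfl⟩ := S.mkQ_surjective z
      rw [LinearMap.pi_apply_eq_sum_univ S.mkQ f]
      refine Submodule.sum_mem _ fun v _ => Submodule.smul_mem _ _ (Submodule.subset_span ?_)
      refine mem_palette.2 ⟨v, mem_univ _, ?_⟩
      simp only [c]
      congr 1
      ext w
      simp [Pi.single_apply, eq_comm]
    have h2 := finrank_span_finset_le_card (R := ZMod 2) (palette univ c)
    rw [Set.finrank, htop, finrank_top] at h2
    omega
  -- A crossing edge is not in X, hence is covered by the packing.
  have hcross : cross H univ d ≤ ∑ i, #(I i \ X) := by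
    refine (Finset.card_le_card ?_).trans Finset.card_biUnion_le
    intro e he
    obtain ⟨heH, -, hed⟩ := mem_crossSet.1 he
    have heX : e ∉ X := by
      intro heX
      apply hed
      have hmem : incidenceVector e ∈ S := Submodule.subset_span ⟨e, heX, rfl⟩
      induction e using Sym2.ind with
      | _ x y =>
        rw [incidenceVector_mk, ← Submodule.ker_mkQ S, LinearMap.mem_ker, map_add] at hmem
        rw [Sym2.map_mk, Sym2.mk_isDiag_iff, hd]
        exact (eq_neg_of_add_eq_zero_left hmem).trans (by
          rw [← map_neg, ZModModule.neg_eq_self])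
    have : ∃ i, e ∈ I i := by
      by_contra! hno
      exact heX (hXc e heH hno)
    obtain ⟨i, hi⟩ := this
    exact Finset.mem_biUnion.2 ⟨i, mem_univ _, Finset.mem_sdiff.2 ⟨hi, heX⟩⟩
  have ht := hH d
  have hle : ∀ i, #(I i) + 1 ≤ Fintype.card V := fun i => card_lt_of_indep (hI.indep i)
  have hsplit : ∀ i, #(I i \ X) + Module.finrank (ZMod 2) S = #(I i) := fun i => by
    rw [← hw i, Finset.card_sdiff_add_card_inter]
  -- Each I i meets X in a set of dim S elements, so tightness for d gives ∑ (#(I i) + 1) ≥ m·|V|.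
  -- No term exceeds |V|, so all are equal to it.
  by_contra hne
  have hlt : ∑ i, (#(I i) + 1) < ∑ _i : Fin m, Fintype.card V :=
    Finset.sum_lt_sum (fun i _ => hle i) ⟨i₀, mem_univ _, lt_of_le_of_ne (hle i₀) hne⟩
  have hsum : ∑ i, #(I i) = ∑ i, #(I i \ X) + m * Module.finrank (ZMod 2) S := by
    simp_rw [← hsplit, Finset.sum_add_distrib]
    simp
  rw [Finset.sum_add_distrib] at hlt
  simp only [sum_const, card_univ, Fintype.card_fin, smul_eq_mul, mul_one] at hlt
  have := Nat.mul_le_mul_left m hq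
  rw [mul_add] at this
  omega

/-- An independent edge set of the maximal possible size connects all vertices. -/
theorem reflTransGen_of_indep [Nonempty V] {I : Finset (Sym2 V)}
    (hI : LinearIndepOn (ZMod 2) incidenceVector (I : Set (Sym2 V)))
    (hc : #I + 1 = Fintype.card V) (x y : V) :
    Relation.ReflTransGen (fun a b => s(a, b) ∈ I) x y := by
  classical
  by_contra hxy
  -- By dimension the edges span all vectors of coordinate sum zero. The sum over C vanishes on
  -- every edge of I, but not on the vector of s(x, y) with y outside C.
  set C : Finset V := {z | Relation.ReflTransGen (fun a b => s(a, b) ∈ I) x z} with hC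
  have heq : Submodule.span (ZMod 2) (incidenceVector '' (I : Set (Sym2 V))) =
      LinearMap.ker (coordSum (univ : Finset V)) := by
    refine Submodule.eq_of_le_of_finrank_le (span_incidenceVector_le _) ?_
    rw [finrank_span_of_indep hI]
    have := finrank_ker_coordSum_lt (V := V)
    omega
  have hle : Submodule.span (ZMod 2) (incidenceVector '' (I : Set (Sym2 V))) ≤
      LinearMap.ker (coordSum C) := by
    rw [Submodule.span_le]
    rintro _ ⟨e, he, rfl⟩
    induction e using Sym2.ind with
    | _ a b =>
      refine coordSum_incidenceVector _ _ _ ?_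
      simp only [hC, mem_filter, mem_univ, true_and]
      exact ⟨fun h => h.tail he, fun h => h.tail (by rw [Sym2.eq_swap]; exact he)⟩
  have hmem : incidenceVector s(x, y) ∈ LinearMap.ker (coordSum C) :=
    hle (by rw [heq]; exact coordSum_incidenceVector _ _ _ (by simp))
  rw [LinearMap.mem_ker, incidenceVector_mk, map_add, coordSum_single, coordSum_single,
    if_pos (by simpa [hC] using Relation.ReflTransGen.refl), if_neg (by simpa [hC] using hxy),
    add_zero] at hmem
  exact one_ne_zero hmem

end Trees

end TreeFactor

namespace TreeFactor
open Finset

/-! ### Tutte's matching theorem in terms of reachability. -/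

section Alternating

variable {W : Type*}

/-- The vertices reachable from `a` by walks all of whose later vertices avoid `X`. -/
def reachSet (K : SimpleGraph W) (X : Finset W) (a : W) : Set W :=
  {b | Relation.ReflTransGen (fun x y => K.Adj x y ∧ y ∉ X) a b}

theorem reachSet_eq_of_adj {K : SimpleGraph W} {X : Finset W} {a b : W} (ha : a ∉ X) (hb : b ∉ X)
    (hab : K.Adj a b) : reachSet K X a = reachSet K X b := by
  ext z
  exact ⟨fun h => .head ⟨hab.symm, ha⟩ h, fun h => .head ⟨hab, hb⟩ h⟩

theorem exists_odd_reachSets [Fintype W] (K : SimpleGraph W) (heven : Even (Fintype.card W))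
    (hK : ¬ ∃ M : K.Subgraph, M.IsPerfectMatching) :
    ∃ (X : Finset W) (O : Finset (Set W)), #X + 2 ≤ #O ∧
      ∀ C ∈ O, Odd C.ncard ∧ ∃ a, a ∉ X ∧ C = reachSet K X a := by
  classical
  rw [SimpleGraph.tutte] at hK
  push Not at hK
  obtain ⟨u, hu⟩ := hK
  set L := ((⊤ : K.Subgraph).deleteVerts u).coe with hL
  have hodd := L.odd_ncard_oddComponents
  have hcard : Nat.card ((⊤ : K.Subgraph).deleteVerts u).verts + u.ncard = Fintype.card W := by
    rw [Nat.card_coe_set_eq, SimpleGraph.Subgraph.deleteVerts_verts, SimpleGraph.Subgraph.verts_top,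
      Set.ncard_sdiff (Set.subset_univ u), Set.ncard_univ, Nat.card_eq_fintype_card]
    have := Set.ncard_le_card u
    rw [Nat.card_eq_fintype_card] at this
    omega
  -- The number of odd components has the parity of the remaining order, hence that of |u|; so an
  -- excess over |u| is at least 2.
  have hge : u.ncard + 2 ≤ L.oddComponents.ncard := by
    have hu' : u.ncard < L.oddComponents.ncard := hu
    rw [← hcard] at heven
    by_contra hlt
    have he : L.oddComponents.ncard = u.ncard + 1 := by omega
    rw [he] at hodd
    by_cases h : Odd (Nat.card ((⊤ : K.Subgraph).deleteVerts u).verts)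
    · have := hodd.2 h
      rw [Nat.odd_iff] at this h
      rw [Nat.even_iff] at heven
      omega
    · have := mt hodd.1 h
      rw [Nat.odd_iff] at this h
      rw [Nat.even_iff] at heven
      omega
  have hfin : L.oddComponents.Finite := Set.toFinite _
  have hsupp : ∀ a (ha : a ∈ ((⊤ : K.Subgraph).deleteVerts u).verts),
      Subtype.val '' (L.connectedComponentMk ⟨a, ha⟩).supp = reachSet K u.toFinset a := by
    intro a ha
    ext b
    constructor
    · rintro ⟨b, hb, rfl⟩
      rw [SimpleGraph.ConnectedComponent.mem_supp_iff, SimpleGraph.ConnectedComponent.eq] at hb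
      have h := (SimpleGraph.reachable_iff_reflTransGen _ _).1 hb.symm
      refine h.lift Subtype.val fun x y hxy => ?_
      have hy := y.2
      simp only [SimpleGraph.Subgraph.deleteVerts_verts, Set.mem_sdiff] at hy
      refine ⟨((⊤ : K.Subgraph).deleteVerts u).adj_sub hxy, ?_⟩
      rw [Set.mem_toFinset]
      exact hy.2
    · intro hb
      induction hb with
      | refl => exact ⟨⟨a, ha⟩, rfl, rfl⟩
      | @tail y z _ hyz ih =>
        obtain ⟨y, hy, rfl⟩ := ih
        have hz : z ∈ ((⊤ : K.Subgraph).deleteVerts u).verts := by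
          simpa using hyz.2
        refine ⟨⟨z, hz⟩, ?_, rfl⟩
        rw [SimpleGraph.ConnectedComponent.mem_supp_iff] at hy ⊢
        rw [← hy, SimpleGraph.ConnectedComponent.eq]
        have hy2 : y.1 ∉ u := by
          have := y.2
          simp only [SimpleGraph.Subgraph.deleteVerts_verts, Set.mem_sdiff] at this
          exact this.2
        have hadj : L.Adj y ⟨z, hz⟩ := by
          rw [hL, SimpleGraph.Subgraph.coe_adj, SimpleGraph.Subgraph.deleteVerts_adj]
          simpa [hy2, hyz.1] using hyz.2
        exact hadj.reachable.symm
  refine ⟨u.toFinset, hfin.toFinset.image fun C => Subtype.val '' C.supp, ?_, ?_⟩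
  · rw [Finset.card_image_of_injective, ← Set.ncard_eq_toFinset_card,
      ← Set.ncard_eq_toFinset_card']
    · exact hge
    · intro C D hCD
      exact SimpleGraph.ConnectedComponent.supp_injective
        (Set.image_injective.2 Subtype.val_injective hCD)
  · intro C hC
    obtain ⟨D, hD, rfl⟩ := Finset.mem_image.1 hC
    rw [Set.Finite.mem_toFinset] at hD
    refine ⟨?_, ?_⟩
    · rw [Set.ncard_image_of_injective _ Subtype.val_injective]
      exact hD
    · induction D using SimpleGraph.ConnectedComponent.ind with
      | _ a => exact ⟨a.1, by simpa using a.2, hsupp a.1 a.2⟩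

end Alternating

/-! ### Tutte's f-factor theorem via a matching gadget. -/

section Factor

variable {V : Type*}

/-- The edges of a graph, as a finset. -/
noncomputable def edges [Fintype V] (Γ : SimpleGraph V) : Finset (Sym2 V) := by
  classical exact {e | e ∈ Γ.edgeSet}

@[simp] theorem mem_edges [Fintype V] {Γ : SimpleGraph V} {e : Sym2 V} : e ∈ edges Γ ↔ e ∈ Γ.edgeSet := by
  simp [edges]

/-- The neighbours of `v` in `A`. -/
noncomputable def nbrs (Γ : SimpleGraph V) (A : Finset V) (v : V) : Finset V := by
  classical exact {w ∈ A | Γ.Adj v w}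

@[simp] theorem mem_nbrs {Γ : SimpleGraph V} {A : Finset V} {v w : V} :
    w ∈ nbrs Γ A v ↔ w ∈ A ∧ Γ.Adj v w := by
  simp [nbrs]

theorem card_darts [DecidableEq V] (Γ : SimpleGraph V) [Fintype Γ.Dart] (A B : Finset V) :
    #{d : Γ.Dart | d.fst ∈ A ∧ d.snd ∈ B} = ∑ v ∈ A, #(nbrs Γ B v) := by
  rw [← Finset.card_sigma]
  refine Finset.card_bij (fun d _ => ⟨d.fst, d.snd⟩) ?_ ?_ ?_
  · intro d hd
    rw [Finset.mem_filter] at hd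
    exact Finset.mem_sigma.2 ⟨hd.2.1, mem_nbrs.2 ⟨hd.2.2, d.adj⟩⟩
  · intro d _ d' _ h
    simp only [Sigma.mk.injEq, heq_eq_eq] at h
    exact SimpleGraph.Dart.ext _ _ (Prod.ext h.1 h.2)
  · rintro ⟨v, w⟩ h
    rw [Finset.mem_sigma, mem_nbrs] at h
    exact ⟨⟨(v, w), h.2.2⟩, Finset.mem_filter.2 ⟨mem_univ _, h.1, h.2.1⟩, rfl⟩

variable [Fintype V]

/-- Tutte's gadget: each vertex `v` is replaced by a complete bipartite graph between the darts
leaving `v` and `deg v - f v` further vertices. -/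
def gadget (Γ : SimpleGraph V) (f : V → ℕ) :
    SimpleGraph (Γ.Dart ⊕ Σ v, Fin (#(nbrs Γ univ v) - f v)) where
  Adj
    | .inl d, .inl d' => d' = d.symm
    | .inl d, .inr e => d.fst = e.1
    | .inr e, .inl d => d.fst = e.1
    | .inr _, .inr _ => False
  symm := ⟨by
    rintro (d | e) (d' | e') h
    · simp only at h ⊢
      rw [h, SimpleGraph.Dart.symm_symm]
    · exact h
    · exact h
    · exact h⟩
  loopless := ⟨by
    rintro (d | e) h
    · exact d.symm_ne h.symm
    · exact h⟩

/-- The extra vertices at v must be matched to darts leaving v, which uses deg v − f v of these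
darts. The other f v darts are matched to their reversals and give the edges of the factor. -/
theorem exists_factor_of_perfectMatching [DecidableEq V] {Γ : SimpleGraph V} {f : V → ℕ}
    (hf : ∀ v, f v ≤ #(nbrs Γ univ v)) {M : (gadget Γ f).Subgraph} (hM : M.IsPerfectMatching) :
    ∃ F : Finset (Sym2 V), (∀ e ∈ F, e ∈ Γ.edgeSet) ∧ ∀ v, edgeDegree F v = f v := by
  classical
  have hM' := SimpleGraph.Subgraph.isPerfectMatching_iff.1 hM
  set F : Finset (Sym2 V) :=
    ({d : Γ.Dart | M.Adj (.inl d) (.inl d.symm)} : Finset _).image SimpleGraph.Dart.edge with hF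
  refine ⟨F, fun e he => ?_, fun v => ?_⟩
  · obtain ⟨d, -, rfl⟩ := Finset.mem_image.1 he
    exact d.edge_mem
  set P : Finset Γ.Dart := {d | d.fst ∈ ({v} : Finset V) ∧ d.snd ∈ (univ : Finset V)} with hP
  have hPc : #P = #(nbrs Γ univ v) := by rw [hP, card_darts]; simp
  have h1 : edgeDegree F v = #{d ∈ P | M.Adj (.inl d) (.inl d.symm)} := by
    rw [edgeDegree_eq]
    symm
    refine Finset.card_bij (fun d _ => d.edge) ?_ ?_ ?_
    · intro d hd
      simp only [hP, mem_filter, mem_univ, true_and, and_true, mem_singleton] at hd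
      refine Finset.mem_filter.2 ⟨Finset.mem_image.2 ⟨d, by simpa using hd.2, rfl⟩, ?_⟩
      rw [← hd.1]
      exact Sym2.mem_mk_left _ _
    · intro d hd d' hd' h
      simp only [hP, mem_filter, mem_univ, true_and, and_true, mem_singleton] at hd hd'
      rcases SimpleGraph.dart_edge_eq_iff d d' |>.1 h with h | h
      · exact h
      · exfalso
        have h2 := congrArg (fun x : Γ.Dart => x.fst) h
        simp only [SimpleGraph.Dart.symm_toProd, Prod.fst_swap] at h2
        have := d'.adj.ne
        rw [hd'.1, ← h2, hd.1] at this
        exact this rfl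
    · intro e he
      obtain ⟨he, hv⟩ := Finset.mem_filter.1 he
      obtain ⟨d, hd, rfl⟩ := Finset.mem_image.1 he
      simp only [mem_filter, mem_univ, true_and] at hd
      have hv' : v = d.fst ∨ v = d.snd := by
        simpa [SimpleGraph.Dart.edge] using hv
      rcases hv' with rfl | rfl
      · exact ⟨d, by simpa [hP] using hd, rfl⟩
      · exact ⟨d.symm, by simpa [hP] using hd.symm, d.edge_symm⟩
  have h2 : #{d ∈ P | ¬ M.Adj (.inl d) (.inl d.symm)} = #(nbrs Γ univ v) - f v := by
    rw [← Fintype.card_fin (#(nbrs Γ univ v) - f v), ← Finset.card_univ]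
    symm
    choose g hg hg' using hM'
    have hgd : ∀ i : Fin (#(nbrs Γ univ v) - f v), ∃ d : Γ.Dart, d.fst = v ∧
        M.Adj (.inr ⟨v, i⟩) (.inl d) := by
      intro i
      have h := hg (.inr ⟨v, i⟩)
      have h' := M.adj_sub h
      cases hgi : g (.inr ⟨v, i⟩) with
      | inl d => rw [hgi] at h h'; exact ⟨d, h', h⟩
      | inr e => rw [hgi] at h'; exact h'.elim
    choose p hp hp' using hgd
    have huni : ∀ a b c, M.Adj a b → M.Adj a c → b = c := fun a b c hb hc =>
      (hg' a b hb).trans (hg' a c hc).symm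
    refine Finset.card_bij (fun i _ => p i) ?_ ?_ ?_
    · intro i _
      rw [Finset.mem_filter]
      refine ⟨by simp [hP, hp], fun h => ?_⟩
      exact Sum.inl_ne_inr (huni _ _ _ h (hp' i).symm)
    · intro i _ j _ hij
      have h3 := hp' i
      rw [hij] at h3
      have := huni _ _ _ h3.symm (hp' j).symm
      simpa using this
    · intro d hd
      simp only [hP, mem_filter, mem_univ, true_and, and_true, mem_singleton] at hd
      obtain ⟨hd1, hd2⟩ := hd
      have h := hg (.inl d)
      have h' := M.adj_sub h
      cases hgi : g (.inl d) with
      | inl d' =>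
        rw [hgi] at h h'
        have h'' : d' = d.symm := h'
        rw [h''] at h
        exact absurd h hd2
      | inr e =>
        obtain ⟨w, i⟩ := e
        rw [hgi] at h h'
        have h'' : d.fst = w := h'
        obtain rfl : w = v := h''.symm.trans hd1
        exact ⟨i, mem_univ _, Sum.inl_injective (huni _ _ _ (hp' i) h.symm)⟩
  have h3 := Finset.card_filter_add_card_filter_not (s := P)
    (p := fun d => M.Adj (.inl d) (.inl d.symm))
  have := hf v
  omega

/-- A lower bound for the number of deleted gadget vertices, by the types of the vertices. -/
theorem gadget_count [DecidableEq V] {Γ : SimpleGraph V} {f : V → ℕ} [Fintype Γ.Dart]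
    (X : Finset (Γ.Dart ⊕ Σ v, Fin (#(nbrs Γ univ v) - f v))) {S T U : Finset V}
    (hSU : Disjoint S U) (hTU : Disjoint T U)
    (hS : ∀ d : Γ.Dart, d.fst ∈ S → .inl d ∈ X)
    (hT : ∀ v ∈ T, ∀ i, .inr ⟨v, i⟩ ∈ X) {κ : Type*} (c : V → κ)
    (hc : ∀ d : Γ.Dart, d.fst ∈ U → d.snd ∈ U → .inl d ∉ X → .inl d.symm ∉ X → c d.fst = c d.snd) :
    ∑ v ∈ T, (#(nbrs Γ univ v) - f v) + ∑ v ∈ S, #(nbrs Γ univ v) +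
      #{d : Γ.Dart | .inl d ∈ X ∧ d.fst ∉ S ∧ d.snd ∈ T} + cross (edges Γ) U c ≤ #X := by
  classical
  have e1 : ∑ v ∈ T, (#(nbrs Γ univ v) - f v) ≤ #X.toRight := by
    have : ∑ v ∈ T, (#(nbrs Γ univ v) - f v) =
        #(T.sigma fun v => (univ : Finset (Fin (#(nbrs Γ univ v) - f v)))) := by
      simp [Finset.card_sigma]
    rw [this]
    refine Finset.card_le_card fun e he => ?_
    rw [Finset.mem_sigma] at he
    exact Finset.mem_toRight.2 (hT _ he.1 _)
  have e2 : cross (edges Γ) U c ≤ #{d : Γ.Dart | .inl d ∈ X ∧ d.fst ∉ S ∧ d.snd ∈ U} := by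
    refine (Finset.card_le_card ?_).trans (Finset.card_image_le (f := SimpleGraph.Dart.edge))
    intro e he
    induction e using Sym2.ind with
    | _ x y =>
      rw [mem_crossSet, mem_edges, SimpleGraph.mem_edgeSet, Finset.mk_mem_sym2_iff, Sym2.map_mk,
        Sym2.mk_isDiag_iff] at he
      obtain ⟨hxy, ⟨hx, hy⟩, hne⟩ := he
      have hxS := Finset.disjoint_right.1 hSU hx
      have hyS := Finset.disjoint_right.1 hSU hy
      rw [Finset.mem_image]
      by_contra! hno
      refine hne (hc ⟨(x, y), hxy⟩ hx hy (fun h => ?_) fun h => ?_)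
      · exact hno ⟨(x, y), hxy⟩ (Finset.mem_filter.2 ⟨mem_univ _, h, hxS, hy⟩) rfl
      · exact hno ⟨(y, x), hxy.symm⟩ (Finset.mem_filter.2 ⟨mem_univ _, h, hyS, hx⟩) Sym2.eq_swap
  have e3 : ∑ v ∈ S, #(nbrs Γ univ v) = #{d : Γ.Dart | d.fst ∈ S ∧ d.snd ∈ (univ : Finset V)} :=
    (card_darts _ _ _).symm
  have e4 : #{d : Γ.Dart | d.fst ∈ S ∧ d.snd ∈ (univ : Finset V)} +
      #{d : Γ.Dart | .inl d ∈ X ∧ d.fst ∉ S ∧ d.snd ∈ T} +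
      #{d : Γ.Dart | .inl d ∈ X ∧ d.fst ∉ S ∧ d.snd ∈ U} ≤ #X.toLeft := by
    rw [← Finset.card_union_of_disjoint, ← Finset.card_union_of_disjoint]
    · refine Finset.card_le_card fun d hd => ?_
      simp only [mem_union, mem_filter, mem_univ, true_and, and_true] at hd
      rw [Finset.mem_toLeft]
      rcases hd with (h | h) | h
      · exact hS d h
      · exact h.1
      · exact h.1
    · rw [Finset.disjoint_left]
      intro d hd hd'
      simp only [mem_union, mem_filter, mem_univ, true_and, and_true] at hd hd'
      rcases hd with h | h
      · exact hd'.2.1 h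
      · exact Finset.disjoint_left.1 hTU h.2.2 hd'.2.2
    · rw [Finset.disjoint_left]
      intro d hd hd'
      simp only [mem_filter, mem_univ, true_and, and_true] at hd hd'
      exact hd'.2.1 hd
  have e5 := X.card_toLeft_add_card_toRight
  omega

/-- Tutte's `f`-factor theorem, the sufficiency of the condition. -/
theorem exists_factor [DecidableEq V] (Γ : SimpleGraph V) (f : V → ℕ) (heven : Even (∑ v, f v))
    (hf : ∀ v, f v ≤ #(nbrs Γ univ v))
    (h : ∀ S T : Finset V, Disjoint S T → ∀ c : V → V,
      #(palette (S ∪ T)ᶜ c) + ∑ v ∈ T, f v ≤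
        ∑ v ∈ S, f v + ∑ v ∈ T, #(nbrs Γ Sᶜ v) + cross (edges Γ) (S ∪ T)ᶜ c + 1) :
    ∃ F : Finset (Sym2 V), (∀ e ∈ F, e ∈ Γ.edgeSet) ∧ ∀ v, edgeDegree F v = f v := by
  classical
  by_cases hM : ∃ M : (gadget Γ f).Subgraph, M.IsPerfectMatching
  · obtain ⟨M, hM⟩ := hM
    exact exists_factor_of_perfectMatching hf hM
  exfalso
  have hcardW : Even (Fintype.card (Γ.Dart ⊕ Σ v, Fin (#(nbrs Γ univ v) - f v))) := by
    rw [Fintype.card_sum, Fintype.card_sigma]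
    have h1 := card_darts Γ univ univ
    simp only [mem_univ, true_and, filter_true, card_univ] at h1
    rw [h1]
    simp only [Fintype.card_fin]
    have h2 : ∑ v, #(nbrs Γ univ v) = ∑ v, (#(nbrs Γ univ v) - f v) + ∑ v, f v := by
      rw [← Finset.sum_add_distrib]
      exact Finset.sum_congr rfl fun v _ => (Nat.sub_add_cancel (hf v)).symm
    rw [h2]
    rw [Nat.even_iff] at heven ⊢
    omega
  obtain ⟨X, O, hXO, hO⟩ := exists_odd_reachSets (gadget Γ f) hcardW hM
  set K := gadget Γ f with hK
  -- X sorts the vertices: at S all darts are deleted but some extra vertex remains; at T all extra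
  -- vertices are deleted, which includes the case that there are none; at the others both kinds
  -- survive and are connected to each other.
  set S : Finset V := {v | (∃ i, .inr ⟨v, i⟩ ∉ X) ∧ ∀ d : Γ.Dart, d.fst = v → .inl d ∈ X} with hS
  set T : Finset V := {v | ∀ i, .inr ⟨v, i⟩ ∈ X} with hT
  have hmS : ∀ v, v ∈ S ↔ (∃ i, .inr ⟨v, i⟩ ∉ X) ∧ ∀ d : Γ.Dart, d.fst = v → .inl d ∈ X := by
    simp [hS]
  have hmT : ∀ v, v ∈ T ↔ ∀ i, .inr ⟨v, i⟩ ∈ X := by simp [hT]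
  have hST : Disjoint S T := by
    rw [Finset.disjoint_left]
    intro v hv hv'
    obtain ⟨i, hi⟩ := ((hmS v).1 hv).1
    exact hi ((hmT v).1 hv' i)
  set U : Finset V := (S ∪ T)ᶜ with hU
  have hmU : ∀ v, v ∈ U ↔ v ∉ S ∧ v ∉ T := by simp [hU]
  let c : V → Set (Γ.Dart ⊕ Σ v, Fin (#(nbrs Γ univ v) - f v)) := fun v =>
    if h : ∃ i, .inr ⟨v, i⟩ ∉ X then reachSet K X (.inr ⟨v, h.choose⟩) else ∅
  have hcd : ∀ d : Γ.Dart, .inl d ∉ X → d.fst ∉ T → reachSet K X (.inl d) = c d.fst := by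
    intro d hd hdT
    have hex : ∃ i, .inr ⟨d.fst, i⟩ ∉ X := by
      rw [hmT] at hdT
      simpa using hdT
    simp only [c, dif_pos hex]
    exact reachSet_eq_of_adj hd hex.choose_spec (show d.fst = d.fst from rfl)
  have hdS : ∀ d : Γ.Dart, .inl d ∉ X → d.fst ∉ S := fun d hd hdS => hd (((hmS _).1 hdS).2 d rfl)
  -- An odd component either meets the gadget of a vertex in U, or contains an extra vertex at S, or
  -- consists of one dart at T whose reversal is deleted. A dart and its reversal both at T form an
  -- even component.
  have hOsub : O ⊆ palette U c ∪
      ((S.sigma fun v => (univ : Finset (Fin (#(nbrs Γ univ v) - f v)))).image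
        fun e => reachSet K X (.inr e)) ∪
      (({d : Γ.Dart | .inl d ∉ X ∧ d.fst ∈ T ∧ .inl d.symm ∈ X} : Finset _).image
        fun d => reachSet K X (.inl d)) := by
    intro C hC
    obtain ⟨hodd, a, ha, rfl⟩ := hO C hC
    rw [Finset.mem_union, Finset.mem_union]
    cases a with
    | inr e =>
      obtain ⟨v, i⟩ := e
      left
      by_cases hvS : v ∈ S
      · exact Or.inr (Finset.mem_image.2 ⟨⟨v, i⟩, Finset.mem_sigma.2 ⟨hvS, mem_univ _⟩, rfl⟩)
      · left
        have hvT : v ∉ T := fun h => ha ((hmT v).1 h i)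
        obtain ⟨d, rfl, hd⟩ : ∃ d : Γ.Dart, d.fst = v ∧ .inl d ∉ X := by
          by_contra! hno
          exact hvS ((hmS v).2 ⟨⟨i, ha⟩, hno⟩)
        refine mem_palette.2 ⟨d.fst, (hmU _).2 ⟨hvS, hvT⟩, ?_⟩
        rw [← hcd d hd hvT]
        exact reachSet_eq_of_adj hd ha (show d.fst = d.fst from rfl)
    | inl d =>
      by_cases hdT : d.fst ∈ T
      · by_cases hdX : .inl d.symm ∈ X
        · exact Or.inr (Finset.mem_image.2 ⟨d, by simp [ha, hdT, hdX], rfl⟩)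
        · have hadj : K.Adj (.inl d) (.inl d.symm) := rfl
          by_cases hsT : d.symm.fst ∈ T
          · exfalso
            have heq : reachSet K X (.inl d) = {.inl d, .inl d.symm} := by
              ext b
              constructor
              · intro hb
                induction hb with
                | refl => exact Or.inl rfl
                | @tail b b' _ hbb ih =>
                  have key : ∀ d' : Γ.Dart, d'.fst ∈ T → b = .inl d' → b' = .inl d'.symm := by
                    rintro d' hd' rfl
                    obtain ⟨hbb1, hbb2⟩ := hbb
                    cases b' with
                    | inl d'' => exact congrArg Sum.inl hbb1
                    | inr e =>
                      obtain ⟨w, i⟩ := e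
                      have hw : d'.fst = w := hbb1
                      subst hw
                      exact absurd ((hmT _).1 hd' i) hbb2
                  rcases ih with rfl | rfl
                  · exact Or.inr (key d hdT rfl)
                  · left
                    rw [key d.symm hsT rfl, SimpleGraph.Dart.symm_symm]
              · rintro (rfl | rfl)
                · exact .refl
                · exact .single ⟨hadj, hdX⟩
            rw [heq, Set.ncard_pair (K.ne_of_adj hadj)] at hodd
            exact absurd hodd (by decide)
          · left; left
            rw [reachSet_eq_of_adj ha hdX hadj, hcd _ hdX hsT]
            exact mem_palette_of_mem c ((hmU _).2 ⟨hdS _ hdX, hsT⟩)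
      · left; left
        rw [hcd d ha hdT]
        exact mem_palette_of_mem c ((hmU _).2 ⟨hdS _ ha, hdT⟩)
  have hOcard := (Finset.card_le_card hOsub).trans ((Finset.card_union_le _ _).trans
    (Nat.add_le_add (Finset.card_union_le _ _) le_rfl))
  have k1 : #((S.sigma fun v => (univ : Finset (Fin (#(nbrs Γ univ v) - f v)))).image
        fun e => reachSet K X (.inr e)) ≤ ∑ v ∈ S, (#(nbrs Γ univ v) - f v) :=
    Finset.card_image_le.trans (by simp [Finset.card_sigma])
  -- Reversing such a dart gives a deleted dart ending in T. Those starting outside S cancel against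
  -- the same term in the lower bound for #X.
  have k2 : #(({d : Γ.Dart | .inl d ∉ X ∧ d.fst ∈ T ∧ .inl d.symm ∈ X} : Finset _).image
        fun d => reachSet K X (.inl d)) ≤
      #{d : Γ.Dart | .inl d ∈ X ∧ d.fst ∉ S ∧ d.snd ∈ T} + ∑ v ∈ T, #(nbrs Γ S v) := by
    rw [← card_darts]
    refine Finset.card_image_le.trans ?_
    have : #{d : Γ.Dart | .inl d ∈ X ∧ d.fst ∉ S ∧ d.snd ∈ T} =
        #(({d : Γ.Dart | .inl d ∈ X ∧ d.fst ∉ S ∧ d.snd ∈ T} : Finset _).image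
          SimpleGraph.Dart.symm) :=
      (Finset.card_image_of_injective _ SimpleGraph.Dart.symm_involutive.injective).symm
    rw [this]
    refine (Finset.card_le_card ?_).trans (Finset.card_union_le _ _)
    intro d hd
    simp only [mem_filter, mem_univ, true_and] at hd
    rw [Finset.mem_union]
    by_cases hs : d.snd ∈ S
    · exact Or.inr (by simp [hd.2.1, hs])
    · exact Or.inl (Finset.mem_image.2 ⟨d.symm, by simp [hd, hs], d.symm_symm⟩)
  have k3 := gadget_count X (Finset.disjoint_left.2 fun v hv hv' => ((hmU v).1 hv').1 hv)
    (Finset.disjoint_left.2 fun v hv hv' => ((hmU v).1 hv').2 hv)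
    (fun d hd => ((hmS _).1 hd).2 d rfl) (fun v hv i => (hmT v).1 hv i) c
    (fun d hd hd' hdX hdX' => by
      rw [← hcd d hdX ((hmU _).1 hd).2, reachSet_eq_of_adj hdX hdX' rfl]
      exact hcd d.symm hdX' ((hmU _).1 hd').2)
  obtain ⟨c', hc'⟩ := exists_vertex_coloring c
  have k4 := h S T hST c'
  rw [← hU, card_palette_congr (d := c) fun x _ y _ => (hc' x y).symm,
    cross_congr (d := c) fun x _ y _ => (hc' x y).symm] at k4
  have k5 : ∀ A : Finset V, ∑ v ∈ A, (#(nbrs Γ univ v) - f v) + ∑ v ∈ A, f v =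
      ∑ v ∈ A, #(nbrs Γ univ v) := fun A => by
    rw [← Finset.sum_add_distrib]
    exact Finset.sum_congr rfl fun v _ => Nat.sub_add_cancel (hf v)
  have k6 : ∑ v ∈ T, #(nbrs Γ S v) + ∑ v ∈ T, #(nbrs Γ Sᶜ v) = ∑ v ∈ T, #(nbrs Γ univ v) := by
    rw [← Finset.sum_add_distrib]
    refine Finset.sum_congr rfl fun v _ => ?_
    rw [← Finset.card_union_of_disjoint]
    · congr 1
      ext w
      simp only [mem_union, mem_nbrs, mem_compl, mem_univ, true_and]
      tauto
    · rw [Finset.disjoint_left]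
      intro w hw hw'
      simp only [mem_nbrs, mem_compl] at hw hw'
      exact hw'.1 hw.1
  have := k5 S
  have := k5 T
  omega

end Factor

end TreeFactor

namespace TreeFactor
open Finset

/-! ### Nearly regular factors of tough graphs. -/

section RegularFactor

variable {V : Type*}

/-- For m = 1 the ends of an edge form a tight set, so merging their colours loses no more colours
than crossing edges. -/
theorem tight_pair [DecidableEq V] {E : Finset (Sym2 V)} {x y : V} (h : s(x, y) ∈ E) :
    Tight 1 E {x, y} := by
  intro c
  by_cases hc : c x = c y
  · have : #(palette {x, y} c) ≤ 1 := card_palette_le_one_of_const fun a ha b hb => by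
      rw [Finset.mem_insert, Finset.mem_singleton] at ha hb
      rcases ha with rfl | rfl <;> rcases hb with rfl | rfl <;> simp [hc]
    omega
  · have h1 : 1 ≤ cross E {x, y} c := Finset.card_pos.2 ⟨s(x, y), by simp [h, hc]⟩
    have h2 : #(palette {x, y} c) ≤ 2 := by
      classical
      refine (Finset.card_le_card (t := ({x, y} : Finset V).image c) fun a ha => ?_).trans
        (Finset.card_image_le.trans Finset.card_le_two)
      simpa [eq_comm] using ha
    omega

/-- Identifying the colours of the ends of crossing edges until none is left. -/
theorem exists_const_coloring (E : Finset (Sym2 V)) (X : Finset V) (c : V → V) :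
    ∃ c' : V → V, (∀ x ∈ X, ∀ y ∈ X, s(x, y) ∈ E → c' x = c' y) ∧
      #(palette X c) ≤ #(palette X c') + cross E X c := by
  classical
  induction hn : #(palette X c) using Nat.strong_induction_on generalizing c with
  | _ n ih =>
    by_cases h : ∀ x ∈ X, ∀ y ∈ X, s(x, y) ∈ E → c x = c y
    · exact ⟨c, h, by omega⟩
    push Not at h
    obtain ⟨x, hx, y, hy, hxy, hne⟩ := h
    obtain ⟨c₁, -, -, h2, h3⟩ := exists_merge (tight_pair hxy)
      (Finset.insert_subset hx (Finset.singleton_subset_iff.2 hy)) c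
    rcases h3 with h3 | h3
    · obtain ⟨c', hc', hle⟩ := ih _ (by omega) c₁ rfl
      exact ⟨c', hc', by omega⟩
    · exact absurd (h3 x (by simp) y (by simp)) hne

theorem ToughColoring.mul_le [Fintype V] [DecidableEq V] {Γ : SimpleGraph V} {t : ℝ}
    (h : ToughColoring Γ t) {r : ℕ} (hrt : (r : ℝ) ≤ t) {κ : Type*} (D : Finset V) (c : V → κ)
    (hc : ∀ x y, x ∉ D → y ∉ D → Γ.Adj x y → c x = c y) {k : ℕ} (hk : 2 ≤ k)
    (hkc : k ≤ #(palette Dᶜ c)) : r * k ≤ #D := by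
  have h1 := h.le ((Nat.cast_nonneg r).trans hrt) D c hc hk hkc
  have h2 : (r : ℝ) * k ≤ t * k := mul_le_mul_of_nonneg_right hrt (Nat.cast_nonneg k)
  exact_mod_cast h2.trans h1

/-- A greedy independent dominating set, chosen by increasing values of `d`. -/
theorem exists_greedy_independent [DecidableEq V] (Γ : SimpleGraph V) (d : V → ℕ) (r : ℕ)
    (A : Finset V) (hd : ∀ v ∈ A, #(nbrs Γ A v) ≤ d v) :
    ∃ I ⊆ A, (∀ v ∈ I, ∀ w ∈ I, ¬ Γ.Adj v w) ∧ (∀ v ∈ A, v ∈ I ∨ ∃ w ∈ I, Γ.Adj v w) ∧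
      ∑ v ∈ A, (r - d v) ≤ ∑ v ∈ I, (d v + 1) * (r - d v) := by
  classical
  induction hn : #A using Nat.strong_induction_on generalizing A with
  | _ n ih =>
    rcases A.eq_empty_or_nonempty with rfl | hA
    · exact ⟨∅, by simp⟩
    obtain ⟨v, hv, hmin⟩ := Finset.exists_min_image A d hA
    set N := insert v (nbrs Γ A v) with hN
    have hNA : N ⊆ A := Finset.insert_subset hv fun w hw => (mem_nbrs.1 hw).1
    have hvN : v ∈ N := Finset.mem_insert_self _ _
    obtain ⟨I, hIA, hind, hdom, hsum⟩ := ih #(A \ N) (by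
        rw [← hn]
        exact Finset.card_lt_card (Finset.sdiff_ssubset hNA ⟨v, hvN⟩)) (A \ N)
      (fun w hw => (Finset.card_le_card fun z hz => by
        rw [mem_nbrs] at hz ⊢
        exact ⟨(Finset.mem_sdiff.1 hz.1).1, hz.2⟩).trans (hd w (Finset.mem_sdiff.1 hw).1)) rfl
    have hvI : v ∉ I := fun h => (Finset.mem_sdiff.1 (hIA h)).2 hvN
    have hvadj : ∀ w ∈ I, ¬ Γ.Adj v w := fun w hw h =>
      (Finset.mem_sdiff.1 (hIA hw)).2
        (Finset.mem_insert_of_mem (mem_nbrs.2 ⟨(Finset.mem_sdiff.1 (hIA hw)).1, h⟩))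
    refine ⟨insert v I, Finset.insert_subset hv (hIA.trans Finset.sdiff_subset), ?_, ?_, ?_⟩
    · intro a ha b hb
      rw [Finset.mem_insert] at ha hb
      rcases ha with rfl | ha
      · rcases hb with rfl | hb
        · exact Γ.irrefl
        · exact hvadj b hb
      · rcases hb with rfl | hb
        · exact fun h => hvadj a ha h.symm
        · exact hind a ha b hb
    · intro w hw
      by_cases hwN : w ∈ N
      · rcases Finset.mem_insert.1 hwN with rfl | hwN
        · exact Or.inl (Finset.mem_insert_self _ _)
        · exact Or.inr ⟨v, Finset.mem_insert_self _ _, (mem_nbrs.1 hwN).2.symm⟩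
      · rcases hdom w (Finset.mem_sdiff.2 ⟨hw, hwN⟩) with h | ⟨z, hz, hwz⟩
        · exact Or.inl (Finset.mem_insert_of_mem h)
        · exact Or.inr ⟨z, Finset.mem_insert_of_mem hz, hwz⟩
    · rw [Finset.sum_insert hvI, ← Finset.sum_sdiff hNA, add_comm]
      refine Nat.add_le_add ?_ hsum
      -- Since d is smallest at v, each of the at most d v + 1 removed vertices has deficiency at
      -- most r − d v.
      have h1 : ∑ w ∈ N, (r - d w) ≤ #N * (r - d v) := by
        rw [← smul_eq_mul]
        exact Finset.sum_le_card_nsmul _ _ _ fun w hw => Nat.sub_le_sub_left (hmin w (hNA hw)) r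
      refine h1.trans (Nat.mul_le_mul_right _ ?_)
      exact (Finset.card_insert_le _ _).trans (Nat.succ_le_succ (hd v hv))

theorem sum_nbrs_comm (Γ : SimpleGraph V) (A B : Finset V) :
    ∑ v ∈ A, #(nbrs Γ B v) = ∑ w ∈ B, #(nbrs Γ A w) := by
  classical
  have h := Finset.sum_card_bipartiteAbove_eq_sum_card_bipartiteBelow (s := A) (t := B) Γ.Adj
  have h1 : ∀ v, nbrs Γ B v = Finset.bipartiteAbove Γ.Adj B v := fun v => by
    ext w; simp [Finset.bipartiteAbove]
  have h2 : ∀ w, nbrs Γ A w = Finset.bipartiteBelow Γ.Adj A w := fun w => by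
    ext v; simp [Finset.bipartiteBelow, Γ.adj_comm]
  simp only [h1, h2]
  exact h

variable [Fintype V] [DecidableEq V]

/-- Deleting `S` and the neighbourhood of an independent set. -/
theorem sum_sub_le_of_independent {Γ : SimpleGraph V} {t : ℝ} (h : ToughColoring Γ t) {r : ℕ}
    (hrt : (r : ℝ) ≤ t) {S I : Finset V} (hSI : Disjoint S I)
    (hind : ∀ v ∈ I, ∀ w ∈ I, ¬ Γ.Adj v w) (hI : 2 ≤ #I) :
    r * #I ≤ #S + ∑ v ∈ I, #(nbrs Γ Sᶜ v) := by
  set D := S ∪ I.biUnion (nbrs Γ Sᶜ) with hD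
  have hID : ∀ v ∈ I, v ∉ D := by
    intro v hv hvD
    rcases Finset.mem_union.1 hvD with hvS | hvD
    · exact Finset.disjoint_left.1 hSI hvS hv
    · obtain ⟨w, hw, hwv⟩ := Finset.mem_biUnion.1 hvD
      exact hind w hw v hv (mem_nbrs.1 hwv).2
  have key : ∀ x y, x ∉ D → y ∉ D → Γ.Adj x y → x ∉ I := by
    intro x y _ hy hxy hx
    refine hy (Finset.mem_union.2 ?_)
    by_cases hyS : y ∈ S
    · exact Or.inl hyS
    · exact Or.inr (Finset.mem_biUnion.2 ⟨x, hx, mem_nbrs.2 ⟨Finset.mem_compl.2 hyS, hxy⟩⟩)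
  have h1 := h.mul_le hrt D (fun v => if v ∈ I then some v else none) (fun x y hx hy hxy => by
    rw [if_neg (key x y hx hy hxy), if_neg (key y x hy hx hxy.symm)]) hI (by
      rw [← Finset.card_map Function.Embedding.some]
      refine Finset.card_le_card fun a ha => ?_
      obtain ⟨v, hv, rfl⟩ := Finset.mem_map.1 ha
      exact mem_palette.2 ⟨v, Finset.mem_compl.2 (hID v hv), by simp [hv]⟩)
  exact h1.trans ((Finset.card_union_le _ _).trans (Nat.add_le_add_left Finset.card_biUnion_le _))

/-- The case of a single vertex, where deleting its neighbourhood need not disconnect. -/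
theorem lt_card_add_nbrs {Γ : SimpleGraph V} {t : ℝ} (h : ToughColoring Γ t) {r : ℕ}
    (hr : 1 ≤ r) (hrt : (r : ℝ) ≤ t) (hn : r + 2 ≤ Fintype.card V) {S : Finset V} {v : V}
    (hv : v ∉ S) : r + 1 ≤ #S + #(nbrs Γ Sᶜ v) := by
  set D := S ∪ nbrs Γ Sᶜ v with hD
  have hDc : #D ≤ #S + #(nbrs Γ Sᶜ v) := Finset.card_union_le _ _
  have hvD : v ∉ D := by simp [hD, hv]
  by_cases hex : ∃ w, w ∉ D ∧ w ≠ v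
  · obtain ⟨w, hw, hwv⟩ := hex
    have key : ∀ x y, y ∉ D → Γ.Adj x y → x ≠ v := by
      rintro x y hy hxy rfl
      refine hy (Finset.mem_union.2 ?_)
      by_cases hyS : y ∈ S
      · exact Or.inl hyS
      · exact Or.inr (mem_nbrs.2 ⟨Finset.mem_compl.2 hyS, hxy⟩)
    have h1 := h.mul_le hrt D (fun x => decide (x = v)) (fun x y hx hy hxy => by
      simp [key x y hy hxy, key y x hx hxy.symm]) le_rfl (by
        rw [← Finset.card_pair (Bool.false_ne_true)]
        refine Finset.card_le_card fun a ha => ?_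
        rw [Finset.mem_insert, Finset.mem_singleton] at ha
        rcases ha with rfl | rfl
        · exact mem_palette.2 ⟨w, Finset.mem_compl.2 hw, by simp [hwv]⟩
        · exact mem_palette.2 ⟨v, Finset.mem_compl.2 hvD, by simp⟩)
    omega
  · push Not at hex
    have : (univ : Finset V) ⊆ insert v D := fun w _ => by
      by_cases hw : w ∈ D
      · exact Finset.mem_insert_of_mem hw
      · rw [hex w hw]; exact Finset.mem_insert_self _ _
    have h2 := (Finset.card_le_card this).trans (Finset.card_insert_le _ _)
    rw [Finset.card_univ] at h2
    omega

/-- The main cut: the vertices of `I` and the colour classes with a vertex not adjacent to `I`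
are separated by deleting `S`, `R` and suitable neighbours of `I`. -/
theorem card_le_of_independent {Γ : SimpleGraph V} {t : ℝ} (h : ToughColoring Γ t) {r : ℕ}
    (hrt : (r : ℝ) ≤ t) {S R I C U : Finset V}
    (hpart : ∀ v, v ∉ S → v ∉ R → v ∈ I ∨ v ∈ C ∨ v ∈ U)
    (hIS : ∀ v ∈ I, v ∉ S ∧ v ∉ R ∧ v ∉ C ∧ v ∉ U) (hCS : ∀ v ∈ C, v ∉ S ∧ v ∉ U)
    (hUS : ∀ v ∈ U, v ∉ S ∧ v ∉ R)
    (hind : ∀ v ∈ I, ∀ w ∈ I, ¬ Γ.Adj v w) (hdom : ∀ v ∈ C, ∃ w ∈ I, Γ.Adj v w)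
    {c : V → V} (hc : ∀ x ∈ U, ∀ y ∈ U, Γ.Adj x y → c x = c y) :
    ∃ p ≤ #(palette U c), #C + p ≤ ∑ v ∈ I, #(nbrs Γ Sᶜ v) ∧
      (2 ≤ #I + (#(palette U c) - p) →
        r * (#I + (#(palette U c) - p)) + p ≤ #S + #R + ∑ v ∈ I, #(nbrs Γ Sᶜ v)) := by
  classical
  -- A class is bad if each of its vertices has a neighbour in I. Neighbours of I in U are deleted,
  -- except that a bad class keeps its representative if this has a unique neighbour in I; so each
  -- bad class saves one in the count of edges from I.
  let bad : V → Prop := fun a => ∀ y ∈ U, c y = a → 1 ≤ #(nbrs Γ I y)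
  have hrep : ∀ a, ∃ y, a ∈ palette U c → y ∈ U ∧ c y = a := fun a => by
    by_cases ha : a ∈ palette U c
    · obtain ⟨y, hy, rfl⟩ := mem_palette.1 ha
      exact ⟨y, fun _ => ⟨hy, rfl⟩⟩
    · exact ⟨a, fun h => absurd h ha⟩
  choose rep hrep using hrep
  set B : Finset V := {y ∈ U | bad (c y) ∧ rep (c y) = y} with hB
  set Y : Finset V := {y ∈ U | 1 ≤ #(nbrs Γ I y) ∧ ¬ (y ∈ B ∧ #(nbrs Γ I y) = 1)} with hY
  set Q : Finset V := {a ∈ palette U c | bad a} with hQ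
  have hQB : #Q ≤ #B := by
    refine Finset.card_le_card_of_injOn rep (fun a ha => ?_) fun a ha b hb hab => ?_
    · have ha' := Finset.mem_filter.1 ha
      obtain ⟨h1, h2⟩ := hrep a ha'.1
      refine Finset.mem_filter.2 ⟨h1, ?_⟩
      rw [h2]
      exact ⟨ha'.2, rfl⟩
    · rw [← (hrep a (Finset.mem_filter.1 ha).1).2, ← (hrep b (Finset.mem_filter.1 hb).1).2, hab]
  have hQle : #Q ≤ #(palette U c) := Finset.card_filter_le _ _
  have hUsum : #Y + #B ≤ ∑ y ∈ U, #(nbrs Γ I y) := by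
    have e1 : #Y = ∑ y ∈ U, if y ∈ Y then 1 else 0 := by
      rw [← Finset.card_filter]
      congr 1
      ext y
      simp only [mem_filter]
      exact ⟨fun hy => ⟨(Finset.mem_filter.1 hy).1, hy⟩, fun hy => hy.2⟩
    have e2 : #B = ∑ y ∈ U, if y ∈ B then 1 else 0 := by
      rw [← Finset.card_filter]
      congr 1
      ext y
      simp only [mem_filter]
      exact ⟨fun hy => ⟨(Finset.mem_filter.1 hy).1, hy⟩, fun hy => hy.2⟩
    rw [e1, e2, ← Finset.sum_add_distrib]
    refine Finset.sum_le_sum fun y hy => ?_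
    have k1 : y ∈ Y → 1 ≤ #(nbrs Γ I y) := fun h => (Finset.mem_filter.1 h).2.1
    have k2 : y ∈ B → 1 ≤ #(nbrs Γ I y) := fun h => (Finset.mem_filter.1 h).2.1 y hy rfl
    have k3 : y ∈ Y → y ∈ B → #(nbrs Γ I y) ≠ 1 := fun h hb h1 =>
      (Finset.mem_filter.1 h).2.2 ⟨hb, h1⟩
    split_ifs with h1 h2 h2
    · have := k1 h1; have := k3 h1 h2; omega
    · have := k1 h1; omega
    · have := k2 h2; omega
    · omega
  have hsum : #C + (#Y + #B) ≤ ∑ v ∈ I, #(nbrs Γ Sᶜ v) := by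
    rw [sum_nbrs_comm]
    have hCU : Disjoint C U := Finset.disjoint_left.2 fun v hv => (hCS v hv).2
    refine le_trans ?_ (Finset.sum_le_sum_of_subset (s := C ∪ U) fun v hv => ?_)
    · rw [Finset.sum_union hCU]
      refine Nat.add_le_add ?_ hUsum
      rw [Finset.card_eq_sum_ones]
      refine Finset.sum_le_sum fun v hv => ?_
      obtain ⟨w, hw, hvw⟩ := hdom v hv
      exact Finset.card_pos.2 ⟨w, mem_nbrs.2 ⟨hw, hvw⟩⟩
    · rw [Finset.mem_compl]
      rcases Finset.mem_union.1 hv with hv | hv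
      · exact (hCS v hv).1
      · exact (hUS v hv).1
  refine ⟨#Q, hQle, by omega, fun hk => ?_⟩
  set D := S ∪ R ∪ C ∪ Y with hD
  have hDc : #D ≤ #S + #R + #C + #Y := by
    refine (Finset.card_union_le _ _).trans (Nat.add_le_add_right ?_ _)
    refine (Finset.card_union_le _ _).trans (Nat.add_le_add_right ?_ _)
    exact Finset.card_union_le _ _
  have hDmem : ∀ x, x ∉ D → (x ∈ I) ∨ (x ∈ U ∧ x ∉ Y) := by
    intro x hx
    simp only [hD, mem_union, not_or] at hx
    rcases hpart x hx.1.1.1 hx.1.1.2 with h | h | h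
    · exact Or.inl h
    · exact absurd h hx.1.2
    · exact Or.inr ⟨h, hx.2⟩
  have hg : ∀ y, ∃ w, (nbrs Γ I y).Nonempty → w ∈ nbrs Γ I y := fun y => by
    by_cases hne : (nbrs Γ I y).Nonempty
    · exact ⟨hne.choose, fun _ => hne.choose_spec⟩
    · exact ⟨y, fun h => absurd h hne⟩
  choose g hg using hg
  -- The surviving representative of a bad class joins the component of its only neighbour in I.
  let c₂ : V → V ⊕ V := fun z => if z ∈ I then .inl z else if bad (c z) then .inl (g z) else .inr (c z)
  have hUY : ∀ y ∈ U, y ∉ Y → 1 ≤ #(nbrs Γ I y) → y ∈ B ∧ #(nbrs Γ I y) = 1 := by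
    intro y hy hyY h1
    by_contra hno
    exact hyY (Finset.mem_filter.2 ⟨hy, h1, hno⟩)
  have hIU : ∀ x ∈ I, ∀ y ∈ U, y ∉ Y → Γ.Adj y x → c₂ x = c₂ y := by
    intro x hx y hy hyY hyx
    have hxm : x ∈ nbrs Γ I y := mem_nbrs.2 ⟨hx, hyx⟩
    obtain ⟨hyB, hy1⟩ := hUY y hy hyY (Finset.card_pos.2 ⟨x, hxm⟩)
    have hyI : y ∉ I := fun h => (hIS y h).2.2.2 hy
    have hb : bad (c y) := (Finset.mem_filter.1 hyB).2.1
    simp only [c₂, if_pos hx, if_neg hyI, if_pos hb]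
    congr 1
    exact Finset.card_le_one.1 hy1.le _ hxm _ (hg y ⟨x, hxm⟩)
  have hc₂ : ∀ x y, x ∉ D → y ∉ D → Γ.Adj x y → c₂ x = c₂ y := by
    intro x y hx hy hxy
    rcases hDmem x hx with hxI | ⟨hxU, hxY⟩ <;> rcases hDmem y hy with hyI | ⟨hyU, hyY⟩
    · exact absurd hxy (hind x hxI y hyI)
    · exact hIU x hxI y hyU hyY hxy.symm
    · exact (hIU y hyI x hxU hxY hxy).symm
    · have hcxy := hc x hxU y hyU hxy
      have hxI : x ∉ I := fun h => (hIS x h).2.2.2 hxU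
      have hyI : y ∉ I := fun h => (hIS y h).2.2.2 hyU
      by_cases hb : bad (c x)
      · have hxB := (hUY x hxU hxY (hb x hxU rfl)).1
        have hyB := (hUY y hyU hyY (hb y hyU hcxy.symm)).1
        have : x = y := by
          rw [← (Finset.mem_filter.1 hxB).2.2, ← (Finset.mem_filter.1 hyB).2.2, hcxy]
        rw [this]
      · have hb' : ¬ bad (c y) := by rwa [← hcxy]
        simp only [c₂, if_neg hxI, if_neg hyI, if_neg hb', hcxy]
  have hcols : #I + (#(palette U c) - #Q) ≤ #(palette Dᶜ c₂) := by
    have e1 : #(palette U c) - #Q = #{a ∈ palette U c | ¬ bad a} := by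
      have : #Q + #{a ∈ palette U c | ¬ bad a} = #(palette U c) :=
        Finset.card_filter_add_card_filter_not _
      omega
    rw [e1, ← Finset.card_disjSum]
    refine Finset.card_le_card fun a ha => ?_
    rcases a with v | a
    · rw [Finset.inl_mem_disjSum] at ha
      obtain ⟨h1, h2, h3, h4⟩ := hIS v ha
      refine mem_palette.2 ⟨v, ?_, by simp only [c₂, if_pos ha]⟩
      simp only [hD, mem_compl, mem_union, not_or]
      exact ⟨⟨⟨h1, h2⟩, h3⟩, fun h => h4 (Finset.mem_filter.1 h).1⟩
    · rw [Finset.inr_mem_disjSum, Finset.mem_filter] at ha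
      obtain ⟨ha, hna⟩ := ha
      have : ∃ y ∈ U, c y = a ∧ #(nbrs Γ I y) = 0 := by
        by_contra! hno
        exact hna fun y hy hya => Nat.one_le_iff_ne_zero.2 (hno y hy hya)
      obtain ⟨y, hy, rfl, hy0⟩ := this
      have hyI : y ∉ I := fun h => (hIS y h).2.2.2 hy
      refine mem_palette.2 ⟨y, ?_, by simp only [c₂, if_neg hyI, if_neg hna]⟩
      simp only [hD, mem_compl, mem_union, not_or]
      refine ⟨⟨hUS y hy, fun h => (hCS y h).2 hy⟩, fun h => ?_⟩
      have := (Finset.mem_filter.1 h).2.1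
      omega
  have h1 := h.mul_le hrt D c₂ hc₂ hk hcols
  omega

/-- The condition of the factor theorem for colourings that are constant along edges. -/
theorem palette_add_sum_sub_le {Γ : SimpleGraph V} {t : ℝ} (h : ToughColoring Γ t) {r : ℕ}
    (hr : 1 ≤ r) (hrt : (r : ℝ) ≤ t) (hn : r + 2 ≤ Fintype.card V) {S T : Finset V}
    (hST : Disjoint S T) (hT : T.Nonempty) {c : V → V}
    (hc : ∀ x ∈ (S ∪ T)ᶜ, ∀ y ∈ (S ∪ T)ᶜ, Γ.Adj x y → c x = c y) :
    #(palette (S ∪ T)ᶜ c) + r * #T ≤ r * #S + ∑ v ∈ T, #(nbrs Γ Sᶜ v) := by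
  classical
  set d : V → ℕ := fun v => #(nbrs Γ Sᶜ v) with hd
  set U := (S ∪ T)ᶜ with hU
  set q := #(palette U c) with hq
  -- Only vertices of T₁ can have a deficiency r − d v; every vertex of R has a surplus of at least
  -- one. The greedy independent set I reduces the total deficiency to r·s.
  set T₁ : Finset V := {v ∈ T | d v ≤ r} with hT₁
  set R : Finset V := {v ∈ T | ¬ d v ≤ r} with hR
  have hT₁S : ∀ v ∈ T₁, v ∈ Sᶜ := fun v hv =>
    Finset.mem_compl.2 (Finset.disjoint_right.1 hST (Finset.mem_filter.1 hv).1)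
  obtain ⟨I, hIT, hind, hdom, hgreedy⟩ := exists_greedy_independent Γ d r T₁ fun v _ =>
    Finset.card_le_card fun w hw => by
      rw [mem_nbrs] at hw ⊢
      exact ⟨hT₁S w hw.1, hw.2⟩
  set s := ∑ v ∈ I, (r - d v) with hs
  have hdI : ∀ v ∈ I, d v ≤ r := fun v hv => (Finset.mem_filter.1 (hIT hv)).2
  have hsI : s + ∑ v ∈ I, d v = r * #I := by
    rw [hs, ← Finset.sum_add_distrib, Finset.sum_congr rfl fun v hv => Nat.sub_add_cancel (hdI v hv),
      Finset.sum_const, smul_eq_mul, mul_comm]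
  have hgr : ∑ v ∈ I, (d v + 1) * (r - d v) ≤ r * s := by
    rw [hs, Finset.mul_sum]
    refine Finset.sum_le_sum fun v hv => ?_
    rcases Nat.lt_or_ge (d v) r with hlt | hge
    · exact Nat.mul_le_mul_right _ hlt
    · rw [Nat.sub_eq_zero_of_le hge]; simp
  have hTsum : r * #T + #R ≤ ∑ v ∈ T₁, (r - d v) + ∑ v ∈ T, d v := by
    have e1 : #T₁ + #R = #T := Finset.card_filter_add_card_filter_not _
    have e2 : ∑ v ∈ T₁, d v + ∑ v ∈ R, d v = ∑ v ∈ T, d v :=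
      Finset.sum_filter_add_sum_filter_not _ _ _
    have e3 : ∑ v ∈ T₁, (r - d v) + ∑ v ∈ T₁, d v = r * #T₁ := by
      rw [← Finset.sum_add_distrib, Finset.sum_congr rfl fun v hv =>
        Nat.sub_add_cancel (Finset.mem_filter.1 hv).2, Finset.sum_const, smul_eq_mul, mul_comm]
    have e4 : #R * (r + 1) ≤ ∑ v ∈ R, d v := by
      rw [← smul_eq_mul]
      exact Finset.card_nsmul_le_sum _ _ _ fun v hv =>
        Nat.lt_of_not_le (Finset.mem_filter.1 hv).2
    rw [← e1, mul_add]
    rw [mul_comm, add_mul, one_mul] at e4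
    omega
  suffices hsuff : q + r * s ≤ r * #S + #R by
    change q + r * #T ≤ r * #S + ∑ v ∈ T, d v
    omega
  -- Add r − 1 times the first inequality to the second. They come from deleting S with the
  -- neighbours of I, and from the main cut.
  have hmul : s ≤ #S → s + q ≤ #S + #R → q + r * s ≤ r * #S + #R := by
    intro h1 h2
    obtain ⟨k, rfl⟩ : ∃ k, r = k + 1 := ⟨r - 1, by omega⟩
    have := Nat.mul_le_mul_left k h1
    rw [add_mul, add_mul, one_mul, one_mul]
    omega
  have hIS : ∀ v ∈ I, v ∉ S := fun v hv => Finset.mem_compl.1 (hT₁S v (hIT hv))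
  have hSI : Disjoint S I := Finset.disjoint_right.2 hIS
  have hmU : ∀ v, v ∈ U ↔ v ∉ S ∧ v ∉ T := by simp [hU]
  have hmT₁ : ∀ v, v ∈ T₁ ↔ v ∈ T ∧ d v ≤ r := by simp [hT₁]
  have hmR : ∀ v, v ∈ R ↔ v ∈ T ∧ ¬ d v ≤ r := by simp [hR]
  have hUcut : ∀ D : Finset V, (∀ v, v ∈ D ↔ v ∉ U) → 2 ≤ q → r * q ≤ #D := by
    intro D hD h2
    have hDU : Dᶜ = U := by ext v; rw [Finset.mem_compl, hD, not_not]
    refine h.mul_le hrt D c (fun x y hx hy hxy => ?_) h2 (by rw [hDU])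
    rw [hD, not_not] at hx hy
    exact hc x hx y hy hxy
  obtain ⟨p, hpq, hCp, hcut⟩ := card_le_of_independent h hrt (S := S) (R := R) (I := I)
    (C := T₁ \ I) (U := U) (c := c)
    (fun v hS hvR => by
      rw [Finset.mem_sdiff, hmT₁, hmU]
      rw [hmR] at hvR
      by_cases hvI : v ∈ I
      · exact Or.inl hvI
      by_cases hvT : v ∈ T
      · exact Or.inr (Or.inl ⟨⟨hvT, not_not.1 fun h => hvR ⟨hvT, h⟩⟩, hvI⟩)
      · exact Or.inr (Or.inr ⟨hS, hvT⟩))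
    (fun v hv => by
      have h1 := (hmT₁ v).1 (hIT hv)
      refine ⟨hIS v hv, fun h => ((hmR v).1 h).2 h1.2, fun h => (Finset.mem_sdiff.1 h).2 hv,
        fun h => ((hmU v).1 h).2 h1.1⟩)
    (fun v hv => by
      have h1 := (Finset.mem_sdiff.1 hv).1
      exact ⟨Finset.mem_compl.1 (hT₁S v h1), fun h => ((hmU v).1 h).2 ((hmT₁ v).1 h1).1⟩)
    (fun v hv => ⟨((hmU v).1 hv).1, fun h => ((hmU v).1 hv).2 ((hmR v).1 h).1⟩)
    hind
    (fun v hv => (hdom v (Finset.mem_sdiff.1 hv).1).resolve_left (Finset.mem_sdiff.1 hv).2)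
    hc
  rw [← hq] at hpq hcut
  have hcut' : 2 ≤ #I + (q - p) → s + q ≤ #S + #R := by
    intro h2
    have h3 := hcut h2
    rw [mul_add] at h3
    have h4 := Nat.mul_le_mul_right (q - p) hr
    have h5 : ∑ v ∈ I, #(nbrs Γ Sᶜ v) = ∑ v ∈ I, d v := rfl
    omega
  -- The cuts need at least two remaining components, so |I| = 1 and |I| = 0 are treated apart.
  rcases Nat.lt_or_ge 1 #I with hI2 | hI1
  · have h1 := sum_sub_le_of_independent h hrt hSI hind hI2
    have h5 : ∑ v ∈ I, #(nbrs Γ Sᶜ v) = ∑ v ∈ I, d v := rfl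
    exact hmul (by omega) (hcut' (by omega))
  rcases Nat.lt_or_ge 0 #I with hI0 | hI0
  · obtain ⟨v, rfl⟩ := Finset.card_eq_one.1 (le_antisymm hI1 hI0)
    have h1 := lt_card_add_nbrs h hr hrt hn (hIS v (Finset.mem_singleton_self v))
    have h2 : #(nbrs Γ Sᶜ v) = d v := rfl
    rw [Finset.sum_singleton] at hsI hCp
    rw [Finset.card_singleton] at hsI hcut'
    have hsS : s + 1 ≤ #S := by omega
    by_cases hqp : q = p
    swap
    · exact hmul (by omega) (hcut' (by omega))
    -- All classes are bad and |I| = 1, so the main cut leaves too few components. Two or more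
    -- classes are separated by deleting everything outside U; with at most one class, the strict
    -- inequality s < #S suffices.
    by_cases hq2 : 2 ≤ q
    · refine hmul (by omega) ?_
      have h3 := hUcut (insert v (S ∪ R ∪ (T₁ \ {v}))) (fun w => by
        rw [hmU, Finset.mem_insert, Finset.mem_union, Finset.mem_union, Finset.mem_sdiff, hmR, hmT₁,
          Finset.mem_singleton]
        have hvT : w = v → w ∈ T := fun h => by
          rw [h]; exact ((hmT₁ v).1 (hIT (Finset.mem_singleton_self v))).1
        clear * - hvT
        tauto) hq2
      have h4 : #(insert v (S ∪ R ∪ (T₁ \ {v}))) ≤ #S + #R + #(T₁ \ {v}) + 1 :=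
        (Finset.card_insert_le _ _).trans (Nat.succ_le_succ ((Finset.card_union_le _ _).trans
          (Nat.add_le_add_right (Finset.card_union_le _ _) _)))
      have h5 := Nat.mul_le_mul_left r hq2
      omega
    · have h3 := Nat.mul_le_mul_left r hsS
      rw [mul_add] at h3
      omega
  · have hI : I = ∅ := Finset.card_eq_zero.1 (by omega)
    have hT₁e : T₁ = ∅ := by
      rw [Finset.eq_empty_iff_forall_notMem]
      intro v hv
      rcases hdom v hv with h | ⟨w, hw, -⟩
      · rw [hI] at h; exact Finset.notMem_empty _ h
      · rw [hI] at hw; exact Finset.notMem_empty _ hw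
    have hs0 : s = 0 := by rw [hs, hI, Finset.sum_empty]
    have hRT : R = T := by
      ext v
      rw [hmR]
      refine ⟨fun h => h.1, fun hv => ⟨hv, fun hle => ?_⟩⟩
      have := (hmT₁ v).2 ⟨hv, hle⟩
      rw [hT₁e] at this
      exact Finset.notMem_empty _ this
    refine hmul (by omega) ?_
    by_cases hq2 : 2 ≤ q
    · have h3 := hUcut (S ∪ T) (fun w => by rw [hU, Finset.mem_compl, not_not]) hq2
      have h4 := Finset.card_union_le S T
      have h5 := Nat.mul_le_mul_right q hr
      rw [hRT]
      omega
    · have := hT.card_pos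
      rw [hRT]
      omega

theorem edgeDegree_edges (Γ : SimpleGraph V) (v : V) :
    edgeDegree (edges Γ) v = #(nbrs Γ univ v) := by
  rw [edgeDegree_eq]
  symm
  refine Finset.card_bij (fun w _ => s(v, w)) ?_ ?_ ?_
  · intro w hw
    rw [mem_nbrs] at hw
    simp [hw.2]
  · intro w _ w' _ h
    exact Sym2.congr_right.1 h
  · intro e he
    rw [Finset.mem_filter] at he
    obtain ⟨w, rfl⟩ := he.2
    exact ⟨w, mem_nbrs.2 ⟨mem_univ _, by simpa using he.1⟩, rfl⟩

/-- A sufficiently tough graph has a spanning subgraph that is regular up to one vertex. -/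
theorem exists_nearly_regular_factor {Γ : SimpleGraph V} {t : ℝ} (h : ToughColoring Γ t) {r : ℕ}
    (hr : 1 ≤ r) (hrt : (r : ℝ) ≤ t) (hn : r + 1 ≤ Fintype.card V) :
    ∃ F : Finset (Sym2 V), (∀ e ∈ F, e ∈ Γ.edgeSet) ∧
      (∀ v, edgeDegree F v = r ∨ edgeDegree F v = r + 1) ∧
      ∀ v w, edgeDegree F v = r + 1 → edgeDegree F w = r + 1 → v = w := by
  rcases hn.eq_or_lt with hn | hn
  -- On r + 1 vertices, two nonadjacent ones would be separated by the other r − 1 < 2r vertices. So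
  -- the graph is complete and already r-regular.
  · have hcomplete : ∀ x y, x ≠ y → Γ.Adj x y := by
      intro x y hxy
      by_contra hno
      have h1 := h.mul_le hrt ({x, y} : Finset V)ᶜ id (fun a b ha hb hab => by
        rw [Finset.mem_compl, not_not, Finset.mem_insert, Finset.mem_singleton] at ha hb
        rcases ha with rfl | rfl <;> rcases hb with rfl | rfl
        · rfl
        · exact absurd hab hno
        · exact absurd hab.symm hno
        · rfl) le_rfl (by
          rw [compl_compl, ← Finset.card_pair hxy]
          exact Finset.card_le_card fun a ha => mem_palette.2 ⟨a, ha, rfl⟩)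
      rw [Finset.card_compl, Finset.card_pair hxy] at h1
      omega
    have hdeg : ∀ v, edgeDegree (edges Γ) v = r := by
      intro v
      have : nbrs Γ univ v = univ.erase v := by
        ext w
        rw [mem_nbrs, Finset.mem_erase]
        exact ⟨fun h => ⟨h.2.ne', mem_univ _⟩, fun h => ⟨mem_univ _, hcomplete v w h.1.symm⟩⟩
      rw [edgeDegree_edges, this, Finset.card_erase_of_mem (mem_univ _), Finset.card_univ]
      omega
    refine ⟨edges Γ, fun e he => mem_edges.1 he, fun v => Or.inl (hdeg v), fun v w hv => ?_⟩
    rw [hdeg v] at hv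
    omega
  -- If |V|·r is odd, one prescribed degree is raised to r + 1 to make the sum even.
  · obtain ⟨ε, hε, heven⟩ : ∃ ε : V → ℕ, ∑ v, ε v ≤ 1 ∧ Even (∑ v, (r + ε v)) := by
      by_cases hpar : Even (Fintype.card V * r)
      · exact ⟨fun _ => 0, by simp, by simpa using hpar⟩
      · have : Nonempty V := Fintype.card_pos_iff.1 (by omega)
        refine ⟨fun v => if v = Classical.arbitrary V then 1 else 0, by simp, ?_⟩
        rw [Finset.sum_add_distrib]
        simp only [sum_const, card_univ, smul_eq_mul, Finset.sum_ite_eq', mem_univ, if_true]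
        exact (Nat.not_even_iff_odd.1 hpar).add_one
    have hmain : ∀ S T : Finset V, Disjoint S T → ∀ c : V → V,
        #(palette (S ∪ T)ᶜ c) + ∑ v ∈ T, (r + ε v) ≤
        ∑ v ∈ S, (r + ε v) + ∑ v ∈ T, #(nbrs Γ Sᶜ v) + cross (edges Γ) (S ∪ T)ᶜ c + 1 := by
      intro S T hST c
      obtain ⟨c', hc', hle⟩ := exists_const_coloring (edges Γ) (S ∪ T)ᶜ c
      have hc : ∀ x ∈ (S ∪ T)ᶜ, ∀ y ∈ (S ∪ T)ᶜ, Γ.Adj x y → c' x = c' y :=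
        fun x hx y hy hxy => hc' x hx y hy (by simpa using hxy)
      have e1 : ∑ v ∈ T, (r + ε v) ≤ r * #T + 1 := by
        rw [Finset.sum_add_distrib, Finset.sum_const, smul_eq_mul, mul_comm]
        exact Nat.add_le_add_left ((Finset.sum_le_sum_of_subset (Finset.subset_univ T)).trans hε) _
      have e2 : r * #S ≤ ∑ v ∈ S, (r + ε v) := by
        rw [Finset.sum_add_distrib, Finset.sum_const, smul_eq_mul, mul_comm]
        exact Nat.le_add_right _ _
      -- The summand 1 in the factor condition absorbs a single class when T is empty, and the
      -- raised degree when T is nonempty.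
      rcases T.eq_empty_or_nonempty with rfl | hT
      · rw [Finset.union_empty] at hc hle ⊢
        rw [Finset.sum_empty, Finset.sum_empty]
        by_cases hq : 2 ≤ #(palette Sᶜ c')
        · have h1 := h.mul_le hrt S c' (fun x y hx hy hxy =>
            hc x (Finset.mem_compl.2 hx) y (Finset.mem_compl.2 hy) hxy) hq le_rfl
          have h2 := Nat.mul_le_mul_right #(palette Sᶜ c') hr
          have h3 := Nat.mul_le_mul_right #S hr
          omega
        · omega
      · have h1 := palette_add_sum_sub_le h hr hrt hn hST hT hc
        omega
    have hf : ∀ v, r + ε v ≤ #(nbrs Γ univ v) := by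
      intro v
      -- The degree bound is the factor condition for T = {v} with one colour on the rest; that
      -- colour uses up the slack of 1.
      have h1 := hmain ∅ {v} (Finset.disjoint_empty_left _) fun _ => v
      have h2 : cross (edges Γ) (∅ ∪ {v} : Finset V)ᶜ (fun _ => v) = 0 := by
        refine Finset.card_eq_zero.2 (Finset.eq_empty_iff_forall_notMem.2 fun e he => ?_)
        induction e using Sym2.ind with
        | _ x y => exact (mem_crossSet.1 he).2.2 (by simp)
      obtain ⟨w, hw⟩ := Finset.exists_mem_ne (s := univ) (by rw [Finset.card_univ]; omega) v
      have h3 : 1 ≤ #(palette (∅ ∪ {v} : Finset V)ᶜ fun _ => v) :=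
        Finset.card_pos.2 ⟨v, mem_palette.2 ⟨w, by simpa using hw.2, rfl⟩⟩
      rw [h2, Finset.sum_singleton, Finset.sum_singleton, Finset.sum_empty, Finset.compl_empty] at h1
      omega
    obtain ⟨F, hF, hdeg⟩ := exists_factor Γ (fun v => r + ε v) heven hf hmain
    have hε1 : ∀ v, ε v ≤ 1 := fun v =>
      (Finset.single_le_sum (fun _ _ => Nat.zero_le _) (mem_univ v)).trans hε
    refine ⟨F, hF, fun v => ?_, fun v w hv hw => ?_⟩
    · have := hε1 v
      rw [hdeg]
      omega
    · rw [hdeg] at hv hw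
      by_contra hne
      have := Finset.add_le_sum (f := ε) (s := univ) (fun _ _ => Nat.zero_le _)
        (mem_univ v) (mem_univ w) hne
      omega

end RegularFactor

end TreeFactor

namespace TreeFactor
open Finset

/-! ### Between multigraphs and simple graphs. -/

section Transfer

open scoped Graph

variable {α β : Type*}

/-- The simple graph underlying a loopless graph, on the subtype of its vertices. -/
def simplification (G : Graph α β) (hG : G.Loopless) : SimpleGraph V(G) where
  Adj x y := G.Adj x y
  symm := ⟨fun _ _ h => h.symm⟩
  loopless := ⟨fun x => G.not_adj_self x⟩

theorem joined_deleteVerts {G : Graph α β} {κ : Type*} {S : Set α} {c : V(G) → κ}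
    (hc : ∀ x y : V(G), x.1 ∉ S → y.1 ∉ S → G.Adj x y → c x = c y) {x y : α} (hx : x ∈ V(G))
    (h : (G.deleteVerts S).Joined x y) : ∃ hy : y ∈ V(G), c ⟨y, hy⟩ = c ⟨x, hx⟩ := by
  obtain ⟨-, h⟩ := h
  induction h with
  | refl => exact ⟨hx, rfl⟩
  | tail _ hyz ih =>
    obtain ⟨hy, hcy⟩ := ih
    obtain ⟨e, he⟩ := hyz
    rw [Graph.deleteVerts_isLink] at he
    exact ⟨he.1.right_mem, (hc ⟨_, hy⟩ ⟨_, he.1.right_mem⟩ he.2.1 he.2.2 ⟨e, he.1⟩).symm.trans hcy⟩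

theorem finite_componentSets {G : Graph α β} (hV : V(G).Finite) : G.componentSets.Finite :=
  (hV.image fun x => {y | G.Joined x y}).subset fun _ ⟨x, hx, hC⟩ => ⟨x, hx, hC.symm⟩

/-- Representatives of different surviving colours lie in different components after the deletion,
because the colouring is constant along walks there. With at least two colours the alternative 1 in
the maximum is impossible. -/
theorem toughColoring_simplification {G : Graph α β} [Fintype V(G)] [DecidableEq V(G)]
    (hG : G.Loopless) {t : ℝ} (ht : 0 < t) (h : G.IsTough t) :
    ToughColoring (simplification G hG) t := by
  intro S c hc hk
  set S' : Set α := Subtype.val '' (S : Set V(G)) with hS'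
  have hmem : ∀ x : V(G), x.1 ∈ S' ↔ x ∈ S := fun x => by
    simp [hS']
  have hS'V : S' ⊆ V(G) := by
    rintro _ ⟨x, -, rfl⟩
    exact x.2
  have hcard : S'.ncard = #S := by
    rw [hS', Set.ncard_image_of_injective _ Subtype.val_injective, Set.ncard_coe_finset]
  have hrep : ∀ a, ∃ x, a ∈ palette Sᶜ c → x ∉ S ∧ c x = a := fun a => by
    by_cases ha : a ∈ palette Sᶜ c
    · obtain ⟨x, hx, rfl⟩ := mem_palette.1 ha
      exact ⟨x, fun _ => ⟨Finset.mem_compl.1 hx, rfl⟩⟩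
    · exact ⟨a, fun h => absurd h ha⟩
  choose rep hrep using hrep
  have hfin : (G.deleteVerts S').componentSets.Finite :=
    finite_componentSets ((Set.toFinite V(G)).subset (by simp))
  have hle : #(palette Sᶜ c) ≤ (G.deleteVerts S').numComponents := by
    rw [Graph.numComponents, ← Set.ncard_coe_finset]
    refine Set.ncard_le_ncard_of_injOn (fun a => {y | (G.deleteVerts S').Joined (rep a) y}) ?_ ?_ hfin
    · intro a ha
      refine ⟨rep a, ?_, rfl⟩
      rw [Graph.vertexSet_deleteVerts]
      exact ⟨(rep a).2, fun h => (hrep a ha).1 ((hmem _).1 h)⟩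
    · intro a ha b hb hab
      have hb' : (rep b).1 ∈ {y | (G.deleteVerts S').Joined (rep b) y} := by
        refine ⟨?_, .refl⟩
        rw [Graph.vertexSet_deleteVerts]
        exact ⟨(rep b).2, fun h => (hrep b hb).1 ((hmem _).1 h)⟩
      rw [← show {y | (G.deleteVerts S').Joined (rep a) y} =
        {y | (G.deleteVerts S').Joined (rep b) y} from hab] at hb'
      obtain ⟨_, hc'⟩ := joined_deleteVerts (c := c) (fun x y hx hy hxy =>
        hc x y (fun h => hx ((hmem x).2 h)) (fun h => hy ((hmem y).2 h)) hxy) (rep a).2 hb'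
      rw [← (hrep a ha).2, ← (hrep b hb).2]
      exact hc'.symm
  have h1 := h S' hS'V
  rw [hcard] at h1
  have h2 : ((#(palette Sᶜ c) : ℕ) : ℝ) ≤ max 1 (1 / t * (#S : ℝ)) := le_trans (by exact_mod_cast hle) h1
  have hk' : (2 : ℝ) ≤ #(palette Sᶜ c) := by exact_mod_cast hk
  rcases le_max_iff.1 h2 with h3 | h3
  · linarith
  · rw [one_div, ← div_eq_inv_mul, le_div_iff₀ ht] at h3
    linarith

variable {G : Graph α β} {hG : G.Loopless} {φ : Sym2 V(G) → β}

/-- The subgraph of `G` whose edges are chosen by `φ` among the edges joining given vertices. -/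
theorem restrict_image_isLink
    (hφ : ∀ x y : V(G), (simplification G hG).Adj x y → G.IsLink (φ s(x, y)) x y)
    {F : Finset (Sym2 V(G))} (hF : ∀ e ∈ F, e ∈ (simplification G hG).edgeSet) {b : β}
    {x y : V(G)} : (G.restrict (φ '' F)).IsLink b x y ↔ s(x, y) ∈ F ∧ φ s(x, y) = b := by
  rw [Graph.restrict_isLink]
  constructor
  · rintro ⟨⟨e, he, rfl⟩, h⟩
    induction e using Sym2.ind with
    | _ a b =>
      have hab := hφ a b (hF _ he)
      have : s(a, b) = s(x, y) := by
        rcases hab.eq_and_eq_or_eq_and_eq h with ⟨h1, h2⟩ | ⟨h1, h2⟩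
        · rw [Subtype.ext h1, Subtype.ext h2]
        · rw [Subtype.ext h1, Subtype.ext h2, Sym2.eq_swap]
      rw [← this]
      exact ⟨he, rfl⟩
  · rintro ⟨he, rfl⟩
    exact ⟨⟨_, he, rfl⟩, hφ x y (hF _ he)⟩

theorem injOn_edgeChoice
    (hφ : ∀ x y : V(G), (simplification G hG).Adj x y → G.IsLink (φ s(x, y)) x y) :
    Set.InjOn φ (simplification G hG).edgeSet := by
  intro e he f hf h
  induction e using Sym2.ind with
  | _ a b =>
    induction f using Sym2.ind with
    | _ x y =>
      have h1 := hφ a b he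
      have h2 := hφ x y hf
      rw [h] at h1
      rcases h1.eq_and_eq_or_eq_and_eq h2 with ⟨h1, h2⟩ | ⟨h1, h2⟩
      · rw [Subtype.ext h1, Subtype.ext h2]
      · rw [Subtype.ext h1, Subtype.ext h2, Sym2.eq_swap]

theorem vertexDegree_restrict_image
    (hφ : ∀ x y : V(G), (simplification G hG).Adj x y → G.IsLink (φ s(x, y)) x y)
    {F : Finset (Sym2 V(G))} (hF : ∀ e ∈ F, e ∈ (simplification G hG).edgeSet) (v : V(G)) :
    (G.restrict (φ '' F)).vertexDegree v = edgeDegree F v := by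
  classical
  have h1 : (G.restrict (φ '' F)).loopSet v = ∅ := by
    ext b
    simp only [Graph.mem_loopSet, Graph.restrict_isLoopAt, Set.mem_empty_iff_false, iff_false]
    exact fun h => G.not_isLoopAt b v h.1
  have h2 : (G.restrict (φ '' F)).incidenceSet v = φ '' ({e ∈ F | v ∈ e} : Finset _) := by
    ext b
    rw [Graph.mem_incidenceSet]
    constructor
    · rintro ⟨y, hy⟩
      have hyV : y ∈ V(G) := hy.right_mem
      obtain ⟨h1, rfl⟩ := (restrict_image_isLink hφ hF (y := ⟨y, hyV⟩)).1 hy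
      exact ⟨_, Finset.mem_coe.2 (Finset.mem_filter.2 ⟨h1, Sym2.mem_mk_left _ _⟩), rfl⟩
    · rintro ⟨e, he, rfl⟩
      obtain ⟨heF, w, rfl⟩ := Finset.mem_filter.1 (Finset.mem_coe.1 he)
      exact ⟨w, (restrict_image_isLink hφ hF).2 ⟨heF, rfl⟩⟩
  rw [Graph.vertexDegree, h1, h2, Set.ncard_empty, add_zero, Set.InjOn.ncard_image,
    Set.ncard_coe_finset, edgeDegree_eq]
  exact (injOn_edgeChoice hφ).mono fun e he => hF e (Finset.mem_filter.1 (Finset.mem_coe.1 he)).1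

theorem isTreeGraph_restrict_image [Fintype V(G)] [DecidableEq V(G)] [Nonempty V(G)]
    (hφ : ∀ x y : V(G), (simplification G hG).Adj x y → G.IsLink (φ s(x, y)) x y)
    {F : Finset (Sym2 V(G))} (hF : ∀ e ∈ F, e ∈ (simplification G hG).edgeSet)
    (hind : LinearIndepOn (ZMod 2) incidenceVector (F : Set (Sym2 V(G))))
    (hcard : #F + 1 = Fintype.card V(G)) : (G.restrict (φ '' F)).IsTreeGraph := by
  refine ⟨⟨Set.nonempty_coe_sort.1 ‹_›, fun x hx y hy => ⟨hx, ?_⟩⟩, ?_⟩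
  · exact (reflTransGen_of_indep hind hcard ⟨x, hx⟩ ⟨y, hy⟩).lift Subtype.val fun a b hab =>
      ⟨_, (restrict_image_isLink hφ hF).2 ⟨hab, rfl⟩⟩
  · rintro k ⟨v, e, -, he, hv⟩
    have hvV : ∀ i, v i ∈ V(G) := fun i => (hv i).left_mem
    have hl : ∀ i, s((⟨v i, hvV i⟩ : V(G)), ⟨v (i + 1), hvV (i + 1)⟩) ∈ F ∧
        φ s((⟨v i, hvV i⟩ : V(G)), ⟨v (i + 1), hvV (i + 1)⟩) = e i := fun i =>
      (restrict_image_isLink hφ hF).1 (hv i)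
    refine no_cycle_of_indep hind (fun i => (⟨v i, hvV i⟩ : V(G))) (fun i j hij => he ?_)
      fun i => (hl i).1
    rw [← (hl i).2, ← (hl j).2]
    exact congrArg φ hij

end Transfer

end TreeFactor

/-! ### Assembling the spanning subgraph and its trees. -/

theorem mainTheorem8 {α β : Type*} (G : Graph α β)
    (hV : V(G).Finite) (hE : E(G).Finite) (hloopless : G.Loopless)
    (m r : ℕ) (t : ℝ) (hm : 1 ≤ m) (hr : 2 * m ≤ r)
    (ht : max (2 * (m : ℝ) * (r : ℝ) / ((r : ℝ) + 1 - 2 * (m : ℝ))) (r : ℝ) ≤ t)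
    (htough : G.IsTough t) (hcard : r + 1 ≤ V(G).ncard) :
    ∃ H : Graph α β, H ≤s G ∧ H.IsTreeConnected m ∧
      ∀ v ∈ V(H), H.vertexDegree v = r ∨ H.vertexDegree v = r + 1 := by
  classical
  have : Fintype V(G) := hV.fintype
  rw [← Nat.card_coe_set_eq, Nat.card_eq_fintype_card] at hcard
  have hne : Nonempty V(G) := Fintype.card_pos_iff.1 (by omega)
  have hrt : (r : ℝ) ≤ t := (le_max_right _ _).trans ht
  have hr1 : (1 : ℝ) ≤ r := by exact_mod_cast (by omega : 1 ≤ r)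
  have hden : (0 : ℝ) < (r : ℝ) + 1 - 2 * m := by
    have : (2 : ℝ) * m ≤ r := by exact_mod_cast hr
    linarith
  have ht2 : 2 * (m : ℝ) * r ≤ t * (r + 1 - 2 * m) :=
    (div_le_iff₀ hden).1 ((le_max_left _ _).trans ht)
  have hΓ := TreeFactor.toughColoring_simplification hloopless (by linarith) htough
  obtain ⟨F, hF, hdeg, huniq⟩ :=
    TreeFactor.exists_nearly_regular_factor hΓ (by omega : 1 ≤ r) hrt hcard
  obtain ⟨H, hH, htight, hHdeg⟩ := TreeFactor.exists_tight_of_tough hm hr ht2 hΓ hF hdeg huniq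
  obtain ⟨I, hIH, hIdisj, hI⟩ := TreeFactor.exists_tree_packing htight
  -- Choose one of the parallel edges for each adjacent pair. Nonadjacent pairs need a default edge,
  -- which exists because H has positive degrees.
  have hφ : ∃ φ : Sym2 V(G) → β, ∀ x y : V(G),
      (TreeFactor.simplification G hloopless).Adj x y → G.IsLink (φ s(x, y)) x y := by
    obtain ⟨v⟩ := hne
    have hpos : 0 < TreeFactor.edgeDegree H v := by have := hHdeg v; omega
    rw [TreeFactor.edgeDegree_eq] at hpos
    obtain ⟨e, he⟩ := Finset.card_pos.1 hpos
    have heΓ := hH e (Finset.mem_filter.1 he).1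
    have hβ : Nonempty β := by
      induction e using Sym2.ind with
      | _ a b =>
        obtain ⟨b, -⟩ := heΓ
        exact ⟨b⟩
    have hex : ∀ e : Sym2 V(G), ∃ b : β, ∀ x y : V(G), s(x, y) = e → G.Adj x y →
        G.IsLink b x y := by
      intro e
      induction e using Sym2.ind with
      | _ x y =>
        by_cases hxy : G.Adj x y
        · obtain ⟨b, hb⟩ := hxy
          refine ⟨b, fun x' y' h _ => ?_⟩
          rcases Sym2.eq_iff.1 h with ⟨rfl, rfl⟩ | ⟨rfl, rfl⟩
          · exact hb
          · exact hb.symm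
        · refine ⟨Classical.arbitrary β, fun x' y' h h' => absurd ?_ hxy⟩
          rcases Sym2.eq_iff.1 h with ⟨rfl, rfl⟩ | ⟨rfl, rfl⟩
          · exact h'
          · exact h'.symm
    choose φ hφ using hex
    exact ⟨φ, fun x y hxy => hφ _ x y rfl hxy⟩
  obtain ⟨φ, hφ⟩ := hφ
  have hIΓ : ∀ i, ∀ e ∈ I i, e ∈ (TreeFactor.simplification G hloopless).edgeSet :=
    fun i e he => hH e (hIH i he)
  refine ⟨G.restrict (φ '' H), ⟨Graph.restrict_le, rfl⟩,
    ⟨fun i => G.restrict (φ '' I i), fun i => ⟨⟨?_, rfl⟩, ?_⟩, fun i j hij => ?_⟩, fun v hv => ?_⟩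
  · exact G.restrict_mono_right (Set.image_mono (Finset.coe_subset.2 (hIH i)))
  · exact TreeFactor.isTreeGraph_restrict_image hφ (hIΓ i) (hI i).1 (hI i).2
  · refine Set.disjoint_left.2 ?_
    rintro b ⟨-, e, he, rfl⟩ ⟨-, f, hf, hef⟩
    obtain rfl := TreeFactor.injOn_edgeChoice hφ (hIΓ j f hf) (hIΓ i e he) hef
    exact Finset.disjoint_left.1 (hIdisj hij) he hf
  · rw [TreeFactor.vertexDegree_restrict_image hφ hH ⟨v, hv⟩]
    exact hHdeg ⟨v, hv⟩
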